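/- **Setting.** Let $G$ be a finite extensive-form game with $n\ge 1$ players, perfect recall and possibly chance moves. For Player $i$ let $\mathcal I_i$ be the information sets, $\Sigma_i=\{\varnothing_i\}\cup\{(I,a):I\in\mathcal I_i,\ a\in A_I\}$ the sequences, $\Pi_i$ the reduced-normal-form plans and $\Pi_i(\sigma)\subseteq\Pi_i$ those prescribing all moves up to and including $\sigma\in\Sigma_i$. Let $\sigma(I)$ be the parent sequence of $I$, $\sigma_i(z)$ the last sequence of Player $i$ on the path to the leaf $z\in Z$, $Z_I$ the set of leaves whose path meets $I$, $u_i(z)$ the payoffs and $p(z)$ the product of the chance probabilities on the path to $z$. Information sets are connected if some path from the root meets both; sequences of distinct players are relevant if one of them is empty or their information sets are connected. The correlation plan of a distribution $\mu$ on $\prod_i\Pi_i$ is $\xi(\sigma_1,\dots,\sigma_n)=\mu(\prod_i\Pi_i(\sigma_i))$, indexed by the tuples of pairwise relevant sequences; $\Xi$ is the set of all correlation plans. $Y_i\subseteq\mathbb R^{\Sigma_i}$ is the set of vectors $y(\sigma)=\nu(\Pi_i(\sigma))$, $\nu$ a distribution on $\Pi_i$. $F_iy=f_i$ denotes the $|\mathcal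 I_i|+1$ equations $y(\varnothing_i)=1$ and $\sum_{a\in A_I}y(I,a)-y(\sigma(I))=0$ $(I\in\mathcal I_i)$. Write $\xi(\sigma;z)$ for $\xi$ at the tuple $(\sigma_1(z),\dots,\sigma_n(z))$ with entry $i$ replaced by $\sigma\in\Sigma_i$. Player $i$'s utility under $\mu$ is $u_i(\mu)=\sum_z p(z)u_i(z)\,\mu(\pi_j\in\Pi_j(\sigma_j(z))\ \forall j)$. $\mu$ is an **NFCCE** if for all $i$ and all distributions $\nu$ on $\Pi_i$, $u_i(\mu)$ is at least the expected utility $\hat u_i$ of Player $i$ when $i$ plays a plan drawn from $\nu$ independently of $\mu$ and the others follow $\mu$. $\mu$ is an **EFCCE** if for all $i$, $I\in\mathcal I_i$ and distributions $\nu$ on $\Pi_i(\sigma(I))$, $u_i(\mu)$ is at least the expected utility $\hat u_I$ of Player $i$ when $i$ follows $\mu$ until $I$ is reached (if ever) and from then on a plan drawn from $\nu$, independently of $\mu$, while the others follow $\mu$. A correlation plan is called an NFCCE (EFCCE) if it is induced by one; this does not depend on the choice of $\mu$ inducing it. Let $A_i,b_i$ and, for $I\in\mathcal I_i$, $A_{i,I},b_{i,I}$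 be given by $$\xi^\top A_iy=\sum_{z\in Z}p(z)u_i(z)\xi(\varnothing_i;z)y(\sigma_i(z)),\quad b_i^\top\xi=\sum_{z\in Z}p(z)u_i(z)\xi(\sigma_i(z);z),$$ $$\xi^\top A_{i,I}y=\sum_{z\in Z_I}p(z)u_i(z)\xi(\sigma(I);z)y(\sigma_i(z)),\quad b_{i,I}^\top\xi=\sum_{z\in Z_I}p(z)u_i(z)\xi(\sigma_i(z);z).$$ **(1) Saddle point, NFCCE.** $\Xi$ and $\mathcal Y=\{(\lambda,\tilde y):\lambda\in\Delta^n,\ \tilde y_i\in\lambda_iY_i\ \forall i\}$, where $\Delta^n$ is the probability simplex in $\mathbb R^n$, are polytopes, and $\Phi(\xi,(\lambda,\tilde y))=\sum_i(\xi^\top A_i\tilde y_i-\lambda_ib_i^\top\xi)$ is bilinear. The maximum $m(\xi)=\max_{\mathcal Y}\Phi(\xi,\cdot)$ exists for every $\xi$; for the correlation plan $\xi$ of $\mu$ it equals the maximum of $\hat u_i-u_i(\mu)$ over all $i,\nu$, and $\mu$ is an NFCCE iff $m(\xi)\le 0$. The set $\operatorname{argmin}_{\xi\in\Xi}m(\xi)$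 is nonempty and consists of NFCCEs. For every vector $c$ and every $\tau\in\mathbb R$ such that some NFCCE has $c^\top\xi\ge\tau$, the set $\operatorname{argmin}\{m(\xi):\xi\in\Xi,\ c^\top\xi\ge\tau\}$ is nonempty and consists of NFCCEs. The maximum of $c^\top\xi$ over all NFCCEs exists, and if $\tau$ is this maximum, the elements of this argmin are NFCCEs maximizing $c^\top\xi$. Social welfare $\sum_iu_i(\mu)$ is the linear objective $c=\sum_ib_i$. **(2) Linear program, NFCCE.** For every $\xi$, $m(\xi)$ is the minimum of $u$ over all $u\in\mathbb R$, $v_i\in\mathbb R^{|\mathcal I_i|+1}$ with $$u-v_i^\top f_i+b_i^\top\xi\ge 0,\qquad F_i^\top v_i-A_i^\top\xi\ge 0\qquad\forall i.\tag{D}$$ The set of all $(\xi,u,v)$ with (D), $u\le 0$ and $\xi\in\Xi$ is described by finitely many linear inequalities; its $\xi$-components are exactly the NFCCEs. For every $c$, the linear program of maximizing $c^\top\xi$ over this set has a solution, and the $\xi$-components of its solutions are exactly the NFCCEs maximizing $c^\top\xi$. **(3) EFCCE.** The maximum of $c^\top\xi$ over all EFCCEs exists for every $c$. If $G$ has at least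 one information set, all of (1) holds for EFCCE with $\Delta$ the simplex over all pairs $(i,I)$, $I\in\mathcal I_i$, with $\tilde y_{i,I}\in\lambda_{i,I}\{y\in Y_i:y(\sigma(I))=1\}$, objective $\sum_{i,I}(\xi^\top A_{i,I}\tilde y_{i,I}-\lambda_{i,I}b_{i,I}^\top\xi)$ and deviation benefits $\hat u_I-u_i(\mu)$; and the inner maximum equals the minimum of $u$ over all $u,w_{i,I}\in\mathbb R$, $v_{i,I}\in\mathbb R^{|\mathcal I_i|+1}$ with $$u-w_{i,I}-v_{i,I}^\top f_i+b_{i,I}^\top\xi\ge 0,\qquad F_i^\top v_{i,I}+w_{i,I}e_{\sigma(I)}-A_{i,I}^\top\xi\ge 0\qquad\forall i,I,$$ where $e_{\sigma(I)}$ is the unit vector of the coordinate $\sigma(I)$. In all cases, the linear program of maximizing $c^\top\xi$ subject to these constraints, $u\le 0$ and $\xi\in\Xi$ has the properties stated in (2), with EFCCE in place of NFCCE. **(4) Size.** For every fixed $n$ there is a polynomial $P$ such that for every $n$-player game with $N$ nodes both linear programs have at most $P(N)$ variables, and, if $\Xi$ is described by $k$ linear inequalities, they can be written with at most $k+P(N)$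 inequalities. **(5) Two players, no chance.** If $n=2$ and there are no chance moves, then $\Xi$ is the set of all $\xi\ge 0$ with $\xi(\varnothing_1,\varnothing_2)=1$, $\sum_{a\in A_I}\xi((I,a),\tau)=\xi(\sigma(I),\tau)$ for all $I\in\mathcal I_1$, $\tau\in\Sigma_2$ such that $(I,a),\tau$ are relevant, and symmetrically for Player 2. There is a polynomial $P$ such that for every such game with $N$ nodes, $\Xi$ and the feasible sets of both linear programs are described by at most $P(N)$ linear inequalities. -/

import Mathlib

open scoped Matrix Pointwise

/-! ## Extensive-form games -/

/-- The moves (information set, action) of Player `i` on the path from the root to the node `h`,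
most recent first.  A node is the list of the actions that lead to it from the root, most recent
first, so `a :: h` is the child of `h` along the edge `a`. -/
def ownMoves {A I : Type} {n : ℕ} (infoset : List A → Option I) (player : I → Fin n) (i : Fin n) :
    List A → List (I × A)
  | [] => []
  | a :: h =>
    match infoset h with
    | some J => if player J = i then (J, a) :: ownMoves infoset player i h
        else ownMoves infoset player i h
    | none => ownMoves infoset player i h

/-- Finite `n`-player extensive-form games with perfect recall, possibly with chance moves.
Nodes are action histories (most recent action first); `u <:+ v` says that `u` is on the path from
the root to `v`. -/
structure ExtensiveGame (n : ℕ) where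
  /-- labels of actions -/
  Act : Type
  /-- information sets of all players -/
  Info : Type
  [actFintype : Fintype Act]
  [infoFintype : Fintype Info]
  /-- the game tree -/
  nodes : Finset (List Act)
  root_mem : [] ∈ nodes
  parent_mem : ∀ a h, a :: h ∈ nodes → h ∈ nodes
  /-- the information set of a decision node; `none` at chance nodes and at leaves -/
  infoset : List Act → Option Info
  /-- the player to whom an information set belongs -/
  player : Info → Fin n
  /-- the set `A_I` of actions available at every node of the information set `I` -/
  acts : Info → Finset Act
  mem_acts_iff : ∀ h ∈ nodes, ∀ I, infoset h = some I → ∀ a, a ∈ acts I ↔ a :: h ∈ nodes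
  acts_nonempty : ∀ I, (acts I).Nonempty
  info_nonempty : ∀ I, ∃ h ∈ nodes, infoset h = some I
  /-- two nodes of an information set are preceded by the same moves of its player -/
  perfect_recall : ∀ h ∈ nodes, ∀ h' ∈ nodes, ∀ I, infoset h = some I → infoset h' = some I →
    ownMoves infoset player (player I) h = ownMoves infoset player (player I) h'
  /-- probability with which chance picks the action `a` at the chance node `h` -/
  chance : List Act → Act → ℝ
  chance_nonneg : ∀ a h, a :: h ∈ nodes → infoset h = none → 0 ≤ chance h a
  chance_sum : ∀ h ∈ nodes, infoset h = none → (∃ a, a :: h ∈ nodes) →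
    open scoped Classical in ∑ a with a :: h ∈ nodes, chance h a = 1
  /-- payoff of each player at each leaf -/
  payoff : Fin n → List Act → ℝ

attribute [instance] ExtensiveGame.actFintype ExtensiveGame.infoFintype

noncomputable section

open scoped Classical

namespace ExtensiveGame

variable {n : ℕ} (G : ExtensiveGame n)

/-- the number of nodes of the game tree -/
def size : ℕ := G.nodes.card

/-- the leaves of the game tree -/
def leaves : Finset (List G.Act) := {h ∈ G.nodes | ∀ a, a :: h ∉ G.nodes}

/-- the game has no chance moves: a node without an information set is a leaf -/
def NoChance : Prop := ∀ h ∈ G.nodes, G.infoset h = none → h ∈ G.leaves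

/-- probability that chance plays all of its actions on the path from the root to a node -/
def chanceReach : List G.Act → ℝ
  | [] => 1
  | a :: h => chanceReach h * if G.infoset h = none then G.chance h a else 1

/-- the information sets of Player `i` -/
abbrev InfoOf (i : Fin n) : Type := {I : G.Info // G.player I = i}

/-- moves of Player `i` on the path to `h`, most recent first -/
abbrev moves (i : Fin n) (h : List G.Act) : List (G.Info × G.Act) :=
  ownMoves G.infoset G.player i h

/-- some node of the information set `I` (by perfect recall the choice is immaterial below) -/
def rep (I : G.Info) : List G.Act := (G.info_nonempty I).choose

theorem rep_mem (I : G.Info) : G.rep I ∈ G.nodes := (G.info_nonempty I).choose_spec.1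

theorem infoset_rep (I : G.Info) : G.infoset (G.rep I) = some I :=
  (G.info_nonempty I).choose_spec.2

/-! ### Sequences -/

/-- The sequences of Player `i`: `none` is the empty sequence, `some (I, a)` the sequence `(I, a)`
with `I` an information set of Player `i` and `a ∈ A_I`. -/
abbrev Seq (i : Fin n) : Type :=
  {s : Option (G.Info × G.Act) // ∀ m ∈ s, G.player m.1 = i ∧ m.2 ∈ G.acts m.1}

/-- the empty sequence -/
def emptySeq (i : Fin n) : G.Seq i := ⟨none, by simp⟩

/-- the sequence `(I, a)` -/
def moveSeq (I : G.Info) (a : G.acts I) : G.Seq (G.player I) :=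
  ⟨some (I, a.1), by rintro m hm; cases hm; exact ⟨rfl, a.2⟩⟩

theorem moves_spec (i : Fin n) (h : List G.Act) (hh : h ∈ G.nodes) :
    ∀ m ∈ G.moves i h, G.player m.1 = i ∧ m.2 ∈ G.acts m.1 := by
  induction h with
  | nil => simp [moves, ownMoves]
  | cons a h ih =>
    have hp := G.parent_mem a h hh
    intro m hm
    unfold moves ownMoves at hm
    split at hm
    · next J hJ =>
      split_ifs at hm with hi
      · rcases List.mem_cons.1 hm with rfl | hm
        · exact ⟨hi, (G.mem_acts_iff h hp J hJ a).2 hh⟩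
        · exact ih hp m hm
      · exact ih hp m hm
    · exact ih hp m hm

/-- `σ_i(h)`: the last sequence of Player `i` on the path from the root to the node `h` -/
def seqAt (i : Fin n) (h : List G.Act) (hh : h ∈ G.nodes) : G.Seq i :=
  ⟨(G.moves i h).head?, fun m hm => G.moves_spec i h hh m (List.mem_of_mem_head? hm)⟩

/-- `σ(I)`: the parent sequence of an information set -/
def parentSeq (I : G.Info) : G.Seq (G.player I) := G.seqAt (G.player I) (G.rep I) (G.rep_mem I)

theorem leaf_mem (z : G.leaves) : z.1 ∈ G.nodes := (Finset.mem_filter.1 z.2).1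

/-- `σ_i(z)` for a leaf `z` -/
def leafSeq (i : Fin n) (z : G.leaves) : G.Seq i := G.seqAt i z.1 (G.leaf_mem z)

/-- two information sets are connected -/
def Connected (I J : G.Info) : Prop :=
  ∃ u ∈ G.nodes, ∃ v ∈ G.nodes, G.infoset u = some I ∧ G.infoset v = some J ∧ (u <:+ v ∨ v <:+ u)

/-- two sequences (of distinct players) are relevant -/
def Relevant {i j : Fin n} (s : G.Seq i) (t : G.Seq j) : Prop :=
  ∀ m ∈ s.1, ∀ m' ∈ t.1, G.Connected m.1 m'.1

/-- tuples of pairwise relevant sequences, one for each player -/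
abbrev RelTuple : Type := {s : ∀ i, G.Seq i // ∀ i j, i ≠ j → G.Relevant (s i) (s j)}

instance : Fintype G.RelTuple := inferInstance

/-- the tuple of empty sequences -/
def emptyTuple : G.RelTuple := ⟨G.emptySeq, fun i j _ m hm => by simp [emptySeq] at hm⟩

/-! ### Reduced-normal-form plans -/

/-- Reduced-normal-form plans of Player `i`: an action is chosen exactly at those information sets
of Player `i` that are reachable given the other choices of the plan. -/
abbrev Plan (i : Fin n) : Type :=
  {p : G.Info → Option G.Act // ∀ I,
    if G.player I = i ∧ ∀ m ∈ G.moves i (G.rep I), p m.1 = some m.2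
    then ∃ a ∈ G.acts I, p I = some a else p I = none}

/-- all moves up to and including a sequence of Player `i` -/
def seqMoves {i : Fin n} (s : G.Seq i) : List (G.Info × G.Act) :=
  match s.1 with
  | none => []
  | some m => m :: G.moves i (G.rep m.1)

/-- `p ∈ Π_i(s)`: the plan `p` prescribes all moves up to and including the sequence `s` -/
def Plays {i : Fin n} (p : G.Plan i) (s : G.Seq i) : Prop :=
  ∀ m ∈ G.seqMoves s, p.1 m.1 = some m.2

/-- probability distributions over the plans of Player `i` -/
abbrev PlanDist (i : Fin n) : Set (G.Plan i → ℝ) := stdSimplex ℝ (G.Plan i)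

/-- correlated distributions, that is, probability distributions over plan profiles -/
abbrev CorrDist : Set ((∀ i, G.Plan i) → ℝ) := stdSimplex ℝ (∀ i, G.Plan i)

/-! ### Sequence-form strategies and correlation plans -/

/-- the sequence-form strategy induced by `ν` -/
def inducedSeq (i : Fin n) (ν : G.Plan i → ℝ) : G.Seq i → ℝ :=
  fun s => ∑ p with G.Plays p s, ν p

/-- the polytope of sequence-form strategies of Player `i` -/
def seqForm (i : Fin n) : Set (G.Seq i → ℝ) := G.inducedSeq i '' G.PlanDist i

/-- The matrix `F_i`; row `none` is the constraint `y(∅) = 1` and row `some I` the constraint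
`∑_{a ∈ A_I} y(I, a) - y(σ(I)) = 0`. -/
def flowMat (i : Fin n) : Matrix (Option (G.InfoOf i)) (G.Seq i) ℝ :=
  fun r s => match r with
  | none => if s = G.emptySeq i then 1 else 0
  | some I => (if ∃ a, s.1 = some (I.1, a) then 1 else 0) -
      (if s.1 = (G.parentSeq I.1).1 then 1 else 0)

/-- the right-hand side `f_i` -/
def flowRhs (i : Fin n) : Option (G.InfoOf i) → ℝ :=
  fun r => match r with
  | none => 1
  | some _ => 0

/-- the correlation plan induced by `μ` -/
def corrPlan (μ : (∀ i, G.Plan i) → ℝ) : G.RelTuple → ℝ :=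
  fun t => ∑ p with ∀ i, G.Plays (p i) (t.1 i), μ p

/-- `Ξ`: the polytope of extensive-form correlation plans -/
def corrPolytope : Set (G.RelTuple → ℝ) := G.corrPlan '' G.CorrDist

/-- `ξ` at a tuple of sequences, and `0` if the tuple is not pairwise relevant -/
def extend (ξ : G.RelTuple → ℝ) (s : ∀ i, G.Seq i) : ℝ :=
  if h : ∀ i j, i ≠ j → G.Relevant (s i) (s j) then ξ ⟨s, h⟩ else 0

/-- The tuples whose entries are nonnegative, equal `1` at the empty tuple, and satisfy
`∑_{a ∈ A_I} ξ(…, (I, a), …) = ξ(…, σ(I), …)` for all information sets `I` and all sequences of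
the other players for which these tuples are relevant. -/
def flowPolytope : Set (G.RelTuple → ℝ) :=
  {ξ | (∀ t, 0 ≤ ξ t) ∧ ξ G.emptyTuple = 1 ∧
    ∀ (I : G.Info) (t : G.RelTuple), t.1 (G.player I) = G.parentSeq I →
      (∀ a : G.acts I, ∀ i j, i ≠ j →
        G.Relevant (Function.update t.1 (G.player I) (G.moveSeq I a) i)
          (Function.update t.1 (G.player I) (G.moveSeq I a) j)) →
      ∑ a : G.acts I, G.extend ξ (Function.update t.1 (G.player I) (G.moveSeq I a)) = ξ t}

/-! ### Equilibria -/

/-- expected utility of Player `i` if everybody follows the recommendations sampled from `μ` -/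
def utility (μ : (∀ i, G.Plan i) → ℝ) (i : Fin n) : ℝ :=
  ∑ z : G.leaves, G.chanceReach z * G.payoff i z *
    ∑ p with ∀ j, G.Plays (p j) (G.leafSeq j z), μ p

/-- social welfare -/
def welfare (μ : (∀ i, G.Plan i) → ℝ) : ℝ := ∑ i, G.utility μ i

/-- expected utility of Player `i` if Player `i` plays according to `ν`, independent of `μ`, and
everybody else follows the recommendations sampled from `μ` -/
def deviationUtility (μ : (∀ i, G.Plan i) → ℝ) (i : Fin n) (ν : G.Plan i → ℝ) : ℝ :=
  ∑ z : G.leaves, G.chanceReach z * G.payoff i z *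
    (∑ p with ∀ j, j ≠ i → G.Plays (p j) (G.leafSeq j z), μ p) *
    ∑ q with G.Plays q (G.leafSeq i z), ν q

/-- normal-form coarse-correlated equilibria -/
def IsNFCCE (μ : (∀ i, G.Plan i) → ℝ) : Prop :=
  μ ∈ G.CorrDist ∧ ∀ i, ∀ ν ∈ G.PlanDist i, G.deviationUtility μ i ν ≤ G.utility μ i

/-- the path from the root to `z` passes through a node of `I` -/
def Through (I : G.Info) (z : List G.Act) : Prop := ∃ v, v <:+ z ∧ G.infoset v = some I

/-- probability distributions over `Π_i(I)`, where `i` is the player of `I` -/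
def triggerDist (I : G.Info) : Set (G.Plan (G.player I) → ℝ) :=
  {ν ∈ G.PlanDist (G.player I) | ∀ p, ν p ≠ 0 → G.Plays p (G.parentSeq I)}

/-- expected utility of the `(I, ν)`-trigger agent: Player `i`, the player of `I`, follows the
recommendations until a node of `I` is reached (if any) and from then on plays a plan sampled from
`ν`, while everybody else follows the recommendations sampled from `μ` -/
def triggerUtility (μ : (∀ i, G.Plan i) → ℝ) (I : G.Info) (ν : G.Plan (G.player I) → ℝ) : ℝ :=
  ∑ z : G.leaves, G.chanceReach z * G.payoff (G.player I) z *
    if G.Through I z then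
      (∑ p with G.Plays (p (G.player I)) (G.parentSeq I) ∧
        ∀ j, j ≠ G.player I → G.Plays (p j) (G.leafSeq j z), μ p) *
      ∑ q with G.Plays q (G.leafSeq (G.player I) z), ν q
    else ∑ p with ∀ j, G.Plays (p j) (G.leafSeq j z), μ p

/-- extensive-form coarse-correlated equilibria -/
def IsEFCCE (μ : (∀ i, G.Plan i) → ℝ) : Prop :=
  μ ∈ G.CorrDist ∧ ∀ I, ∀ ν ∈ G.triggerDist I, G.triggerUtility μ I ν ≤ G.utility μ (G.player I)

/-- correlation plans of NFCCEs -/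
def nfccePlans : Set (G.RelTuple → ℝ) := G.corrPlan '' {μ | G.IsNFCCE μ}

/-- correlation plans of EFCCEs -/
def efccePlans : Set (G.RelTuple → ℝ) := G.corrPlan '' {μ | G.IsEFCCE μ}

/-! ### The matrices and vectors of the incentive constraints -/

/-- the tuple `(σ_1(z), …, s, …, σ_n(z))` with the sequence `s` in place `i` -/
def leafTuple (i : Fin n) (s : G.Seq i) (z : G.leaves) : ∀ j, G.Seq j :=
  Function.update (fun j => G.leafSeq j z) i s

/-- `A_i`: `ξᵀ A_i y = ∑_z u_i(z) ξ(∅_i; z) y(σ_i(z))`, with chance probabilities -/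
def matA (i : Fin n) : Matrix G.RelTuple (G.Seq i) ℝ :=
  fun t s => ∑ z : G.leaves, if t.1 = G.leafTuple i (G.emptySeq i) z ∧ s = G.leafSeq i z
    then G.chanceReach z * G.payoff i z else 0

/-- `b_i`: `b_iᵀ ξ = ∑_z u_i(z) ξ(σ_i(z); z)`, with chance probabilities -/
def vecB (i : Fin n) : G.RelTuple → ℝ :=
  fun t => ∑ z : G.leaves, if t.1 = G.leafTuple i (G.leafSeq i z) z
    then G.chanceReach z * G.payoff i z else 0

/-- `A_{i,I}`: `ξᵀ A_{i,I} y = ∑_{z ∈ Z_I} u_i(z) ξ(σ(I); z) y(σ_i(z))` -/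
def trigA (I : G.Info) : Matrix G.RelTuple (G.Seq (G.player I)) ℝ :=
  fun t s => ∑ z : G.leaves, if G.Through I z ∧ t.1 = G.leafTuple (G.player I) (G.parentSeq I) z ∧
      s = G.leafSeq (G.player I) z
    then G.chanceReach z * G.payoff (G.player I) z else 0

/-- `b_{i,I}`: `b_{i,I}ᵀ ξ = ∑_{z ∈ Z_I} u_i(z) ξ(σ_i(z); z)` -/
def trigB (I : G.Info) : G.RelTuple → ℝ :=
  fun t => ∑ z : G.leaves, if G.Through I z ∧
      t.1 = G.leafTuple (G.player I) (G.leafSeq (G.player I) z) z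
    then G.chanceReach z * G.payoff (G.player I) z else 0

/-! ### Saddle-point problems -/

/-- pairs `(λ, ỹ)` with `λ` in the `n`-simplex and `ỹ_i ∈ λ_i Y_i` -/
def nfcceDomain : Set ((Fin n → ℝ) × (∀ i, G.Seq i → ℝ)) :=
  {p | p.1 ∈ stdSimplex ℝ (Fin n) ∧ ∀ i, p.2 i ∈ p.1 i • G.seqForm i}

/-- `∑_i (ξᵀ A_i ỹ_i - λ_i b_iᵀ ξ)` -/
def nfcceObj (ξ : G.RelTuple → ℝ) (p : (Fin n → ℝ) × (∀ i, G.Seq i → ℝ)) : ℝ :=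
  ∑ i, (ξ ⬝ᵥ (G.matA i *ᵥ p.2 i) - p.1 i * (G.vecB i ⬝ᵥ ξ))

/-- the value of the inner maximization problem -/
def nfcceInner (ξ : G.RelTuple → ℝ) : ℝ := sSup (G.nfcceObj ξ '' G.nfcceDomain)

/-- pairs `(λ, ỹ)` with `λ` in the simplex over all pairs `(i, I)` of a player and one of her
information sets, and `ỹ_I ∈ λ_I {y ∈ Y_i : y(σ(I)) = 1}` -/
def efcceDomain : Set ((G.Info → ℝ) × (∀ I : G.Info, G.Seq (G.player I) → ℝ)) :=
  {p | p.1 ∈ stdSimplex ℝ G.Info ∧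
    ∀ I, p.2 I ∈ p.1 I • {y ∈ G.seqForm (G.player I) | y (G.parentSeq I) = 1}}

/-- `∑_I (ξᵀ A_{i,I} ỹ_I - λ_I b_{i,I}ᵀ ξ)` -/
def efcceObj (ξ : G.RelTuple → ℝ) (p : (G.Info → ℝ) × (∀ I : G.Info, G.Seq (G.player I) → ℝ)) :
    ℝ :=
  ∑ I, (ξ ⬝ᵥ (G.trigA I *ᵥ p.2 I) - p.1 I * (G.trigB I ⬝ᵥ ξ))

/-- the value of the inner maximization problem -/
def efcceInner (ξ : G.RelTuple → ℝ) : ℝ := sSup (G.efcceObj ξ '' G.efcceDomain)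

/-! ### Linear programs -/

/-- the constraints of the dual of the inner maximization problem, in the variables `u`, `v_i` -/
def NFCCEDual (ξ : G.RelTuple → ℝ) (u : ℝ) (v : ∀ i, Option (G.InfoOf i) → ℝ) : Prop :=
  (∀ i, 0 ≤ u - v i ⬝ᵥ G.flowRhs i + G.vecB i ⬝ᵥ ξ) ∧
  ∀ i s, 0 ≤ ((G.flowMat i)ᵀ *ᵥ v i) s - ((G.matA i)ᵀ *ᵥ ξ) s

/-- the variables of the linear program for NFCCE: the entries of `ξ`, then `u`, then the entries
of all `v_i` -/
abbrev NFCCEVar : Type := G.RelTuple ⊕ Unit ⊕ (Σ i, Option (G.InfoOf i))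

/-- the feasible set of the linear program for NFCCE -/
def nfcceLP : Set (G.NFCCEVar → ℝ) :=
  {x | G.NFCCEDual (fun t => x (.inl t)) (x (.inr (.inl ()))) (fun i r => x (.inr (.inr ⟨i, r⟩))) ∧
    x (.inr (.inl ())) ≤ 0 ∧ (fun t => x (.inl t)) ∈ G.corrPolytope}

/-- the constraints of the dual of the inner maximization problem, in the variables `u`, `w_I`,
`v_I`; the variable `w_I`, dual to the constraint `y(σ(I)) = 1`, occurs in the row of `σ(I)` -/
def EFCCEDual (ξ : G.RelTuple → ℝ) (u : ℝ) (w : G.Info → ℝ)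
    (v : ∀ I : G.Info, Option (G.InfoOf (G.player I)) → ℝ) : Prop :=
  (∀ I, 0 ≤ u - w I - v I ⬝ᵥ G.flowRhs (G.player I) + G.trigB I ⬝ᵥ ξ) ∧
  ∀ I s, 0 ≤ ((G.flowMat (G.player I))ᵀ *ᵥ v I) s + (if s = G.parentSeq I then w I else 0) -
    ((G.trigA I)ᵀ *ᵥ ξ) s

/-- the variables of the linear program for EFCCE: the entries of `ξ`, then `u`, then all `w_I`,
then the entries of all `v_I` -/
abbrev EFCCEVar : Type :=
  G.RelTuple ⊕ Unit ⊕ G.Info ⊕ (Σ I : G.Info, Option (G.InfoOf (G.player I)))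

/-- the feasible set of the linear program for EFCCE -/
def efcceLP : Set (G.EFCCEVar → ℝ) :=
  {x | G.EFCCEDual (fun t => x (.inl t)) (x (.inr (.inl ()))) (fun I => x (.inr (.inr (.inl I))))
      (fun I r => x (.inr (.inr (.inr ⟨I, r⟩)))) ∧
    x (.inr (.inl ())) ≤ 0 ∧ (fun t => x (.inl t)) ∈ G.corrPolytope}

end ExtensiveGame

/-! ## Optimization -/

/-- a polytope: the convex hull of finitely many points -/
def IsPolytope {E : Type} [AddCommGroup E] [Module ℝ E] (S : Set E) : Prop :=
  ∃ F : Set E, F.Finite ∧ S = convexHull ℝ F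

/-- `S` is the solution set of `m` linear inequalities -/
def IsSolutionSet {V : Type} [Fintype V] (S : Set (V → ℝ)) (m : ℕ) : Prop :=
  ∃ (M : Matrix (Fin m) V ℝ) (q : Fin m → ℝ), S = {x | q ≤ M *ᵥ x}

/-- the minimizers of `g` over `X` -/
def argminOn {E : Type} (g : E → ℝ) (X : Set E) : Set E := {x ∈ X | ∀ x' ∈ X, g x ≤ g x'}

/-- the maximizers of `g` over `X` -/
def argmaxOn {E : Type} (g : E → ℝ) (X : Set E) : Set E := {x ∈ X | ∀ x' ∈ X, g x' ≤ g x}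

end

/-!
The proof rests on one observation about a single player. For weights `g` on her sequences, backward
induction computes values `v` of her information sets together with a plan that chooses optimally
everywhere; these values are a feasible solution of the dual program `F_iᵀ v ≥ g` whose objective
`vᵀ f_i` equals the value of this plan (`exists_dual`). So strong duality for the inner maximization
problems needs no general theory of linear programming. For EFCCE, where the deviating player has to
play `σ(I)`, a bonus on the coordinate `σ(I)` that exceeds all differences of payoffs enforces this,
and minus the bonus is the dual variable `w_I` (`exists_dual_of_plays`). Together with the separation
theorem, duality also shows that the nonnegative solutions of `F_i y = f_i` are the sequence-form
strategies (`mem_seqForm_iff`).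

Utilities under deviations depend on a correlated distribution only through its correlation plan, so
being an equilibrium means that finitely many linear functionals, one for each deviation to a pure
plan, are nonpositive at the correlation plan (`nfccePlans_eq`, `efccePlans_eq`). The inner value is
the maximum of these functionals, and all statements about minimizers, maximizers and linear programs
follow by compactness, once equilibria are known to exist.

Existence is a minimax argument (`exists_forall_nonpos_of_forall_weights`): for given weights on the
deviations it suffices to find a correlation plan at which the weighted sum of the benefits
vanishes, and independent strategies do this. For NFCCE each player plays the weighted mixture of
her deviations. For EFCCE she plays a strategy `y` that is invariant under the averaged trigger
deviations, that is, with `λ_I` the weight of the triggers at `I` and `r_I` the vector of the deviation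
scaled by `λ_I`, `∑_I λ_I y(s) = ∑_I y(σ(I)) r_I(s)` for every sequence `s`, where `I` ranges over the
information sets at which `s` moves. This equation can be solved from the root downwards
(`exists_stationary`).

In two-player games without chance moves, let `ξ` solve the flow equations. By the separation
theorem it suffices that for all weights `g` on the relevant pairs of sequences some pure profile
does at least as well as `ξ`. This is shown by induction over the game tree, for pairs that are
relevant within a subtree (`pureOptimal`). At the root of a subtree, where one player moves, the
flow equations distribute the weights among the moves. After a move, the information sets of the
opponent that do not meet the subtree of the move are connected only to the move itself and to what
precedes it, so they can be eliminated by backward induction for the opponent alone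
(`exists_elimination`); the remaining weights live on the subtree of the move. Finally the best move
is chosen.

That the feasible sets are described by finitely many inequalities follows from Fourier–Motzkin
elimination of the weights in a convex combination (`exists_isSolutionSet_convexHull_range`).
-/


noncomputable section

open scoped Classical

/-! ### Convexity and linear inequalities -/

theorem convexHull_range_eq_image {P E : Type} [Fintype P] [AddCommGroup E] [Module ℝ E]
    (e : P → E) :
    convexHull ℝ (Set.range e) = (fun ν : P → ℝ => ∑ p, ν p • e p) '' stdSimplex ℝ P := by
  have h : (fun ν : P → ℝ => ∑ p, ν p • e p) = Fintype.linearCombination ℝ e := by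
    ext ν
    rw [Fintype.linearCombination_apply]
  rw [h, ← convexHull_rangle_single_eq_stdSimplex, LinearMap.image_convexHull, ← Set.range_comp]
  congr 2
  ext p
  simp [Fintype.linearCombination_apply_single]

theorem sum_smul_mem_convexHull {P E : Type} [Fintype P] [AddCommGroup E] [Module ℝ E]
    (e : P → E) {S : Set P} {ν : P → ℝ} (hν : ν ∈ stdSimplex ℝ P) (hS : ∀ p, ν p ≠ 0 → p ∈ S) :
    ∑ p, ν p • e p ∈ convexHull ℝ (e '' S) := by
  have h1 : ∑ p, ν p • e p = ∑ p with p ∈ S, ν p • e p := by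
    rw [Finset.sum_filter]
    refine Finset.sum_congr rfl fun p _ => ?_
    split_ifs with hp
    · rfl
    · rw [not_imp_comm.1 (hS p) hp, zero_smul]
  have h2 : ∑ p with p ∈ S, ν p = 1 := by
    rw [← hν.2, Finset.sum_filter]
    refine Finset.sum_congr rfl fun p _ => ?_
    split_ifs with hp
    · rfl
    · rw [not_imp_comm.1 (hS p) hp]
  rw [h1]
  refine (convex_convexHull ℝ _).sum_mem (fun p _ => hν.1 p) h2 fun p hp => ?_
  exact subset_convexHull ℝ _ ⟨p, (Finset.mem_filter.1 hp).2, rfl⟩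

theorem isPolytope_convexHull_range {P E : Type} [Finite P] [AddCommGroup E] [Module ℝ E]
    (e : P → E) : IsPolytope (convexHull ℝ (Set.range e)) := ⟨_, Set.finite_range e, rfl⟩

/-- A linear functional on `V → ℝ` is the inner product with a vector. -/
theorem dotProduct_single_eq {V : Type} [Fintype V] (f : (V → ℝ) →ₗ[ℝ] ℝ) (x : V → ℝ) :
    (fun v => f (Pi.single v 1)) ⬝ᵥ x = f x := by
  rw [LinearMap.pi_apply_eq_sum_univ f x]
  refine Finset.sum_congr rfl fun v _ => ?_
  have : (fun j => if v = j then (1 : ℝ) else 0) = Pi.single v 1 := by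
    ext j
    simp [Pi.single_apply, eq_comm]
  rw [this, smul_eq_mul, mul_comm]

/-- A point that no linear functional separates from a closed convex set belongs to it. -/
theorem mem_of_forall_dotProduct_le {V : Type} [Fintype V] {C : Set (V → ℝ)} (hC : Convex ℝ C)
    (hC' : IsClosed C) {x : V → ℝ} (h : ∀ g : V → ℝ, ∃ c ∈ C, g ⬝ᵥ x ≤ g ⬝ᵥ c) : x ∈ C := by
  by_contra hx
  obtain ⟨f, u, h1, h2⟩ := geometric_hahn_banach_closed_point hC hC' hx
  obtain ⟨c, hc, hle⟩ := h fun v => f (Pi.single v 1)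
  have e1 := dotProduct_single_eq f.toLinearMap x
  have e2 := dotProduct_single_eq f.toLinearMap c
  simp only [ContinuousLinearMap.coe_coe] at e1 e2
  rw [e1, e2] at hle
  linarith [h1 c hc]

/-- Solution sets of finitely many linear inequalities, indexed by an arbitrary finite type. -/
theorem isSolutionSet_of {V κ : Type} [Fintype V] [Fintype κ] {S : Set (V → ℝ)}
    (L : κ → (V → ℝ) →ₗ[ℝ] ℝ) (q : κ → ℝ) (h : ∀ x, x ∈ S ↔ ∀ k, q k ≤ L k x) :
    IsSolutionSet S (Fintype.card κ) := by
  refine ⟨fun k v => L ((Fintype.equivFin κ).symm k) (Pi.single v 1),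
    fun k => q ((Fintype.equivFin κ).symm k), ?_⟩
  ext x
  rw [h, Set.mem_ofPred_eq, Pi.le_def]
  have key : ∀ k, ((fun k v => L ((Fintype.equivFin κ).symm k) (Pi.single v 1) :
      Matrix (Fin (Fintype.card κ)) V ℝ) *ᵥ x) k = L ((Fintype.equivFin κ).symm k) x :=
    fun k => dotProduct_single_eq _ x
  simp only [key]
  exact ((Fintype.equivFin κ).symm.forall_congr_right (q := fun k => q k ≤ L k x)).symm

theorem IsSolutionSet.exists_linear {V : Type} [Fintype V] {S : Set (V → ℝ)} {m : ℕ}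
    (h : IsSolutionSet S m) :
    ∃ (L : Fin m → (V → ℝ) →ₗ[ℝ] ℝ) (q : Fin m → ℝ), ∀ x, x ∈ S ↔ ∀ k, q k ≤ L k x := by
  obtain ⟨M, q, rfl⟩ := h
  refine ⟨fun k => (LinearMap.proj k).comp M.mulVecLin, q, fun x => ?_⟩
  rfl

/-- Solution sets may be intersected with further inequalities after a linear change of
variables. -/
theorem IsSolutionSet.inter_preimage {V W κ : Type} [Fintype V] [Fintype W] [Fintype κ]
    {S : Set (V → ℝ)} {k : ℕ} (hS : IsSolutionSet S k) (T : (W → ℝ) →ₗ[ℝ] (V → ℝ))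
    (L : κ → (W → ℝ) →ₗ[ℝ] ℝ) (q : κ → ℝ) {R : Set (W → ℝ)}
    (h : ∀ x, x ∈ R ↔ T x ∈ S ∧ ∀ j, q j ≤ L j x) : IsSolutionSet R (k + Fintype.card κ) := by
  obtain ⟨L', q', h'⟩ := hS.exists_linear
  have := isSolutionSet_of (S := R) (Sum.elim (fun j => (L' j).comp T) L) (Sum.elim q' q) (by
    intro x
    rw [h, h', Sum.forall]
    rfl)
  simpa using this

/-- Fourier–Motzkin elimination of one variable. -/
theorem fourier_motzkin {E κ : Type} [AddCommGroup E] [Module ℝ E] [Fintype κ]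
    (L : κ → E →ₗ[ℝ] ℝ) (d q : κ → ℝ) :
    ∃ (κ' : Type) (_ : Fintype κ') (L' : κ' → E →ₗ[ℝ] ℝ) (q' : κ' → ℝ),
      ∀ x, (∃ t : ℝ, ∀ k, q k ≤ L k x + d k * t) ↔ ∀ k, q' k ≤ L' k x := by
  let A := {k // 0 < d k}
  let B := {k // d k < 0}
  let Z := {k // d k = 0}
  refine ⟨(A × B) ⊕ Z, inferInstance,
    Sum.elim (fun p => d p.1.1 • L p.2.1 - d p.2.1 • L p.1.1) (fun z => L z.1),
    Sum.elim (fun p => d p.1.1 * q p.2.1 - d p.2.1 * q p.1.1) (fun z => q z.1), fun x => ?_⟩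
  constructor
  · rintro ⟨t, ht⟩ (⟨⟨a, ha⟩, ⟨b, hb⟩⟩ | ⟨z, hz⟩)
    · simp only [Sum.elim_inl, LinearMap.sub_apply, LinearMap.smul_apply, smul_eq_mul]
      nlinarith [mul_le_mul_of_nonneg_left (ht b) ha.le,
        mul_le_mul_of_nonpos_left (ht a) hb.le]
    · simpa [hz] using ht z
  · intro h
    -- the lower bounds on `t` are below the upper bounds
    have hAB : ∀ (a : A) (b : B), (q a.1 - L a.1 x) / d a.1 ≤ (q b.1 - L b.1 x) / d b.1 := by
      intro a b
      have := h (Sum.inl (a, b))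
      simp only [Sum.elim_inl, LinearMap.sub_apply, LinearMap.smul_apply, smul_eq_mul] at this
      rw [div_le_iff₀ a.2, div_mul_eq_mul_div, le_div_iff_of_neg b.2]
      linarith
    obtain ⟨t, h1, h2⟩ : ∃ t : ℝ, (∀ a : A, (q a.1 - L a.1 x) / d a.1 ≤ t) ∧
        ∀ b : B, t ≤ (q b.1 - L b.1 x) / d b.1 := by
      by_cases hA : Nonempty A
      · obtain ⟨a, -, ha⟩ := Finset.exists_max_image Finset.univ
          (fun a : A => (q a.1 - L a.1 x) / d a.1) Finset.univ_nonempty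
        exact ⟨_, fun a' => ha a' (Finset.mem_univ _), fun b => hAB a b⟩
      · by_cases hB : Nonempty B
        · obtain ⟨b, -, hb⟩ := Finset.exists_min_image Finset.univ
            (fun b : B => (q b.1 - L b.1 x) / d b.1) Finset.univ_nonempty
          exact ⟨_, fun a => absurd ⟨a⟩ hA, fun b' => hb b' (Finset.mem_univ _)⟩
        · exact ⟨0, fun a => absurd ⟨a⟩ hA, fun b => absurd ⟨b⟩ hB⟩
    refine ⟨t, fun k => ?_⟩
    rcases lt_trichotomy (d k) 0 with hk | hk | hk
    · have := h2 ⟨k, hk⟩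
      rw [le_div_iff_of_neg hk] at this
      linarith
    · have := h (Sum.inr ⟨k, hk⟩)
      simp only [Sum.elim_inr] at this
      rw [hk]
      linarith
    · have := h1 ⟨k, hk⟩
      rw [div_le_iff₀ hk] at this
      linarith

/-- Fourier–Motzkin elimination of finitely many variables. -/
theorem fourier_motzkin_fin {E : Type} [AddCommGroup E] [Module ℝ E] (m : ℕ) :
    ∀ {κ : Type} [Fintype κ] (L : κ → (E × (Fin m → ℝ)) →ₗ[ℝ] ℝ) (q : κ → ℝ),
    ∃ (κ' : Type) (_ : Fintype κ') (L' : κ' → E →ₗ[ℝ] ℝ) (q' : κ' → ℝ),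
      ∀ x, (∃ t, ∀ k, q k ≤ L k (x, t)) ↔ ∀ k, q' k ≤ L' k x := by
  induction m with
  | zero =>
    intro κ _ L q
    refine ⟨κ, inferInstance, fun k => (L k).comp (LinearMap.inl ℝ E _), q, fun x => ?_⟩
    constructor
    · rintro ⟨t, ht⟩ k
      rw [Subsingleton.elim t 0] at ht
      exact ht k
    · exact fun h => ⟨0, h⟩
  | succ m ih =>
    intro κ _ L q
    -- the last `m` variables, and the first one
    let T : (E × (Fin m → ℝ)) →ₗ[ℝ] (E × (Fin (m + 1) → ℝ)) :=
      LinearMap.prod (LinearMap.fst ℝ _ _)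
        (LinearMap.pi (Fin.cons 0 fun j => (LinearMap.proj j).comp (LinearMap.snd ℝ _ _)))
    have hT : ∀ x t (s : ℝ), ((x, Fin.cons s t) : E × (Fin (m + 1) → ℝ)) =
        T (x, t) + s • ((0 : E), Pi.single 0 (1 : ℝ)) := by
      intro x t s
      refine Prod.ext (by simp [T]) ?_
      funext j
      refine Fin.cases ?_ (fun j => ?_) j
      · simp [T]
      · simp [T, Fin.succ_ne_zero]
    obtain ⟨κ₁, _, L₁, q₁, h₁⟩ := fourier_motzkin (fun k => (L k).comp T)
      (fun k => L k ((0 : E), Pi.single 0 (1 : ℝ))) q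
    obtain ⟨κ₂, i₂, L₂, q₂, h₂⟩ := ih L₁ q₁
    refine ⟨κ₂, i₂, L₂, q₂, fun x => ?_⟩
    rw [← h₂, ← (Fin.consEquiv fun _ => ℝ).exists_congr_right]
    simp only [← h₁]
    rw [Prod.exists, exists_comm]
    refine exists_congr fun t => exists_congr fun s => forall_congr' fun k => ?_
    change q k ≤ L k (x, Fin.cons s t) ↔ _
    rw [hT, map_add, map_smul, smul_eq_mul, mul_comm]
    rfl

/-- A polytope is the solution set of finitely many linear inequalities. -/
theorem exists_isSolutionSet_convexHull_range {V P : Type} [Fintype V] [Fintype P]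
    (e : P → V → ℝ) : ∃ m, IsSolutionSet (convexHull ℝ (Set.range e)) m := by
  let φ := Fintype.equivFin P
  let X : (((V → ℝ) × (Fin (Fintype.card P) → ℝ))) →ₗ[ℝ] (V → ℝ) := LinearMap.fst ℝ _ _
  let Y : P → (((V → ℝ) × (Fin (Fintype.card P) → ℝ))) →ₗ[ℝ] ℝ :=
    fun p => (LinearMap.proj (φ p)).comp (LinearMap.snd ℝ _ _)
  let W : (((V → ℝ) × (Fin (Fintype.card P) → ℝ))) →ₗ[ℝ] ℝ := ∑ p, Y p
  let D : V → (((V → ℝ) × (Fin (Fintype.card P) → ℝ))) →ₗ[ℝ] ℝ :=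
    fun v => (LinearMap.proj v).comp X - ∑ p, e p v • Y p
  -- nonnegative weights `ν` with sum `1` and `x = ∑ p, ν p • e p`
  obtain ⟨κ, _, L, q, h⟩ := fourier_motzkin_fin (Fintype.card P)
    (κ := P ⊕ Bool ⊕ V × Bool)
    (Sum.elim Y (Sum.elim (fun b => if b then W else -W) fun r => if r.2 then D r.1 else -D r.1))
    (Sum.elim 0 (Sum.elim (fun b => if b then 1 else -1) 0))
  refine ⟨_, isSolutionSet_of L q fun x => ?_⟩
  rw [← h, convexHull_range_eq_image, Set.mem_image,
    ← (φ.arrowCongr (Equiv.refl ℝ)).exists_congr_right]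
  refine exists_congr fun ν => ?_
  have hY : ∀ p, Y p (x, φ.arrowCongr (Equiv.refl ℝ) ν) = ν p := fun p => by simp [Y]
  have hW : W (x, φ.arrowCongr (Equiv.refl ℝ) ν) = ∑ p, ν p := by simp [W, hY]
  have hD : ∀ v, D v (x, φ.arrowCongr (Equiv.refl ℝ) ν) = x v - ∑ p, ν p * e p v := fun v => by
    simp [D, hY, X, mul_comm]
  simp only [Sum.forall, Sum.elim_inl, Sum.elim_inr, Bool.forall_bool, Prod.forall, hY]
  simp only [if_true, Bool.false_eq_true, if_false, LinearMap.neg_apply, hW, hD, Pi.zero_apply]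
  constructor
  · rintro ⟨⟨h1, h2⟩, rfl⟩
    refine ⟨h1, ⟨by linarith, by linarith⟩, fun v => ?_⟩
    simp [Finset.sum_apply]
  · rintro ⟨h1, ⟨h2, h3⟩, h4⟩
    refine ⟨⟨h1, by linarith⟩, ?_⟩
    funext v
    have := h4 v
    simp only [Finset.sum_apply, Pi.smul_apply, smul_eq_mul]
    linarith [this.1, this.2]

/-! ### Minimization of maxima of linear functionals -/

/-- A minimax argument: if every nonnegative combination of finitely many linear functionals is
nonpositive somewhere on a compact convex set, then they are nonpositive simultaneously at some
point of this set. -/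
theorem exists_forall_nonpos_of_forall_weights {V K : Type} [Fintype V] [Fintype K]
    {X : Set (V → ℝ)} (hX : Convex ℝ X) (hX' : IsCompact X) (f : K → (V → ℝ) →ₗ[ℝ] ℝ)
    (h : ∀ w : K → ℝ, (∀ k, 0 ≤ w k) → ∃ x ∈ X, ∑ k, w k * f k x ≤ 0) :
    ∃ x ∈ X, ∀ k, f k x ≤ 0 := by
  by_contra hcon
  push Not at hcon
  let T : (V → ℝ) →ₗ[ℝ] (K → ℝ) := LinearMap.pi f
  have hT : Continuous T := T.continuous_of_finiteDimensional
  have hdisj : Disjoint (T '' X) (Set.Iic (0 : K → ℝ)) := by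
    rw [Set.disjoint_left]
    rintro _ ⟨x, hx, rfl⟩ hle
    obtain ⟨k, hk⟩ := hcon x hx
    exact absurd (hle k) (not_le.2 hk)
  obtain ⟨φ, u, v, h1, h2, h3⟩ := geometric_hahn_banach_compact_closed (hX.linear_image T)
    (hX'.image hT) (convex_Iic 0) isClosed_Iic hdisj
  have hv : v < 0 := by simpa using h3 0 (Set.mem_Iic.2 le_rfl)
  have hw : ∀ k, 0 ≤ -φ (Pi.single k 1) := by
    intro k
    by_contra hk
    push Not at hk
    have hk' : 0 < φ (Pi.single k 1) := by linarith
    -- a large negative multiple of the `k`-th unit vector violates the lower bound `v`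
    have := h3 ((v / φ (Pi.single k 1)) • Pi.single k (1 : ℝ)) (by
      rw [Set.mem_Iic]
      refine smul_nonpos_of_nonpos_of_nonneg ?_ ?_
      · exact (div_neg_of_neg_of_pos hv hk').le
      · rw [Pi.single_nonneg]
        exact zero_le_one)
    rw [map_smul, smul_eq_mul, div_mul_cancel₀ _ hk'.ne'] at this
    exact lt_irrefl _ this
  obtain ⟨x, hx, hle⟩ := h _ hw
  have e := dotProduct_single_eq φ.toLinearMap (T x)
  have h4 := h1 (T x) ⟨x, hx, rfl⟩
  simp only [ContinuousLinearMap.coe_coe, dotProduct] at e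
  have e2 : ∑ k, -φ (Pi.single k 1) * f k x = -φ (T x) := by
    rw [← e, ← Finset.sum_neg_distrib]
    exact Finset.sum_congr rfl fun k _ => neg_mul _ _
  rw [e2] at hle
  linarith

/-- Pairs of a weight vector in the simplex and points of the accordingly scaled polytopes form a
polytope, whose vertices put all the weight on a vertex of one of the polytopes. -/
theorem weighted_eq_convexHull {ι : Type} [Fintype ι] {P E : ι → Type} [∀ k, Fintype (P k)]
    [∀ k, Nonempty (P k)] [∀ k, AddCommGroup (E k)] [∀ k, Module ℝ (E k)] (e : ∀ k, P k → E k) :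
    {p : (ι → ℝ) × (∀ k, E k) | p.1 ∈ stdSimplex ℝ ι ∧
      ∀ k, p.2 k ∈ p.1 k • convexHull ℝ (Set.range (e k))} =
    convexHull ℝ (Set.range fun x : Σ k, P k =>
      ((Pi.single x.1 1, Pi.single x.1 (e x.1 x.2)) : (ι → ℝ) × (∀ k, E k))) := by
  have key : ∀ ν : (Σ k, P k) → ℝ, ∑ x, ν x •
      ((Pi.single x.1 1, Pi.single x.1 (e x.1 x.2)) : (ι → ℝ) × (∀ k, E k)) =
      (fun k => ∑ a, ν ⟨k, a⟩, fun k => ∑ a, ν ⟨k, a⟩ • e k a) := by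
    intro ν
    rw [Fintype.sum_sigma]
    refine Prod.ext ?_ ?_
    · funext k
      rw [Prod.fst_sum, Finset.sum_apply, Finset.sum_eq_single k]
      · simp [Prod.fst_sum, Finset.sum_apply]
      · intro j _ hj
        simp [Prod.fst_sum, Finset.sum_apply, Pi.single_eq_of_ne hj.symm]
      · simp
    · funext k
      rw [Prod.snd_sum, Finset.sum_apply, Finset.sum_eq_single k]
      · simp [Prod.snd_sum, Finset.sum_apply]
      · intro j _ hj
        simp [Prod.snd_sum, Finset.sum_apply, Pi.single_eq_of_ne hj.symm]
      · simp
  rw [convexHull_range_eq_image]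
  simp only [key]
  ext ⟨l, y⟩
  simp only [Set.mem_ofPred_eq, Set.mem_image]
  constructor
  · rintro ⟨hl, hy⟩
    choose y' hy' hyy using fun k => Set.mem_smul_set.1 (hy k)
    choose ν hν hνy using fun k => by
      have := hy' k
      rw [convexHull_range_eq_image] at this
      exact this
    refine ⟨fun x => l x.1 * ν x.1 x.2, ⟨fun x => mul_nonneg (hl.1 _) ((hν _).1 _), ?_⟩,
      Prod.ext ?_ ?_⟩
    · rw [Fintype.sum_sigma]
      simp only [← Finset.mul_sum, (hν _).2, mul_one]
      exact hl.2
    · funext k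
      simp only [← Finset.mul_sum, (hν _).2, mul_one]
    · funext k
      simp only [mul_smul, ← Finset.smul_sum]
      rw [← hyy, ← hνy]
  · rintro ⟨ν, hν, h⟩
    obtain ⟨rfl, rfl⟩ := Prod.ext_iff.1 h
    dsimp only
    refine ⟨⟨fun k => Finset.sum_nonneg fun a _ => hν.1 _, ?_⟩, fun k => ?_⟩
    · rw [← hν.2, Fintype.sum_sigma]
    · have hn : ∀ a, 0 ≤ ν ⟨k, a⟩ := fun a => hν.1 _
      by_cases h0 : ∑ a, ν ⟨k, a⟩ = 0
      · have hz : ∀ a, ν ⟨k, a⟩ = 0 := fun a =>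
          (Finset.sum_eq_zero_iff_of_nonneg fun a _ => hn a).1 h0 a (Finset.mem_univ a)
        simp only [hz, zero_smul, Finset.sum_const_zero]
        rw [Set.zero_smul_set (((Set.range_nonempty (e k))).convexHull)]
        rfl
      · refine Set.mem_smul_set.2 ⟨∑ a, (ν ⟨k, a⟩ / ∑ a, ν ⟨k, a⟩) • e k a, ?_, ?_⟩
        · rw [convexHull_range_eq_image]
          refine ⟨_, ⟨fun a => div_nonneg (hn a) (Finset.sum_nonneg fun a _ => hn a), ?_⟩, rfl⟩
          rw [← Finset.sum_div, div_self h0]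
        · rw [Finset.smul_sum]
          refine Finset.sum_congr rfl fun a _ => ?_
          rw [smul_smul, mul_div_cancel₀ _ h0]

/-- A linear functional attains its maximum over a polytope at a vertex. -/
theorem isGreatest_image_convexHull_range {P E : Type} [Fintype P] [Nonempty P] [AddCommGroup E]
    [Module ℝ E] (f : E →ₗ[ℝ] ℝ) (e : P → E) :
    IsGreatest (f '' convexHull ℝ (Set.range e))
      (Finset.univ.sup' Finset.univ_nonempty fun p => f (e p)) := by
  constructor
  · obtain ⟨p, -, hp⟩ := Finset.exists_mem_eq_sup' Finset.univ_nonempty fun p => f (e p)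
    exact ⟨e p, subset_convexHull ℝ _ ⟨p, rfl⟩, hp.symm⟩
  · rintro _ ⟨x, hx, rfl⟩
    have hsub : convexHull ℝ (Set.range e) ⊆
        {x | f x ≤ Finset.univ.sup' Finset.univ_nonempty fun p => f (e p)} := by
      refine convexHull_min ?_ (convex_halfSpace_le f.isLinear _)
      rintro _ ⟨p, rfl⟩
      exact Finset.le_sup' (fun p => f (e p)) (Finset.mem_univ p)
    exact hsub hx

theorem exists_mem_argminOn {E : Type} [TopologicalSpace E] {X : Set E} (hX : IsCompact X)
    (hne : X.Nonempty) {m : E → ℝ} (hm : Continuous m) : (argminOn m X).Nonempty := by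
  obtain ⟨x, hx, h⟩ := hX.exists_isMinOn hne hm.continuousOn
  exact ⟨x, hx, fun y hy => h hy⟩

theorem exists_mem_argmaxOn {E : Type} [TopologicalSpace E] {X : Set E} (hX : IsCompact X)
    (hne : X.Nonempty) {m : E → ℝ} (hm : Continuous m) : (argmaxOn m X).Nonempty := by
  obtain ⟨x, hx, h⟩ := hX.exists_isMaxOn hne hm.continuousOn
  exact ⟨x, hx, fun y hy => h hy⟩

/-- If some point of `Y ⊆ X` has `m ≤ 0`, then so do all minimizers of `m` over `Y`. -/
theorem argminOn_subset {E : Type} {X Y : Set E} {m : E → ℝ} (hYX : Y ⊆ X)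
    (h : ∃ y ∈ Y, m y ≤ 0) : argminOn m Y ⊆ {x ∈ X | m x ≤ 0} := by
  rintro x ⟨hx, hmin⟩
  obtain ⟨y, hy, hy0⟩ := h
  exact ⟨hYX hx, (hmin y hy).trans hy0⟩

theorem argminOn_inter_halfSpace {V : Type} [Fintype V] {X : Set (V → ℝ)} (hX : IsCompact X)
    {m : (V → ℝ) → ℝ} (hm : Continuous m) (c : V → ℝ) (τ : ℝ)
    (h : ∃ x ∈ {x ∈ X | m x ≤ 0}, τ ≤ c ⬝ᵥ x) :
    (argminOn m (X ∩ {x | τ ≤ c ⬝ᵥ x})).Nonempty ∧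
      argminOn m (X ∩ {x | τ ≤ c ⬝ᵥ x}) ⊆ {x ∈ X | m x ≤ 0} := by
  obtain ⟨x, ⟨hx, hx0⟩, hτ⟩ := h
  have hcl : IsClosed {x : V → ℝ | τ ≤ c ⬝ᵥ x} :=
    isClosed_le continuous_const (continuous_const.dotProduct continuous_id)
  exact ⟨exists_mem_argminOn (hX.inter_right hcl) ⟨x, hx, hτ⟩ hm,
    argminOn_subset Set.inter_subset_left ⟨x, ⟨hx, hτ⟩, hx0⟩⟩

theorem argminOn_inter_argmaxOn {V : Type} [Fintype V] {X : Set (V → ℝ)} (hX : IsCompact X)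
    {m : (V → ℝ) → ℝ} (hm : Continuous m) (c : V → ℝ) (x₀ : V → ℝ)
    (h : x₀ ∈ argmaxOn (fun x => c ⬝ᵥ x) {x ∈ X | m x ≤ 0}) :
    (argminOn m (X ∩ {x | c ⬝ᵥ x₀ ≤ c ⬝ᵥ x})).Nonempty ∧
      argminOn m (X ∩ {x | c ⬝ᵥ x₀ ≤ c ⬝ᵥ x}) ⊆
        argmaxOn (fun x => c ⬝ᵥ x) {x ∈ X | m x ≤ 0} := by
  obtain ⟨h1, h2⟩ := argminOn_inter_halfSpace hX hm c (c ⬝ᵥ x₀) ⟨x₀, h.1, le_rfl⟩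
  exact ⟨h1, fun x hx => ⟨h2 hx, fun y hy => (h.2 y hy).trans hx.1.2⟩⟩

theorem image_argmaxOn_comp {E F : Type} (π : E → F) (c : F → ℝ) (X : Set E) :
    π '' argmaxOn (fun x => c (π x)) X = argmaxOn c (π '' X) := by
  ext y
  constructor
  · rintro ⟨x, ⟨hx, hmax⟩, rfl⟩
    refine ⟨⟨x, hx, rfl⟩, ?_⟩
    rintro _ ⟨x', hx', rfl⟩
    exact hmax x' hx'
  · rintro ⟨⟨x, hx, rfl⟩, hmax⟩
    exact ⟨x, ⟨hx, fun x' hx' => hmax _ ⟨x', hx', rfl⟩⟩, rfl⟩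

theorem continuous_sup'_linear {V K : Type} [Fintype V] [Fintype K] [Nonempty K]
    (f : K → (V → ℝ) →ₗ[ℝ] ℝ) :
    Continuous fun x => Finset.univ.sup' Finset.univ_nonempty fun k => f k x :=
  Continuous.finset_sup'_apply _ fun k _ => (f k).continuous_of_finiteDimensional

/-! ### Saddle-point problems over weighted polytopes -/

instance Sigma.nonempty_of_forall {ι : Type} {P : ι → Type} [Nonempty ι] [∀ k, Nonempty (P k)] :
    Nonempty (Σ k, P k) := nonempty_sigma.2 ⟨Classical.arbitrary ι, inferInstance⟩

section WeightedSaddlePoint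

variable {V ι : Type} [Fintype V] {W P : ι → Type} [∀ k, Fintype (W k)]
  (A : ∀ k, Matrix V (W k) ℝ) (b : ι → V → ℝ) (e : ∀ k, P k → W k → ℝ)

/-- the benefit `ξᵀ A_k y - b_kᵀ ξ` of the deviation `y`, as a functional of `ξ` -/
def benefit (k : ι) (y : W k → ℝ) : (V → ℝ) →ₗ[ℝ] ℝ where
  toFun ξ := ξ ⬝ᵥ (A k *ᵥ y) - b k ⬝ᵥ ξ
  map_add' ξ ξ' := by
    rw [add_dotProduct, dotProduct_add]
    ring
  map_smul' c ξ := by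
    rw [smul_dotProduct, dotProduct_smul, RingHom.id_apply, smul_sub]

theorem benefit_apply (k : ι) (y : W k → ℝ) (ξ : V → ℝ) :
    benefit A b k y ξ = ξ ⬝ᵥ (A k *ᵥ y) - b k ⬝ᵥ ξ := rfl

theorem benefit_le_of_mem_convexHull {ξ : V → ℝ} {u : ℝ} {k : ι}
    (h : ∀ p, benefit A b k (e k p) ξ ≤ u) {y : W k → ℝ}
    (hy : y ∈ convexHull ℝ (Set.range (e k))) : benefit A b k y ξ ≤ u := by
  have hlin : convexHull ℝ (Set.range (e k)) ⊆ {y | ξ ⬝ᵥ (A k *ᵥ y) ≤ u + b k ⬝ᵥ ξ} := by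
    refine convexHull_min ?_ (convex_halfSpace_le ⟨fun x y => ?_, fun c x => ?_⟩ _)
    · rintro _ ⟨p, rfl⟩
      have := h p
      rw [benefit_apply] at this
      exact sub_le_iff_le_add.1 this
    · rw [Matrix.mulVec_add, dotProduct_add]
    · rw [Matrix.mulVec_smul, dotProduct_smul]
  exact sub_le_iff_le_add.2 (hlin hy)

variable [Fintype ι]

/-- the bilinear form `∑_k (ξᵀ A_k ỹ_k - λ_k b_kᵀ ξ)` -/
def weightedForm : (V → ℝ) →ₗ[ℝ] ((ι → ℝ) × (∀ k, W k → ℝ)) →ₗ[ℝ] ℝ :=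
  LinearMap.mk₂ ℝ (fun ξ p => ∑ k, (ξ ⬝ᵥ (A k *ᵥ p.2 k) - p.1 k * (b k ⬝ᵥ ξ)))
    (fun ξ ξ' p => by
      rw [← Finset.sum_add_distrib]
      refine Finset.sum_congr rfl fun k _ => ?_
      rw [add_dotProduct, dotProduct_add]
      ring)
    (fun c ξ p => by
      rw [Finset.smul_sum]
      refine Finset.sum_congr rfl fun k _ => ?_
      rw [smul_dotProduct, dotProduct_smul]
      simp only [smul_eq_mul]
      ring)
    (fun ξ p p' => by
      rw [← Finset.sum_add_distrib]
      refine Finset.sum_congr rfl fun k _ => ?_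
      rw [Prod.snd_add, Prod.fst_add, Pi.add_apply, Pi.add_apply, Matrix.mulVec_add,
        dotProduct_add]
      ring)
    (fun c ξ p => by
      rw [Finset.smul_sum]
      refine Finset.sum_congr rfl fun k _ => ?_
      rw [Prod.smul_snd, Prod.smul_fst, Pi.smul_apply, Pi.smul_apply, Matrix.mulVec_smul,
        dotProduct_smul]
      simp only [smul_eq_mul]
      ring)

theorem weightedForm_vertex (ξ : V → ℝ) (k : ι) (y : W k → ℝ) :
    weightedForm A b ξ (Pi.single k 1, Pi.single k y) = benefit A b k y ξ := by
  change ∑ j, (ξ ⬝ᵥ (A j *ᵥ (Pi.single k y : ∀ k, W k → ℝ) j) -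
    (Pi.single k 1 : ι → ℝ) j * (b j ⬝ᵥ ξ)) = _
  rw [Finset.sum_eq_single k]
  · simp [benefit_apply]
  · intro j _ hj
    simp [Pi.single_eq_of_ne hj]
  · simp

variable [Nonempty ι] [∀ k, Fintype (P k)] [∀ k, Nonempty (P k)]

/-- the largest benefit `ξᵀ A_k y - b_kᵀ ξ` of a vertex `y` -/
def maxBenefit (ξ : V → ℝ) : ℝ :=
  Finset.univ.sup' Finset.univ_nonempty fun x : Σ k, P k => benefit A b x.1 (e x.1 x.2) ξ

theorem continuous_maxBenefit : Continuous (maxBenefit A b e) :=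
  continuous_sup'_linear fun x : Σ k, P k => benefit A b x.1 (e x.1 x.2)

theorem maxBenefit_le_iff (ξ : V → ℝ) (u : ℝ) :
    maxBenefit A b e ξ ≤ u ↔ ∀ k p, benefit A b k (e k p) ξ ≤ u := by
  simp [maxBenefit, Finset.sup'_le_iff, Sigma.forall]

theorem isLeast_maxBenefit (ξ : V → ℝ) :
    IsLeast {u | ∀ k p, benefit A b k (e k p) ξ ≤ u} (maxBenefit A b e ξ) :=
  ⟨(maxBenefit_le_iff A b e ξ _).1 le_rfl, fun u hu => (maxBenefit_le_iff A b e ξ u).2 hu⟩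

theorem isGreatest_weightedForm (ξ : V → ℝ) :
    IsGreatest (weightedForm A b ξ '' {p | p.1 ∈ stdSimplex ℝ ι ∧
      ∀ k, p.2 k ∈ p.1 k • convexHull ℝ (Set.range (e k))}) (maxBenefit A b e ξ) := by
  rw [weighted_eq_convexHull]
  have := isGreatest_image_convexHull_range (weightedForm A b ξ) (fun x : Σ k, P k =>
    ((Pi.single x.1 1, Pi.single x.1 (e x.1 x.2)) : (ι → ℝ) × (∀ k, W k → ℝ)))
  simp only [weightedForm_vertex] at this
  exact this

theorem isGreatest_benefit (ξ : V → ℝ) :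
    IsGreatest {d | ∃ k, ∃ y ∈ convexHull ℝ (Set.range (e k)), d = benefit A b k y ξ}
      (maxBenefit A b e ξ) := by
  constructor
  · obtain ⟨⟨k, p⟩, -, h⟩ := Finset.exists_mem_eq_sup' Finset.univ_nonempty
      fun x : Σ k, P k => benefit A b x.1 (e x.1 x.2) ξ
    exact ⟨k, e k p, subset_convexHull ℝ _ ⟨p, rfl⟩, h⟩
  · rintro _ ⟨k, y, hy, rfl⟩
    exact benefit_le_of_mem_convexHull A b e ((maxBenefit_le_iff A b e ξ _).1 le_rfl k) hy

end WeightedSaddlePoint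

/-! ### Recursion along a rank -/

/-- Definition by recursion along a rank function: an operator whose value at `a` depends only on
the values at points of smaller rank has a fixed point. -/
theorem exists_fixedPoint_of_rank {α β : Type} [Nonempty β] (r : α → ℕ) (Φ : (α → β) → α → β)
    (hΦ : ∀ y y' a, (∀ b, r b < r a → y b = y' b) → Φ y a = Φ y' a) : ∃ y, ∀ a, y a = Φ y a := by
  let b₀ : β := Classical.arbitrary β
  let F : ∀ a, (∀ b, r b < r a → β) → β :=
    fun a ih => Φ (fun b => if h : r b < r a then ih b h else b₀) a
  refine ⟨(measure r).wf.fix F, fun a => ?_⟩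
  rw [WellFounded.fix_eq]
  refine hΦ _ _ a fun b hb => ?_
  exact dif_pos hb

namespace ExtensiveGame

variable {n : ℕ} {G : ExtensiveGame n}

/-! ### Paths and moves -/

theorem moves_nil (i : Fin n) : G.moves i [] = [] := rfl

theorem moves_cons_own {i : Fin n} {h : List G.Act} {J : G.Info} (a : G.Act)
    (hJ : G.infoset h = some J) (hi : G.player J = i) :
    G.moves i (a :: h) = (J, a) :: G.moves i h := by
  unfold moves
  rw [ownMoves]
  simp [hJ, hi]

theorem moves_cons_other {i : Fin n} {h : List G.Act} (a : G.Act)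
    (hh : ∀ J, G.infoset h = some J → G.player J ≠ i) :
    G.moves i (a :: h) = G.moves i h := by
  unfold moves
  rw [ownMoves]
  cases hJ : G.infoset h with
  | none => simp
  | some J => simp [hh J hJ]

theorem moves_suffix_cons (i : Fin n) (a : G.Act) (h : List G.Act) :
    G.moves i h <:+ G.moves i (a :: h) := by
  by_cases hh : ∃ J, G.infoset h = some J ∧ G.player J = i
  · obtain ⟨J, hJ, hi⟩ := hh
    rw [moves_cons_own a hJ hi]
    exact List.suffix_cons _ _
  · push Not at hh
    rw [moves_cons_other a hh]

theorem moves_suffix (i : Fin n) {u v : List G.Act} (h : u <:+ v) :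
    G.moves i u <:+ G.moves i v := by
  induction v with
  | nil => rw [List.suffix_nil.1 h]
  | cons a v ih =>
    rcases List.suffix_cons_iff.1 h with rfl | h
    · exact List.suffix_refl _
    · exact (ih h).trans (moves_suffix_cons i a v)

theorem mem_nodes_of_suffix {u v : List G.Act} (h : u <:+ v) (hv : v ∈ G.nodes) : u ∈ G.nodes := by
  induction v with
  | nil => rwa [List.suffix_nil.1 h]
  | cons a v ih =>
    rcases List.suffix_cons_iff.1 h with rfl | h
    · exact hv
    · exact ih h (G.parent_mem a v hv)

theorem mem_moves_iff {i : Fin n} {h : List G.Act} {I : G.Info} {a : G.Act} :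
    (I, a) ∈ G.moves i h ↔ G.player I = i ∧ ∃ u, a :: u <:+ h ∧ G.infoset u = some I := by
  constructor
  · intro hm
    induction h with
    | nil => simp [moves_nil] at hm
    | cons b h ih =>
      by_cases hh : ∃ J, G.infoset h = some J ∧ G.player J = i
      · obtain ⟨J, hJ, hi⟩ := hh
        rw [moves_cons_own b hJ hi] at hm
        rcases List.mem_cons.1 hm with he | hm
        · cases he
          exact ⟨hi, h, List.suffix_refl _, hJ⟩
        · obtain ⟨h1, u, h2, h3⟩ := ih hm
          exact ⟨h1, u, h2.trans (List.suffix_cons _ _), h3⟩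
      · push Not at hh
        rw [moves_cons_other b hh] at hm
        obtain ⟨h1, u, h2, h3⟩ := ih hm
        exact ⟨h1, u, h2.trans (List.suffix_cons _ _), h3⟩
  · rintro ⟨hi, u, hu, hI⟩
    apply (moves_suffix i hu).subset
    rw [moves_cons_own a hI hi]
    exact List.mem_cons_self

theorem moves_eq_rep {u : List G.Act} (hu : u ∈ G.nodes) {I : G.Info} (hI : G.infoset u = some I)
    {i : Fin n} (hi : G.player I = i) : G.moves i u = G.moves i (G.rep I) := by
  subst hi
  exact G.perfect_recall u hu _ (G.rep_mem I) I hI (G.infoset_rep I)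

theorem cons_moves_rep_suffix {i : Fin n} {h : List G.Act} (hh : h ∈ G.nodes)
    {m : G.Info × G.Act} (hm : m ∈ G.moves i h) :
    m :: G.moves i (G.rep m.1) <:+ G.moves i h := by
  obtain ⟨I, a⟩ := m
  obtain ⟨hi, u, hu, hI⟩ := mem_moves_iff.1 hm
  have h1 := moves_suffix i hu
  have hun : u ∈ G.nodes := mem_nodes_of_suffix ((List.suffix_cons a u).trans hu) hh
  rwa [moves_cons_own a hI hi, moves_eq_rep hun hI hi] at h1

/-- By perfect recall, a path does not meet an information set twice. -/
theorem eq_of_suffix_of_infoset {u v : List G.Act} (hv : v ∈ G.nodes) (huv : u <:+ v) {I : G.Info}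
    (hu : G.infoset u = some I) (hvI : G.infoset v = some I) : u = v := by
  by_contra hne
  obtain ⟨t, rfl⟩ := huv
  rcases List.eq_nil_or_concat t with rfl | ⟨t, a, rfl⟩
  · simp at hne
  · have hs : a :: u <:+ t.concat a ++ u := ⟨t, by simp⟩
    have h1 := (moves_suffix (G.player I) hs).length_le
    have hun : u ∈ G.nodes := mem_nodes_of_suffix ((List.suffix_cons a u).trans hs) hv
    rw [moves_cons_own a hu rfl, moves_eq_rep hun hu rfl, moves_eq_rep hv hvI rfl] at h1
    simp at h1

/-- The moves on a path contain at most one action at each information set. -/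
theorem moves_unique {i : Fin n} {h : List G.Act} (hh : h ∈ G.nodes) {I : G.Info} {a b : G.Act}
    (ha : (I, a) ∈ G.moves i h) (hb : (I, b) ∈ G.moves i h) : a = b := by
  have h1 := cons_moves_rep_suffix hh ha
  have h2 := cons_moves_rep_suffix hh hb
  have h3 := List.suffix_of_suffix_length_le h1 h2 (by simp)
  have h4 := h3.eq_of_length (by simp)
  simpa using h4

theorem infoset_eq_none_of_leaf (z : G.leaves) : G.infoset z.1 = none := by
  cases hI : G.infoset z.1 with
  | none => rfl
  | some I =>
    obtain ⟨a, ha⟩ := G.acts_nonempty I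
    exact absurd ((G.mem_acts_iff _ (G.leaf_mem z) I hI a).1 ha) ((Finset.mem_filter.1 z.2).2 a)

theorem exists_cons_suffix {u v : List G.Act} (h : u <:+ v) (hne : u ≠ v) :
    ∃ a, a :: u <:+ v := by
  obtain ⟨t, rfl⟩ := h
  rcases List.eq_nil_or_concat t with rfl | ⟨t, a, rfl⟩
  · simp at hne
  · exact ⟨a, t, by simp⟩

theorem through_iff {I : G.Info} (z : G.leaves) :
    G.Through I z.1 ↔ ∃ a, (I, a) ∈ G.moves (G.player I) z.1 := by
  constructor
  · rintro ⟨v, hv, hI⟩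
    have hne : v ≠ z.1 := by
      rintro rfl
      rw [infoset_eq_none_of_leaf] at hI
      cases hI
    obtain ⟨a, ha⟩ := exists_cons_suffix hv hne
    exact ⟨a, mem_moves_iff.2 ⟨rfl, v, ha, hI⟩⟩
  · rintro ⟨a, ha⟩
    obtain ⟨_, u, hu, hI⟩ := mem_moves_iff.1 ha
    exact ⟨u, (List.suffix_cons a u).trans hu, hI⟩

/-! ### Sequences -/

/-- the sequence `(I, a)` of Player `i`, the player of `I` -/
def mv {i : Fin n} (I : G.InfoOf i) (a : G.acts I.1) : G.Seq i :=
  ⟨some (I.1, a.1), by rintro m hm; cases hm; exact ⟨I.2, a.2⟩⟩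

/-- the parent sequence of an information set of Player `i` -/
def par {i : Fin n} (I : G.InfoOf i) : G.Seq i := G.seqAt i (G.rep I.1) (G.rep_mem I.1)

theorem par_mk (I : G.Info) : par (⟨I, rfl⟩ : G.InfoOf (G.player I)) = G.parentSeq I := rfl

theorem eq_par_iff {i : Fin n} (I : G.InfoOf i) (s : G.Seq i) :
    s.1 = (G.parentSeq I.1).1 ↔ s = par I := by
  obtain ⟨I, rfl⟩ := I
  rw [par_mk, Subtype.ext_iff]

theorem mv_injective {i : Fin n} {I J : G.InfoOf i} {a : G.acts I.1} {b : G.acts J.1}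
    (h : mv I a = mv J b) : I = J ∧ a.1 = b.1 := by
  have h1 : some (I.1, a.1) = some (J.1, b.1) := congrArg Subtype.val h
  simp only [Option.some.injEq, Prod.mk.injEq] at h1
  exact ⟨Subtype.ext h1.1, h1.2⟩

theorem mv_ne_empty {i : Fin n} (I : G.InfoOf i) (a : G.acts I.1) : mv I a ≠ G.emptySeq i := by
  intro h
  have h1 : some (I.1, a.1) = none := congrArg Subtype.val h
  cases h1

theorem seq_cases {i : Fin n} (s : G.Seq i) :
    s = G.emptySeq i ∨ ∃ (I : G.InfoOf i) (a : G.acts I.1), s = mv I a := by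
  obtain ⟨_ | ⟨I, a⟩, hs⟩ := s
  · exact Or.inl rfl
  · exact Or.inr ⟨⟨I, (hs _ rfl).1⟩, ⟨a, (hs _ rfl).2⟩, rfl⟩

/-- A sequence is either empty or consists of an information set and an action. -/
def seqEquiv (i : Fin n) : Option (Σ I : G.InfoOf i, G.acts I.1) ≃ G.Seq i :=
  Equiv.ofBijective (fun o => o.elim (G.emptySeq i) fun x => mv x.1 x.2) <| by
    constructor
    · rintro (_ | ⟨I, a⟩) (_ | ⟨J, b⟩) h
      · rfl
      · exact absurd h.symm (mv_ne_empty J b)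
      · exact absurd h (mv_ne_empty I a)
      · obtain ⟨h1, h2⟩ := mv_injective h
        dsimp only at h1 h2
        subst h1
        rw [Subtype.ext h2]
    · intro s
      rcases seq_cases s with rfl | ⟨I, a, rfl⟩
      · exact ⟨none, rfl⟩
      · exact ⟨some ⟨I, a⟩, rfl⟩

theorem sum_seq {i : Fin n} {M : Type*} [AddCommMonoid M] (g : G.Seq i → M) :
    ∑ s, g s = g (G.emptySeq i) + ∑ I : G.InfoOf i, ∑ a : G.acts I.1, g (mv I a) := by
  rw [← (seqEquiv i).sum_comp, Fintype.sum_option, Fintype.sum_sigma]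
  rfl

theorem seqMoves_empty (i : Fin n) : G.seqMoves (G.emptySeq i) = [] := rfl

theorem seqMoves_mv {i : Fin n} (I : G.InfoOf i) (a : G.acts I.1) :
    G.seqMoves (mv I a) = (I.1, a.1) :: G.moves i (G.rep I.1) := rfl

theorem moves_eq_cons {i : Fin n} {h : List G.Act} (hh : h ∈ G.nodes) {m : G.Info × G.Act}
    {l : List (G.Info × G.Act)} (hm : G.moves i h = m :: l) : l = G.moves i (G.rep m.1) := by
  induction h with
  | nil => simp [moves_nil] at hm
  | cons b h ih =>
    have hn := G.parent_mem b h hh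
    by_cases hc : ∃ J, G.infoset h = some J ∧ G.player J = i
    · obtain ⟨J, hJ, hi⟩ := hc
      rw [moves_cons_own b hJ hi] at hm
      obtain ⟨rfl, rfl⟩ := List.cons.inj hm
      exact moves_eq_rep hn hJ hi
    · push Not at hc
      rw [moves_cons_other b hc] at hm
      exact ih hn hm

theorem seqMoves_seqAt {i : Fin n} {h : List G.Act} (hh : h ∈ G.nodes) :
    G.seqMoves (G.seqAt i h hh) = G.moves i h := by
  unfold seqMoves seqAt
  simp only
  cases hm : G.moves i h with
  | nil => rfl
  | cons m l => rw [moves_eq_cons hh hm]; rfl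

theorem seqMoves_par {i : Fin n} (I : G.InfoOf i) :
    G.seqMoves (par I) = G.moves i (G.rep I.1) := seqMoves_seqAt _

theorem seqMoves_leafSeq (i : Fin n) (z : G.leaves) :
    G.seqMoves (G.leafSeq i z) = G.moves i z.1 := seqMoves_seqAt _

theorem seqMoves_mv' {i : Fin n} (I : G.InfoOf i) (a : G.acts I.1) :
    G.seqMoves (mv I a) = (I.1, a.1) :: G.seqMoves (par I) := by
  rw [seqMoves_par, seqMoves_mv]

theorem seqAt_eq_par {i : Fin n} {u : List G.Act} (hu : u ∈ G.nodes) (I : G.InfoOf i)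
    (hI : G.infoset u = some I.1) : G.seqAt i u hu = par I := by
  apply Subtype.ext
  change (G.moves i u).head? = (G.moves i (G.rep I.1)).head?
  rw [moves_eq_rep hu hI I.2]

theorem seqAt_cons_own {i : Fin n} {u : List G.Act} {a : G.Act} (hu : a :: u ∈ G.nodes)
    (I : G.InfoOf i) (hI : G.infoset u = some I.1) (ha : a ∈ G.acts I.1) :
    G.seqAt i (a :: u) hu = mv I ⟨a, ha⟩ := by
  apply Subtype.ext
  change (G.moves i (a :: u)).head? = some (I.1, a)
  rw [moves_cons_own a hI I.2]
  rfl

theorem seqAt_cons_other {i : Fin n} {u : List G.Act} {a : G.Act} (hu : a :: u ∈ G.nodes)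
    (hI : ∀ J, G.infoset u = some J → G.player J ≠ i) :
    G.seqAt i (a :: u) hu = G.seqAt i u (G.parent_mem a u hu) := by
  apply Subtype.ext
  change (G.moves i (a :: u)).head? = (G.moves i u).head?
  rw [moves_cons_other a hI]

/-- the number of moves of its player that precede an information set -/
def depth (I : G.Info) : ℕ := (G.moves (G.player I) (G.rep I)).length

theorem depth_lt_of_mem {i : Fin n} {I J : G.Info} {a : G.Act} (hI : G.player I = i)
    (h : (J, a) ∈ G.moves i (G.rep I)) : depth J < depth I := by
  subst hI
  obtain ⟨hi, -⟩ := mem_moves_iff.1 h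
  have h1 := (cons_moves_rep_suffix (G.rep_mem I) h).length_le
  unfold depth
  rw [hi]
  simpa [Nat.succ_le_iff] using h1

/-! ### Pure profiles and plans -/

/-- A pure profile chooses an action at every information set of every player; it follows a
sequence if it chooses all moves up to and including it. -/
def Follows (F : ∀ I : G.Info, G.acts I) {i : Fin n} (s : G.Seq i) : Prop :=
  ∀ m ∈ G.seqMoves s, (F m.1).1 = m.2

/-- the plan that a pure profile induces, by forgetting the choices at unreachable information
sets -/
def planOf (F : ∀ I : G.Info, G.acts I) (i : Fin n) : G.Plan i :=
  ⟨fun I => if G.player I = i ∧ ∀ m ∈ G.moves i (G.rep I), (F m.1).1 = m.2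
    then some (F I).1 else none, by
    intro I
    have key : ∀ I, G.player I = i →
        ((∀ m ∈ G.moves i (G.rep I), (if G.player m.1 = i ∧
          ∀ m' ∈ G.moves i (G.rep m.1), (F m'.1).1 = m'.2 then some (F m.1).1 else none) =
            some m.2) ↔ ∀ m ∈ G.moves i (G.rep I), (F m.1).1 = m.2) := by
      intro I hI
      constructor
      · intro h m hm
        have := h m hm
        split_ifs at this with hc
        simpa using this
      · intro h m hm
        have hc : G.player m.1 = i ∧ ∀ m' ∈ G.moves i (G.rep m.1), (F m'.1).1 = m'.2 := by
          refine ⟨(mem_moves_iff.1 (show (m.1, m.2) ∈ _ from hm)).1, fun m' hm' => h m' ?_⟩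
          exact (cons_moves_rep_suffix (G.rep_mem I) hm).subset (List.mem_cons_of_mem _ hm')
        rw [if_pos hc, h m hm]
    by_cases hI : G.player I = i
    · have hk := key I hI
      by_cases h : ∀ m ∈ G.moves i (G.rep I), (F m.1).1 = m.2
      · rw [if_pos ⟨hI, hk.2 h⟩]
        exact ⟨_, (F I).2, if_pos ⟨hI, h⟩⟩
      · rw [if_neg (fun h' => h (hk.1 h'.2))]
        exact if_neg fun h' => h h'.2
    · rw [if_neg (fun h' => hI h'.1)]
      exact if_neg fun h' => hI h'.1⟩

theorem tail_mem_seqMoves {i : Fin n} {s : G.Seq i} {m : G.Info × G.Act} (hm : m ∈ G.seqMoves s) :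
    G.player m.1 = i ∧ ∀ m' ∈ G.moves i (G.rep m.1), m' ∈ G.seqMoves s := by
  rcases seq_cases s with rfl | ⟨I, a, rfl⟩
  · simp [seqMoves_empty] at hm
  · rw [seqMoves_mv] at hm ⊢
    rcases List.mem_cons.1 hm with rfl | hm
    · exact ⟨I.2, fun m' hm' => List.mem_cons_of_mem _ hm'⟩
    · refine ⟨(mem_moves_iff.1 (show (m.1, m.2) ∈ _ from hm)).1, fun m' hm' => ?_⟩
      exact List.mem_cons_of_mem _ ((cons_moves_rep_suffix (G.rep_mem I.1) hm).subset
        (List.mem_cons_of_mem _ hm'))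

theorem plays_planOf (F : ∀ I : G.Info, G.acts I) {i : Fin n} (s : G.Seq i) :
    G.Plays (planOf F i) s ↔ Follows F s := by
  constructor
  · intro h m hm
    have h1 := h m hm
    unfold planOf at h1
    simp only at h1
    split_ifs at h1 with hc
    simpa using h1
  · intro h m hm
    unfold planOf
    simp only
    obtain ⟨h1, h2⟩ := tail_mem_seqMoves hm
    rw [if_pos ⟨h1, fun m' hm' => h m' (h2 m' hm')⟩, h m hm]

theorem plays_empty {i : Fin n} (p : G.Plan i) : G.Plays p (G.emptySeq i) := by
  intro m hm
  simp [seqMoves_empty] at hm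

theorem follows_mv (F : ∀ I : G.Info, G.acts I) {i : Fin n} (I : G.InfoOf i) (a : G.acts I.1) :
    Follows F (mv I a) ↔ F I.1 = a ∧ Follows F (par I) := by
  unfold Follows
  rw [seqMoves_mv', List.forall_mem_cons, Subtype.ext_iff]

theorem plays_mv {i : Fin n} (p : G.Plan i) (I : G.InfoOf i) (a : G.acts I.1) :
    G.Plays p (mv I a) ↔ p.1 I.1 = some a.1 ∧ G.Plays p (par I) := by
  unfold Plays
  rw [seqMoves_mv', List.forall_mem_cons]

theorem plays_par {i : Fin n} (p : G.Plan i) (I : G.InfoOf i) :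
    G.Plays p (par I) ↔ ∃ a : G.acts I.1, p.1 I.1 = some a.1 := by
  have h := p.2 I.1
  unfold Plays
  rw [seqMoves_par]
  by_cases hc : ∀ m ∈ G.moves i (G.rep I.1), p.1 m.1 = some m.2
  · rw [if_pos ⟨I.2, hc⟩] at h
    obtain ⟨a, ha, hp⟩ := h
    exact iff_of_true hc ⟨⟨a, ha⟩, hp⟩
  · rw [if_neg (fun h' => hc h'.2)] at h
    refine iff_of_false hc ?_
    rintro ⟨a, ha⟩
    rw [h] at ha
    cases ha

/-- A plan that plays the parent sequence of an information set chooses one action there. -/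
theorem sum_plays_mv {i : Fin n} (p : G.Plan i) (I : G.InfoOf i) :
    (∑ a : G.acts I.1, if G.Plays p (mv I a) then (1 : ℝ) else 0) =
      if G.Plays p (par I) then 1 else 0 := by
  by_cases h : G.Plays p (par I)
  · obtain ⟨a, ha⟩ := (plays_par p I).1 h
    rw [if_pos h, Finset.sum_eq_single a]
    · rw [if_pos ((plays_mv p I a).2 ⟨ha, h⟩)]
    · intro b _ hb
      rw [if_neg]
      intro hp
      rw [plays_mv, ha] at hp
      exact hb (Subtype.ext (by simpa using hp.1.symm))
    · simp
  · rw [if_neg h]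
    refine Finset.sum_eq_zero fun a _ => if_neg fun hp => h ((plays_mv p I a).1 hp).2

/-! ### Backward induction for one player -/

theorem depth_lt_of_par_eq {i : Fin n} {I K : G.InfoOf i} {a : G.acts I.1} (h : par K = mv I a) :
    depth I.1 < depth K.1 := by
  have h1 : (I.1, a.1) ∈ G.seqMoves (par K) := by
    rw [h, seqMoves_mv]
    exact List.mem_cons_self
  rw [seqMoves_par] at h1
  exact depth_lt_of_mem K.2 h1

/-- Optimal values at the information sets of Player `i` for the weights `g`, where the values of
information sets outside `D` are not passed on to their parent sequences. -/
theorem exists_backward {i : Fin n} (g : G.Seq i → ℝ) (D : Set (G.InfoOf i)) :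
    ∃ (v : G.InfoOf i → ℝ) (f : ∀ I : G.InfoOf i, G.acts I.1),
      (∀ I a, g (mv I a) + ∑ K, (if K ∈ D ∧ par K = mv I a then v K else 0) ≤ v I) ∧
      ∀ I, g (mv I (f I)) + ∑ K, (if K ∈ D ∧ par K = mv I (f I) then v K else 0) = v I := by
  have : ∀ I : G.InfoOf i, Nonempty (G.acts I.1) := fun I => (G.acts_nonempty I.1).to_subtype
  let q : (G.InfoOf i → ℝ) → ∀ I : G.InfoOf i, G.acts I.1 → ℝ := fun v I a =>
    g (mv I a) + ∑ K, (if K ∈ D ∧ par K = mv I a then v K else 0)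
  obtain ⟨N, hN⟩ : ∃ N, ∀ I : G.InfoOf i, depth I.1 ≤ N :=
    ⟨Finset.univ.sup fun I : G.InfoOf i => depth I.1, fun I =>
      Finset.le_sup (f := fun I : G.InfoOf i => depth I.1) (Finset.mem_univ I)⟩
  obtain ⟨v, hv⟩ := exists_fixedPoint_of_rank (fun I : G.InfoOf i => N - depth I.1)
    (fun v I => Finset.univ.sup' Finset.univ_nonempty (q v I)) (by
      intro y y' I h
      refine Finset.sup'_congr _ rfl fun a _ => ?_
      refine congrArg (g (mv I a) + ·) (Finset.sum_congr rfl fun K _ => ?_)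
      split_ifs with hK
      · have := depth_lt_of_par_eq hK.2
        have := hN K
        exact h K (by omega)
      · rfl)
  choose f hf using fun I => Finset.exists_mem_eq_sup' Finset.univ_nonempty (q v I)
  refine ⟨v, f, fun I a => ?_, fun I => ?_⟩
  · rw [hv I]
    exact Finset.le_sup' (q v I) (Finset.mem_univ a)
  · rw [hv I]
    exact (hf I).2.symm

/-- Sums over information sets grouped by their parent sequences. -/
theorem sum_par {i : Fin n} (v : G.InfoOf i → ℝ) (y : G.Seq i → ℝ) (D : Set (G.InfoOf i)) :
    ∑ s, (∑ K, if K ∈ D ∧ par K = s then v K else 0) * y s =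
      ∑ K, if K ∈ D then v K * y (par K) else 0 := by
  simp only [Finset.sum_mul]
  rw [Finset.sum_comm]
  refine Finset.sum_congr rfl fun K _ => ?_
  by_cases hK : K ∈ D
  · simp [hK]
  · simp [hK]

/-- Elimination of the information sets in `D`: weights on the sequences that end in `D` can be
moved to the other sequences, without decreasing the value of any nonnegative vector that satisfies
the flow equations in `D`, and without changing it for vectors that choose optimally in `D`. -/
theorem exists_elimination {i : Fin n} (g : G.Seq i → ℝ) (D : Set (G.InfoOf i)) :
    ∃ (h : G.Seq i → ℝ) (f : ∀ I : G.InfoOf i, G.acts I.1),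
      (∀ K ∈ D, ∀ a, h (mv K a) = 0) ∧
      (∀ s, g s = 0 → (∀ K ∈ D, par K ≠ s) → h s = 0) ∧
      (∀ y : G.Seq i → ℝ, (∀ s, 0 ≤ y s) → (∀ K ∈ D, ∑ a, y (mv K a) = y (par K)) →
        ∑ s, g s * y s ≤ ∑ s, h s * y s) ∧
      ∀ y : G.Seq i → ℝ, (∀ K ∈ D, ∑ a, y (mv K a) = y (par K)) →
        (∀ K ∈ D, ∀ a, a ≠ f K → y (mv K a) = 0) → ∑ s, g s * y s = ∑ s, h s * y s := by
  obtain ⟨v, f, hle, heq⟩ := exists_backward g D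
  let H : G.Seq i → ℝ := fun s => g s + ∑ K, if K ∈ D ∧ par K = s then v K else 0
  let E : G.Seq i → Prop := fun s => ∃ K ∈ D, ∃ a, s = mv K a
  have hE0 : ¬ E (G.emptySeq i) := by
    rintro ⟨K, -, a, h⟩
    exact mv_ne_empty K a h.symm
  have hE : ∀ (K : G.InfoOf i) a, E (mv K a) ↔ K ∈ D := by
    intro K a
    constructor
    · rintro ⟨J, hJ, b, h⟩
      rwa [(mv_injective h).1]
    · exact fun h => ⟨K, h, a, rfl⟩
  -- the flow equations turn the difference into a sum over the moves in `D`
  have key : ∀ y : G.Seq i → ℝ, (∀ K ∈ D, ∑ a, y (mv K a) = y (par K)) →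
      ∑ s, g s * y s = ∑ s, (if E s then 0 else H s) * y s +
        ∑ K : G.InfoOf i, if K ∈ D then ∑ a, (H (mv K a) - v K) * y (mv K a) else 0 := by
    intro y hy
    have h1 : ∑ s, g s * y s = ∑ s, H s * y s - ∑ K, if K ∈ D then v K * y (par K) else 0 := by
      rw [← sum_par, ← Finset.sum_sub_distrib]
      exact Finset.sum_congr rfl fun s _ => by simp only [H]; ring
    rw [h1, sum_seq, sum_seq, if_neg hE0, add_assoc, add_sub_assoc, ← Finset.sum_sub_distrib,
      ← Finset.sum_add_distrib]
    congr 1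
    refine Finset.sum_congr rfl fun K _ => ?_
    by_cases hK : K ∈ D
    · simp only [hE, hK, if_true, zero_mul, Finset.sum_const_zero, zero_add]
      rw [← hy K hK, Finset.mul_sum, ← Finset.sum_sub_distrib]
      exact Finset.sum_congr rfl fun a _ => by ring
    · simp only [hE, hK, if_false, sub_zero, add_zero]
  refine ⟨fun s => if E s then 0 else H s, f, fun K hK a => if_pos ((hE K a).2 hK), ?_, ?_, ?_⟩
  · intro s hs hK
    simp only [H, hs, zero_add]
    split_ifs
    · rfl
    · exact Finset.sum_eq_zero fun K _ => if_neg fun h => hK K h.1 h.2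
  · intro y hy0 hy
    rw [key y hy, add_le_iff_nonpos_right]
    refine Finset.sum_nonpos fun K _ => ?_
    split_ifs
    · exact Finset.sum_nonpos fun a _ =>
        mul_nonpos_of_nonpos_of_nonneg (sub_nonpos.2 (hle K a)) (hy0 _)
    · exact le_rfl
  · intro y hy hf
    rw [key y hy, add_eq_left]
    refine Finset.sum_eq_zero fun K _ => ?_
    split_ifs with hK
    · refine Finset.sum_eq_zero fun a _ => ?_
      by_cases ha : a = f K
      · rw [ha]
        have : H (mv K (f K)) = v K := heq K
        rw [this, sub_self, zero_mul]
      · rw [hf K hK a ha, mul_zero]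
    · rfl

/-! ### Sequence-form strategies -/

/-- the sequence-form strategy of a plan -/
def planVec {i : Fin n} (p : G.Plan i) : G.Seq i → ℝ := fun s => if G.Plays p s then 1 else 0

theorem inducedSeq_eq {i : Fin n} (ν : G.Plan i → ℝ) :
    G.inducedSeq i ν = ∑ p, ν p • planVec p := by
  funext s
  simp [inducedSeq, planVec, Finset.sum_apply, Finset.sum_filter]

theorem seqForm_eq_convexHull (i : Fin n) :
    G.seqForm i = convexHull ℝ (Set.range (planVec : G.Plan i → G.Seq i → ℝ)) := by
  rw [convexHull_range_eq_image, seqForm]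
  exact Set.image_congr fun ν _ => inducedSeq_eq ν

theorem planVec_mem (i : Fin n) (p : G.Plan i) : planVec p ∈ G.seqForm i := by
  rw [seqForm_eq_convexHull]
  exact subset_convexHull ℝ _ ⟨p, rfl⟩

/-- the equations `F_i y = f_i` -/
def IsFlow {i : Fin n} (y : G.Seq i → ℝ) : Prop :=
  y (G.emptySeq i) = 1 ∧ ∀ I : G.InfoOf i, ∑ a, y (mv I a) = y (par I)

theorem isFlow_planVec {i : Fin n} (p : G.Plan i) : IsFlow (planVec p) :=
  ⟨if_pos (plays_empty p), fun I => sum_plays_mv p I⟩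

theorem planVec_nonneg {i : Fin n} (p : G.Plan i) (s : G.Seq i) : 0 ≤ planVec p s := by
  unfold planVec
  split_ifs <;> norm_num

theorem isFlow_of_mem_seqForm {i : Fin n} {y : G.Seq i → ℝ} (hy : y ∈ G.seqForm i) :
    (∀ s, 0 ≤ y s) ∧ IsFlow y := by
  obtain ⟨ν, hν, rfl⟩ := hy
  rw [inducedSeq_eq]
  simp only [Finset.sum_apply, Pi.smul_apply, smul_eq_mul, IsFlow]
  refine ⟨fun s => Finset.sum_nonneg fun p _ => mul_nonneg (hν.1 p) (planVec_nonneg p s), ?_, ?_⟩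
  · rw [← hν.2]
    exact Finset.sum_congr rfl fun p _ => by rw [(isFlow_planVec p).1, mul_one]
  · intro I
    rw [Finset.sum_comm]
    refine Finset.sum_congr rfl fun p _ => ?_
    rw [← Finset.mul_sum, (isFlow_planVec p).2]

theorem flowMat_none (i : Fin n) (s : G.Seq i) :
    G.flowMat i none s = if s = G.emptySeq i then 1 else 0 := rfl

theorem flowMat_some_empty {i : Fin n} (I : G.InfoOf i) :
    G.flowMat i (some I) (G.emptySeq i) = -(if par I = G.emptySeq i then 1 else 0) := by
  simp only [flowMat, eq_par_iff, eq_comm (a := G.emptySeq i)]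
  simp [emptySeq]

theorem flowMat_some_mv {i : Fin n} (I J : G.InfoOf i) (a : G.acts J.1) :
    G.flowMat i (some I) (mv J a) =
      (if J = I then 1 else 0) - (if par I = mv J a then 1 else 0) := by
  have h : (∃ b, (mv J a).1 = some (I.1, b)) ↔ J = I := by
    constructor
    · rintro ⟨b, hb⟩
      have h1 : some (J.1, a.1) = some (I.1, b) := hb
      simp only [Option.some.injEq, Prod.mk.injEq] at h1
      exact Subtype.ext h1.1
    · rintro rfl
      exact ⟨a.1, rfl⟩
  simp only [flowMat, eq_par_iff, h, eq_comm (a := mv J a)]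

theorem flowMat_transpose_empty {i : Fin n} (v : Option (G.InfoOf i) → ℝ) :
    ((G.flowMat i)ᵀ *ᵥ v) (G.emptySeq i) =
      v none - ∑ K : G.InfoOf i, if par K = G.emptySeq i then v (some K) else 0 := by
  simp only [Matrix.mulVec, dotProduct, Matrix.transpose_apply, Fintype.sum_option,
    flowMat_none, flowMat_some_empty]
  simp [Finset.sum_neg_distrib, sub_eq_add_neg]

theorem flowMat_transpose_mv {i : Fin n} (v : Option (G.InfoOf i) → ℝ) (I : G.InfoOf i)
    (a : G.acts I.1) : ((G.flowMat i)ᵀ *ᵥ v) (mv I a) =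
      v (some I) - ∑ K : G.InfoOf i, if par K = mv I a then v (some K) else 0 := by
  simp only [Matrix.mulVec, dotProduct, Matrix.transpose_apply, Fintype.sum_option,
    flowMat_none, flowMat_some_mv, mv_ne_empty, if_false, zero_mul, zero_add, sub_mul,
    Finset.sum_sub_distrib, ite_mul, one_mul]
  simp

/-- `(F_iᵀ v)ᵀ y = vᵀ (F_i y) = vᵀ f_i` for solutions `y` of the flow equations. -/
theorem flowMat_transpose_dotProduct {i : Fin n} (v : Option (G.InfoOf i) → ℝ) {y : G.Seq i → ℝ}
    (hy : IsFlow y) : ((G.flowMat i)ᵀ *ᵥ v) ⬝ᵥ y = v none := by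
  have h1 := sum_par (fun K => v (some K)) y Set.univ
  simp only [Set.mem_univ, true_and, if_true] at h1
  rw [sum_seq] at h1
  rw [dotProduct, sum_seq]
  simp only [flowMat_transpose_empty, flowMat_transpose_mv, sub_mul, Finset.sum_sub_distrib,
    ← Finset.mul_sum, hy.2, hy.1, mul_one] at h1 ⊢
  linarith

theorem dotProduct_flowRhs {i : Fin n} (v : Option (G.InfoOf i) → ℝ) :
    v ⬝ᵥ G.flowRhs i = v none := by
  simp [dotProduct, Fintype.sum_option, flowRhs]

/-- Strong duality for one player: the value of an optimal plan is attained by a dual solution. -/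
theorem exists_dual {i : Fin n} (g : G.Seq i → ℝ) :
    ∃ (v : Option (G.InfoOf i) → ℝ) (p : G.Plan i),
      (∀ s, g s ≤ ((G.flowMat i)ᵀ *ᵥ v) s) ∧ v none = g ⬝ᵥ planVec p := by
  obtain ⟨v, f, hle, heq⟩ := exists_backward g Set.univ
  simp only [Set.mem_univ, true_and] at hle heq
  let w : Option (G.InfoOf i) → ℝ := fun o =>
    o.elim (g (G.emptySeq i) + ∑ K : G.InfoOf i, if par K = G.emptySeq i then v K else 0) v
  let F : ∀ I : G.Info, G.acts I := fun I => if h : G.player I = i then f ⟨I, h⟩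
    else ⟨_, (G.acts_nonempty I).choose_spec⟩
  have hF : ∀ I : G.InfoOf i, F I.1 = f I := fun I => dif_pos I.2
  have h0 : ((G.flowMat i)ᵀ *ᵥ w) (G.emptySeq i) = g (G.emptySeq i) := by
    rw [flowMat_transpose_empty]
    simp [w]
  have hmv : ∀ I a, ((G.flowMat i)ᵀ *ᵥ w) (mv I a) =
      v I - ∑ K : G.InfoOf i, if par K = mv I a then v K else 0 := by
    intro I a
    rw [flowMat_transpose_mv]
    rfl
  refine ⟨w, planOf F i, fun s => ?_, ?_⟩
  · rcases seq_cases s with rfl | ⟨I, a, rfl⟩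
    · rw [h0]
    · rw [hmv]
      linarith [hle I a]
  · rw [← flowMat_transpose_dotProduct w (isFlow_planVec (planOf F i)), dotProduct, dotProduct]
    refine Finset.sum_congr rfl fun s _ => ?_
    rcases seq_cases s with rfl | ⟨I, a, rfl⟩
    · rw [h0]
    · by_cases ha : a = f I
      · rw [hmv, ha]
        congr 1
        linarith [heq I]
      · have : planVec (planOf F i) (mv I a) = 0 := by
          refine if_neg fun h => ha ?_
          rw [plays_planOf, follows_mv, hF] at h
          exact h.1.symm
        rw [this, mul_zero, mul_zero]

/-- Weak duality for one player. -/
theorem dotProduct_le_of_dual {i : Fin n} {g : G.Seq i → ℝ} {v : Option (G.InfoOf i) → ℝ}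
    (hv : ∀ s, g s ≤ ((G.flowMat i)ᵀ *ᵥ v) s) {y : G.Seq i → ℝ} (h0 : ∀ s, 0 ≤ y s)
    (hy : IsFlow y) : g ⬝ᵥ y ≤ v none := by
  rw [← flowMat_transpose_dotProduct v hy]
  exact dotProduct_le_dotProduct_of_nonneg_right hv h0

/-- The sequence-form strategies are the nonnegative solutions of the flow equations. -/
theorem mem_seqForm_iff {i : Fin n} (y : G.Seq i → ℝ) :
    y ∈ G.seqForm i ↔ (∀ s, 0 ≤ y s) ∧ IsFlow y := by
  refine ⟨isFlow_of_mem_seqForm, fun ⟨h0, hy⟩ => ?_⟩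
  rw [seqForm_eq_convexHull]
  refine mem_of_forall_dotProduct_le (convex_convexHull ℝ _)
    ((Set.finite_range _).isClosed_convexHull ℝ) fun g => ?_
  obtain ⟨v, p, hv, hp⟩ := exists_dual g
  refine ⟨planVec p, subset_convexHull ℝ _ ⟨p, rfl⟩, ?_⟩
  rw [← hp]
  exact dotProduct_le_of_dual hv h0 hy

/-- Strong duality for a player who has to play the sequence `s`. -/
theorem exists_dual_of_plays {i : Fin n} (g : G.Seq i → ℝ) (s : G.Seq i)
    (hs : ∃ p : G.Plan i, G.Plays p s) :
    ∃ (w : ℝ) (v : Option (G.InfoOf i) → ℝ) (p : G.Plan i), G.Plays p s ∧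
      (∀ t, g t ≤ ((G.flowMat i)ᵀ *ᵥ v) t + if t = s then w else 0) ∧
      w + v none = g ⬝ᵥ planVec p := by
  obtain ⟨p₀, hp₀⟩ := hs
  -- a bonus `M` on `s` that exceeds all differences of values
  obtain ⟨M, hM⟩ : ∃ M : ℝ, ∀ p : G.Plan i, g ⬝ᵥ planVec p < M + g ⬝ᵥ planVec p₀ := by
    obtain ⟨B, hB⟩ := (Set.finite_range fun p : G.Plan i => g ⬝ᵥ planVec p).bddAbove
    exact ⟨B - g ⬝ᵥ planVec p₀ + 1, fun p => by linarith [hB ⟨p, rfl⟩]⟩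
  obtain ⟨v, p, hv, hp⟩ := exists_dual (g + Pi.single s M)
  have hval : ∀ q : G.Plan i, (g + Pi.single s M) ⬝ᵥ planVec q =
      g ⬝ᵥ planVec q + if G.Plays q s then M else 0 := by
    intro q
    rw [add_dotProduct, single_dotProduct, planVec]
    split_ifs <;> simp
  have hps : G.Plays p s := by
    by_contra hn
    have h1 := dotProduct_le_of_dual hv (planVec_nonneg p₀) (isFlow_planVec p₀)
    rw [hp, hval, hval, if_pos hp₀, if_neg hn] at h1
    linarith [hM p]
  refine ⟨-M, v, p, hps, fun t => ?_, ?_⟩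
  · have := hv t
    rw [Pi.add_apply, Pi.single_apply] at this
    split_ifs at this ⊢ <;> linarith
  · rw [hp, hval, if_pos hps]
    ring

/-- Every node is reached by a pure profile, since by perfect recall no information set occurs twice
on the path to it. -/
theorem exists_profile_follows {h : List G.Act} (hh : h ∈ G.nodes) :
    ∃ F : ∀ I : G.Info, G.acts I, ∀ j, Follows F (G.seqAt j h hh) := by
  let F : ∀ I : G.Info, G.acts I := fun I =>
    if hI : ∃ a, (I, a) ∈ G.moves (G.player I) h
    then ⟨hI.choose, (G.moves_spec _ h hh _ hI.choose_spec).2⟩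
    else ⟨_, (G.acts_nonempty I).choose_spec⟩
  refine ⟨F, fun j m hm => ?_⟩
  rw [seqMoves_seqAt] at hm
  obtain ⟨I, a⟩ := m
  obtain ⟨rfl, -⟩ := mem_moves_iff.1 hm
  have hI : ∃ a, (I, a) ∈ G.moves (G.player I) h := ⟨a, hm⟩
  change (F I).1 = a
  simp only [F, dif_pos hI]
  exact moves_unique hh hI.choose_spec hm

theorem inducedSeq_eq_one_iff {i : Fin n} {ν : G.Plan i → ℝ} (hν : ν ∈ G.PlanDist i)
    (s : G.Seq i) : G.inducedSeq i ν s = 1 ↔ ∀ p, ν p ≠ 0 → G.Plays p s := by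
  have h1 : G.inducedSeq i ν s = 1 ↔ ∑ p with ¬ G.Plays p s, ν p = 0 := by
    have := Finset.sum_filter_add_sum_filter_not Finset.univ (fun p => G.Plays p s) ν
    rw [hν.2] at this
    change ∑ p with G.Plays p s, ν p = 1 ↔ _
    constructor <;> intro h <;> linarith
  rw [h1, Finset.sum_eq_zero_iff_of_nonneg fun p _ => hν.1 p]
  simp only [Finset.mem_filter, Finset.mem_univ, true_and]
  exact forall_congr' fun p => not_imp_comm

/-- The sequence-form strategies that play a sequence for sure are the mixtures of the plans that
play it. -/
theorem seqForm_sep_eq_convexHull {i : Fin n} (s : G.Seq i) :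
    {y ∈ G.seqForm i | y s = 1} =
      convexHull ℝ (Set.range fun p : {p : G.Plan i // G.Plays p s} => planVec p.1) := by
  apply Set.Subset.antisymm
  · rintro y ⟨⟨ν, hν, rfl⟩, h1⟩
    have := sum_smul_mem_convexHull (planVec : G.Plan i → G.Seq i → ℝ) hν
      (S := {p | G.Plays p s}) ((inducedSeq_eq_one_iff hν s).1 h1)
    rw [inducedSeq_eq]
    rwa [Set.image_eq_range] at this
  · refine convexHull_min ?_ ?_
    · rintro _ ⟨p, rfl⟩
      exact ⟨planVec_mem i p.1, if_pos p.2⟩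
    · rw [seqForm_eq_convexHull]
      exact (convex_convexHull ℝ _).inter (convex_hyperplane (LinearMap.proj s).isLinear 1)

/-! ### Correlation plans -/

/-- the correlation plan of a profile of plans -/
def profVec (p : ∀ i, G.Plan i) : G.RelTuple → ℝ :=
  fun t => if ∀ i, G.Plays (p i) (t.1 i) then 1 else 0

theorem corrPlan_eq (μ : (∀ i, G.Plan i) → ℝ) : G.corrPlan μ = ∑ p, μ p • profVec p := by
  funext t
  simp [corrPlan, profVec, Finset.sum_apply, Finset.sum_filter]

theorem corrPolytope_eq_convexHull :
    G.corrPolytope = convexHull ℝ (Set.range (profVec : (∀ i, G.Plan i) → G.RelTuple → ℝ)) := by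
  rw [convexHull_range_eq_image, corrPolytope]
  exact Set.image_congr fun μ _ => corrPlan_eq μ

theorem isCompact_corrPolytope : IsCompact G.corrPolytope := by
  rw [corrPolytope_eq_convexHull]
  exact (Set.finite_range _).isCompact_convexHull ℝ

theorem convex_corrPolytope : Convex ℝ G.corrPolytope := by
  rw [corrPolytope_eq_convexHull]
  exact convex_convexHull ℝ _

instance (i : Fin n) : Nonempty (G.Plan i) :=
  ⟨planOf (fun I => ⟨_, (G.acts_nonempty I).choose_spec⟩) i⟩

theorem extend_of_relevant (ξ : G.RelTuple → ℝ) (t : G.RelTuple) : G.extend ξ t.1 = ξ t :=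
  dif_pos t.2

theorem sum_ite_eq_extend (ξ : G.RelTuple → ℝ) (τ : ∀ i, G.Seq i) :
    ∑ t : G.RelTuple, (if t.1 = τ then ξ t else 0) = G.extend ξ τ := by
  unfold extend
  split_ifs with h
  · rw [Finset.sum_eq_single ⟨τ, h⟩]
    · rw [if_pos rfl]
    · intro t _ ht
      exact if_neg fun h' => ht (Subtype.ext h')
    · simp
  · refine Finset.sum_eq_zero fun t _ => if_neg ?_
    rintro rfl
    exact h t.2

theorem extend_corrPlan (μ : (∀ i, G.Plan i) → ℝ) {τ : ∀ i, G.Seq i}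
    (h : ∀ i j, i ≠ j → G.Relevant (τ i) (τ j)) :
    G.extend (G.corrPlan μ) τ = ∑ p with ∀ i, G.Plays (p i) (τ i), μ p :=
  dif_pos h

/-- Information sets on a common path are connected. -/
theorem relevant_of_through {z : List G.Act} (hz : z ∈ G.nodes) {i j : Fin n} {s : G.Seq i}
    {t : G.Seq j}
    (hs : ∀ m ∈ s.1, G.Through m.1 z) (ht : ∀ m ∈ t.1, G.Through m.1 z) : G.Relevant s t := by
  intro m hm m' hm'
  obtain ⟨u, hu, hI⟩ := hs m hm
  obtain ⟨v, hv, hJ⟩ := ht m' hm'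
  exact ⟨u, mem_nodes_of_suffix hu hz, v, mem_nodes_of_suffix hv hz, hI, hJ,
    List.suffix_or_suffix_of_suffix hu hv⟩

theorem through_of_mem_seqAt {i : Fin n} {h : List G.Act} {hh : h ∈ G.nodes} {m : G.Info × G.Act}
    (hm : m ∈ (G.seqAt i h hh).1) : G.Through m.1 h := by
  obtain ⟨-, u, hu, hI⟩ := mem_moves_iff.1 (show (m.1, m.2) ∈ G.moves i h from
    List.mem_of_mem_head? hm)
  exact ⟨u, (List.suffix_cons _ u).trans hu, hI⟩

theorem leafTuple_relevant {i : Fin n} {s : G.Seq i} {z : G.leaves}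
    (hs : ∀ m ∈ s.1, G.Through m.1 z.1) :
    ∀ j k, j ≠ k → G.Relevant (G.leafTuple i s z j) (G.leafTuple i s z k) := by
  have h : ∀ j, ∀ m ∈ (G.leafTuple i s z j).1, G.Through m.1 z.1 := by
    intro j
    by_cases hj : j = i
    · subst hj
      rw [leafTuple, Function.update_self]
      exact hs
    · rw [leafTuple, Function.update_of_ne hj]
      exact fun m hm => through_of_mem_seqAt hm
  exact fun j k _ => relevant_of_through (G.leaf_mem z) (h j) (h k)

theorem through_parentSeq {I : G.Info} {z : G.leaves} (h : G.Through I z.1) :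
    ∀ m ∈ (G.parentSeq I).1, G.Through m.1 z.1 := by
  obtain ⟨v, hv, hI⟩ := h
  have hvn := mem_nodes_of_suffix hv (G.leaf_mem z)
  intro m hm
  rw [← par_mk, ← seqAt_eq_par hvn ⟨I, rfl⟩ hI] at hm
  obtain ⟨u, hu, hu'⟩ := through_of_mem_seqAt hm
  exact ⟨u, hu.trans hv, hu'⟩

theorem leafTuple_self (i : Fin n) (z : G.leaves) :
    G.leafTuple i (G.leafSeq i z) z = fun j => G.leafSeq j z :=
  Function.update_eq_self i (fun j => G.leafSeq j z)

theorem forall_plays_leafTuple {i : Fin n} {s : G.Seq i} {z : G.leaves} {p : ∀ j, G.Plan j} :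
    (∀ j, G.Plays (p j) (G.leafTuple i s z j)) ↔
      G.Plays (p i) s ∧ ∀ j, j ≠ i → G.Plays (p j) (G.leafSeq j z) := by
  constructor
  · intro h
    refine ⟨by simpa [leafTuple] using h i, fun j hj => ?_⟩
    simpa [leafTuple, Function.update_of_ne hj] using h j
  · rintro ⟨h1, h2⟩ j
    by_cases hj : j = i
    · subst hj
      simpa [leafTuple] using h1
    · simpa [leafTuple, Function.update_of_ne hj] using h2 j hj

/-! ### Utilities as functions of the correlation plan -/

theorem dotProduct_leafMatrix_mulVec {i : Fin n} (Q : G.leaves → Prop) (c : G.leaves → ℝ)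
    (τ : G.leaves → ∀ j, G.Seq j) (σ : G.leaves → G.Seq i) (ξ : G.RelTuple → ℝ)
    (y : G.Seq i → ℝ) :
    ξ ⬝ᵥ (Matrix.mulVec (fun t s => ∑ z, if Q z ∧ t.1 = τ z ∧ s = σ z then c z else 0) y) =
      ∑ z, if Q z then c z * G.extend ξ (τ z) * y (σ z) else 0 := by
  simp only [dotProduct, Matrix.mulVec, Finset.sum_mul, Finset.mul_sum]
  have h1 : ∀ t : G.RelTuple, ∑ s : G.Seq i, ∑ z : G.leaves,
      ξ t * ((if Q z ∧ t.1 = τ z ∧ s = σ z then c z else 0) * y s) =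
      ∑ z : G.leaves, if Q z then c z * (if t.1 = τ z then ξ t else 0) * y (σ z) else 0 := by
    intro t
    rw [Finset.sum_comm]
    refine Finset.sum_congr rfl fun z _ => ?_
    rw [Finset.sum_eq_single (σ z)]
    · by_cases hQ : Q z <;> by_cases ht : t.1 = τ z <;> simp [hQ, ht]
      ring
    · intro s _ hs
      simp [hs]
    · simp
  rw [Finset.sum_congr rfl fun t _ => h1 t, Finset.sum_comm]
  refine Finset.sum_congr rfl fun z _ => ?_
  split_ifs
  · rw [← sum_ite_eq_extend, Finset.mul_sum, Finset.sum_mul]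
  · simp

theorem leafVec_dotProduct (Q : G.leaves → Prop) (c : G.leaves → ℝ)
    (τ : G.leaves → ∀ j, G.Seq j) (ξ : G.RelTuple → ℝ) :
    (fun t : G.RelTuple => ∑ z, if Q z ∧ t.1 = τ z then c z else 0) ⬝ᵥ ξ =
      ∑ z, if Q z then c z * G.extend ξ (τ z) else 0 := by
  simp only [dotProduct, Finset.sum_mul]
  rw [Finset.sum_comm]
  refine Finset.sum_congr rfl fun z _ => ?_
  rw [← sum_ite_eq_extend, Finset.mul_sum]
  by_cases hQ : Q z
  · simp only [hQ, true_and, if_true]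
    refine Finset.sum_congr rfl fun t _ => ?_
    split_ifs <;> simp
  · simp [hQ]

theorem dotProduct_matA_mulVec (i : Fin n) (ξ : G.RelTuple → ℝ) (y : G.Seq i → ℝ) :
    ξ ⬝ᵥ (G.matA i *ᵥ y) = ∑ z : G.leaves, G.chanceReach z * G.payoff i z *
      G.extend ξ (G.leafTuple i (G.emptySeq i) z) * y (G.leafSeq i z) := by
  have := dotProduct_leafMatrix_mulVec (fun _ => True) (fun z => G.chanceReach z * G.payoff i z)
    (fun z => G.leafTuple i (G.emptySeq i) z) (fun z => G.leafSeq i z) ξ y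
  simp only [true_and, if_true] at this
  rw [← this]
  rfl

theorem vecB_dotProduct (i : Fin n) (ξ : G.RelTuple → ℝ) :
    G.vecB i ⬝ᵥ ξ = ∑ z : G.leaves, G.chanceReach z * G.payoff i z *
      G.extend ξ (fun j => G.leafSeq j z) := by
  have := leafVec_dotProduct (fun _ => True) (fun z => G.chanceReach z * G.payoff i z)
    (fun z => G.leafTuple i (G.leafSeq i z) z) ξ
  simp only [true_and, if_true, leafTuple_self] at this
  rw [← this]
  simp only [← leafTuple_self i]
  rfl

theorem dotProduct_trigA_mulVec (I : G.Info) (ξ : G.RelTuple → ℝ)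
    (y : G.Seq (G.player I) → ℝ) :
    ξ ⬝ᵥ (G.trigA I *ᵥ y) = ∑ z : G.leaves, if G.Through I z then
      G.chanceReach z * G.payoff (G.player I) z *
      G.extend ξ (G.leafTuple (G.player I) (G.parentSeq I) z) * y (G.leafSeq (G.player I) z)
      else 0 :=
  dotProduct_leafMatrix_mulVec _ _ _ _ ξ y

theorem trigB_dotProduct (I : G.Info) (ξ : G.RelTuple → ℝ) :
    G.trigB I ⬝ᵥ ξ = ∑ z : G.leaves, if G.Through I z then
      G.chanceReach z * G.payoff (G.player I) z * G.extend ξ (fun j => G.leafSeq j z) else 0 := by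
  have := leafVec_dotProduct (fun z => G.Through I z)
    (fun z => G.chanceReach z * G.payoff (G.player I) z)
    (fun z => G.leafTuple (G.player I) (G.leafSeq (G.player I) z) z) ξ
  simp only [leafTuple_self] at this
  rw [← this]
  simp only [← leafTuple_self (G.player I)]
  rfl

theorem extend_leafSeq_corrPlan (μ : (∀ i, G.Plan i) → ℝ) (z : G.leaves) :
    G.extend (G.corrPlan μ) (fun j => G.leafSeq j z) =
      ∑ p with ∀ j, G.Plays (p j) (G.leafSeq j z), μ p :=
  extend_corrPlan μ fun _ _ _ => relevant_of_through (G.leaf_mem z)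
    (fun _ hm => through_of_mem_seqAt hm) fun _ hm => through_of_mem_seqAt hm

theorem utility_eq (μ : (∀ i, G.Plan i) → ℝ) (i : Fin n) :
    G.utility μ i = G.vecB i ⬝ᵥ G.corrPlan μ := by
  rw [vecB_dotProduct]
  simp only [extend_leafSeq_corrPlan]
  rfl

theorem deviationUtility_sub_utility (μ : (∀ i, G.Plan i) → ℝ) (i : Fin n) (ν : G.Plan i → ℝ) :
    G.deviationUtility μ i ν - G.utility μ i =
      benefit G.matA G.vecB i (G.inducedSeq i ν) (G.corrPlan μ) := by
  rw [benefit_apply, utility_eq, dotProduct_matA_mulVec, deviationUtility]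
  congr 1
  refine Finset.sum_congr rfl fun z _ => ?_
  rw [extend_corrPlan μ (leafTuple_relevant fun m hm => by cases hm)]
  simp only [forall_plays_leafTuple, plays_empty, true_and]
  rfl

theorem triggerUtility_sub_utility (μ : (∀ i, G.Plan i) → ℝ) (I : G.Info)
    (ν : G.Plan (G.player I) → ℝ) :
    G.triggerUtility μ I ν - G.utility μ (G.player I) =
      benefit G.trigA G.trigB I (G.inducedSeq (G.player I) ν) (G.corrPlan μ) := by
  rw [benefit_apply, dotProduct_trigA_mulVec, trigB_dotProduct, triggerUtility, utility,
    ← Finset.sum_sub_distrib, ← Finset.sum_sub_distrib]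
  refine Finset.sum_congr rfl fun z _ => ?_
  split_ifs with h
  · rw [extend_corrPlan μ (leafTuple_relevant (through_parentSeq h)), extend_leafSeq_corrPlan]
    simp only [forall_plays_leafTuple, inducedSeq, mul_assoc]
  · simp

theorem welfare_eq (μ : (∀ i, G.Plan i) → ℝ) :
    G.welfare μ = (∑ i, G.vecB i) ⬝ᵥ G.corrPlan μ := by
  rw [sum_dotProduct]
  exact Finset.sum_congr rfl fun i _ => utility_eq μ i

/-! ### Incentive constraints -/

/-- the plans of the player of `I` that play the parent sequence of `I` -/
abbrev TrigPlan (I : G.Info) : Type := {p : G.Plan (G.player I) // G.Plays p (G.parentSeq I)}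

instance (I : G.Info) : Nonempty (TrigPlan I) := by
  obtain ⟨F, hF⟩ := exists_profile_follows (G.rep_mem I)
  exact ⟨⟨planOf F _, (plays_planOf F _).2 (hF _)⟩⟩

/-- the sequence-form strategies of the plans in `TrigPlan I` -/
def trigVec (I : G.Info) (p : TrigPlan I) : G.Seq (G.player I) → ℝ := planVec p.1

theorem seqForm_sep_eq (I : G.Info) :
    {y ∈ G.seqForm (G.player I) | y (G.parentSeq I) = 1} =
      convexHull ℝ (Set.range (trigVec I)) := seqForm_sep_eq_convexHull _

theorem image_triggerDist (I : G.Info) :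
    G.inducedSeq (G.player I) '' G.triggerDist I =
      convexHull ℝ (Set.range (trigVec I)) := by
  rw [← seqForm_sep_eq]
  ext y
  constructor
  · rintro ⟨ν, ⟨hν, hs⟩, rfl⟩
    exact ⟨⟨ν, hν, rfl⟩, (inducedSeq_eq_one_iff hν _).2 hs⟩
  · rintro ⟨⟨ν, hν, rfl⟩, hs⟩
    exact ⟨ν, ⟨hν, (inducedSeq_eq_one_iff hν _).1 hs⟩, rfl⟩

theorem deviation_set_eq (μ : (∀ i, G.Plan i) → ℝ) :
    {d | ∃ i, ∃ ν ∈ G.PlanDist i, d = G.deviationUtility μ i ν - G.utility μ i} =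
      {d | ∃ i, ∃ y ∈ convexHull ℝ (Set.range (planVec : G.Plan i → _)),
        d = benefit G.matA G.vecB i y (G.corrPlan μ)} := by
  ext d
  simp only [← seqForm_eq_convexHull, seqForm, Set.mem_ofPred_eq, Set.exists_mem_image,
    deviationUtility_sub_utility]

theorem trigger_set_eq (μ : (∀ i, G.Plan i) → ℝ) :
    {d | ∃ I, ∃ ν ∈ G.triggerDist I, d = G.triggerUtility μ I ν - G.utility μ (G.player I)} =
      {d | ∃ I, ∃ y ∈ convexHull ℝ (Set.range (trigVec I)),
        d = benefit G.trigA G.trigB I y (G.corrPlan μ)} := by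
  ext d
  simp only [← image_triggerDist, Set.mem_ofPred_eq, Set.exists_mem_image,
    triggerUtility_sub_utility]

theorem isNFCCE_iff {μ : (∀ i, G.Plan i) → ℝ} (hμ : μ ∈ G.CorrDist) :
    G.IsNFCCE μ ↔ ∀ i (p : G.Plan i), benefit G.matA G.vecB i (planVec p) (G.corrPlan μ) ≤ 0 := by
  have h : G.IsNFCCE μ ↔ ∀ d ∈ {d | ∃ i, ∃ ν ∈ G.PlanDist i,
      d = G.deviationUtility μ i ν - G.utility μ i}, d ≤ 0 := by
    constructor
    · rintro ⟨-, h⟩ _ ⟨i, ν, hν, rfl⟩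
      exact sub_nonpos.2 (h i ν hν)
    · intro h
      exact ⟨hμ, fun i ν hν => sub_nonpos.1 (h _ ⟨i, ν, hν, rfl⟩)⟩
  rw [h, deviation_set_eq]
  constructor
  · intro h i p
    exact h _ ⟨i, _, subset_convexHull ℝ _ ⟨p, rfl⟩, rfl⟩
  · rintro h _ ⟨i, y, hy, rfl⟩
    exact benefit_le_of_mem_convexHull G.matA G.vecB (fun i => planVec) (h i) hy

theorem isEFCCE_iff {μ : (∀ i, G.Plan i) → ℝ} (hμ : μ ∈ G.CorrDist) :
    G.IsEFCCE μ ↔ ∀ I (p : TrigPlan I),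
      benefit G.trigA G.trigB I (trigVec I p) (G.corrPlan μ) ≤ 0 := by
  have h : G.IsEFCCE μ ↔ ∀ d ∈ {d | ∃ I, ∃ ν ∈ G.triggerDist I,
      d = G.triggerUtility μ I ν - G.utility μ (G.player I)}, d ≤ 0 := by
    constructor
    · rintro ⟨-, h⟩ _ ⟨i, ν, hν, rfl⟩
      exact sub_nonpos.2 (h i ν hν)
    · intro h
      exact ⟨hμ, fun i ν hν => sub_nonpos.1 (h _ ⟨i, ν, hν, rfl⟩)⟩
  rw [h, trigger_set_eq]
  constructor
  · intro h i p
    exact h _ ⟨i, _, subset_convexHull ℝ _ ⟨p, rfl⟩, rfl⟩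
  · rintro h _ ⟨i, y, hy, rfl⟩
    exact benefit_le_of_mem_convexHull G.trigA G.trigB trigVec (h i) hy

theorem nfccePlans_eq : G.nfccePlans = {ξ ∈ G.corrPolytope |
    ∀ i (p : G.Plan i), benefit G.matA G.vecB i (planVec p) ξ ≤ 0} := by
  ext ξ
  constructor
  · rintro ⟨μ, hμ, rfl⟩
    exact ⟨⟨μ, hμ.1, rfl⟩, (isNFCCE_iff hμ.1).1 hμ⟩
  · rintro ⟨⟨μ, hμ, rfl⟩, h⟩
    exact ⟨μ, (isNFCCE_iff hμ).2 h, rfl⟩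

theorem efccePlans_eq : G.efccePlans = {ξ ∈ G.corrPolytope |
    ∀ I (p : TrigPlan I), benefit G.trigA G.trigB I (trigVec I p) ξ ≤ 0} := by
  ext ξ
  constructor
  · rintro ⟨μ, hμ, rfl⟩
    exact ⟨⟨μ, hμ.1, rfl⟩, (isEFCCE_iff hμ.1).1 hμ⟩
  · rintro ⟨⟨μ, hμ, rfl⟩, h⟩
    exact ⟨μ, (isEFCCE_iff hμ).2 h, rfl⟩

theorem isNFCCE_iff_mem {μ : (∀ i, G.Plan i) → ℝ} (hμ : μ ∈ G.CorrDist) :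
    G.IsNFCCE μ ↔ G.corrPlan μ ∈ G.nfccePlans := by
  rw [isNFCCE_iff hμ, nfccePlans_eq]
  exact ⟨fun h => ⟨⟨μ, hμ, rfl⟩, h⟩, fun h => h.2⟩

theorem isEFCCE_iff_mem {μ : (∀ i, G.Plan i) → ℝ} (hμ : μ ∈ G.CorrDist) :
    G.IsEFCCE μ ↔ G.corrPlan μ ∈ G.efccePlans := by
  rw [isEFCCE_iff hμ, efccePlans_eq]
  exact ⟨fun h => ⟨⟨μ, hμ, rfl⟩, h⟩, fun h => h.2⟩

theorem isCompact_setOf_benefit_le {ι : Type} {W P : ι → Type} [∀ k, Fintype (W k)]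
    (A : ∀ k, Matrix G.RelTuple (W k) ℝ) (b : ι → G.RelTuple → ℝ) (e : ∀ k, P k → W k → ℝ) :
    IsCompact {ξ ∈ G.corrPolytope | ∀ k p, benefit A b k (e k p) ξ ≤ 0} := by
  have h : {ξ ∈ G.corrPolytope | ∀ k p, benefit A b k (e k p) ξ ≤ 0} =
      G.corrPolytope ∩ ⋂ k, ⋂ p, {ξ | benefit A b k (e k p) ξ ≤ 0} := by
    ext ξ
    simp
  rw [h]
  refine isCompact_corrPolytope.inter_right ?_
  exact isClosed_iInter fun k => isClosed_iInter fun p =>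
    isClosed_le (benefit A b k (e k p)).continuous_of_finiteDimensional continuous_const

/-! ### Dual linear programs -/

theorem transpose_mulVec_dotProduct {V W : Type} [Fintype V] [Fintype W] (A : Matrix V W ℝ)
    (ξ : V → ℝ) (y : W → ℝ) : (Aᵀ *ᵥ ξ) ⬝ᵥ y = ξ ⬝ᵥ (A *ᵥ y) := by
  rw [Matrix.mulVec_transpose, ← Matrix.dotProduct_mulVec]

theorem exists_nfcceDual_iff (ξ : G.RelTuple → ℝ) (u : ℝ) :
    (∃ v, G.NFCCEDual ξ u v) ↔
      ∀ i (p : G.Plan i), benefit G.matA G.vecB i (planVec p) ξ ≤ u := by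
  constructor
  · rintro ⟨v, h1, h2⟩ i p
    have h3 := dotProduct_le_of_dual (fun s => sub_nonneg.1 (h2 i s)) (planVec_nonneg p)
      (isFlow_planVec p)
    have h4 := h1 i
    rw [transpose_mulVec_dotProduct] at h3
    rw [dotProduct_flowRhs] at h4
    rw [benefit_apply]
    linarith
  · intro h
    choose v p hv hp using fun i => exists_dual ((G.matA i)ᵀ *ᵥ ξ)
    refine ⟨v, fun i => ?_, fun i s => sub_nonneg.2 (hv i s)⟩
    have h1 := h i (p i)
    have h2 := hp i
    rw [transpose_mulVec_dotProduct] at h2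
    rw [benefit_apply] at h1
    rw [dotProduct_flowRhs]
    linarith

theorem exists_efcceDual_iff (ξ : G.RelTuple → ℝ) (u : ℝ) :
    (∃ w v, G.EFCCEDual ξ u w v) ↔
      ∀ I (p : TrigPlan I), benefit G.trigA G.trigB I (trigVec I p) ξ ≤ u := by
  constructor
  · rintro ⟨w, v, h1, h2⟩ I p
    have h3 := dotProduct_le_of_dual (g := (G.trigA I)ᵀ *ᵥ ξ - Pi.single (G.parentSeq I) (w I))
      (v := v I) (fun s => by
        have := h2 I s
        rw [Pi.sub_apply, Pi.single_apply]
        linarith) (planVec_nonneg p.1) (isFlow_planVec p.1)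
    have h5 : planVec p.1 (G.parentSeq I) = 1 := if_pos p.2
    have h4 := h1 I
    rw [sub_dotProduct, transpose_mulVec_dotProduct, single_dotProduct, h5] at h3
    rw [dotProduct_flowRhs] at h4
    rw [benefit_apply, trigVec]
    linarith
  · intro h
    choose w v p hp hv he using fun I => exists_dual_of_plays ((G.trigA I)ᵀ *ᵥ ξ) (G.parentSeq I)
      (let q : TrigPlan I := Classical.arbitrary _; ⟨q.1, q.2⟩)
    refine ⟨w, v, fun I => ?_, fun I s => sub_nonneg.2 (hv I s)⟩
    have h1 := h I ⟨p I, hp I⟩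
    have h2 := he I
    rw [transpose_mulVec_dotProduct] at h2
    rw [benefit_apply, trigVec] at h1
    rw [dotProduct_flowRhs]
    linarith

theorem image_nfcceLP : (fun x t => x (Sum.inl t)) '' G.nfcceLP = G.nfccePlans := by
  rw [nfccePlans_eq]
  ext ξ
  constructor
  · rintro ⟨x, ⟨h1, h2, h3⟩, rfl⟩
    exact ⟨h3, fun i p => ((exists_nfcceDual_iff _ _).1 ⟨_, h1⟩ i p).trans h2⟩
  · rintro ⟨h1, h2⟩
    obtain ⟨v, hv⟩ := (exists_nfcceDual_iff ξ 0).2 h2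
    exact ⟨Sum.elim ξ (Sum.elim (fun _ => 0) fun r => v r.1 r.2), ⟨hv, le_rfl, h1⟩, rfl⟩

theorem image_efcceLP : (fun x t => x (Sum.inl t)) '' G.efcceLP = G.efccePlans := by
  rw [efccePlans_eq]
  ext ξ
  constructor
  · rintro ⟨x, ⟨h1, h2, h3⟩, rfl⟩
    exact ⟨h3, fun i p => ((exists_efcceDual_iff _ _).1 ⟨_, _, h1⟩ i p).trans h2⟩
  · rintro ⟨h1, h2⟩
    obtain ⟨w, v, hv⟩ := (exists_efcceDual_iff ξ 0).2 h2
    exact ⟨Sum.elim ξ (Sum.elim (fun _ => 0) (Sum.elim w fun r => v r.1 r.2)),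
      ⟨hv, le_rfl, h1⟩, rfl⟩

theorem isSolutionSet_nfcceLP {k : ℕ} (h : IsSolutionSet G.corrPolytope k) :
    IsSolutionSet G.nfcceLP (k + Fintype.card (Fin n ⊕ (Σ i, G.Seq i) ⊕ Unit)) := by
  let X : (G.NFCCEVar → ℝ) →ₗ[ℝ] (G.RelTuple → ℝ) := LinearMap.funLeft ℝ ℝ Sum.inl
  let U : (G.NFCCEVar → ℝ) →ₗ[ℝ] ℝ := LinearMap.proj (Sum.inr (Sum.inl ()))
  let v : ∀ i, (G.NFCCEVar → ℝ) →ₗ[ℝ] (Option (G.InfoOf i) → ℝ) := fun i =>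
    LinearMap.funLeft ℝ ℝ fun r => Sum.inr (Sum.inr ⟨i, r⟩)
  refine h.inter_preimage X
    (Sum.elim (fun i => U - (dotProductBilin ℝ ℝ (G.flowRhs i)).comp (v i) +
      (dotProductBilin ℝ ℝ (G.vecB i)).comp X) (Sum.elim (fun r =>
      (LinearMap.proj r.2).comp ((G.flowMat r.1)ᵀ.mulVecLin.comp (v r.1) -
        (G.matA r.1)ᵀ.mulVecLin.comp X)) fun _ => -U)) 0 fun x => ?_
  simp only [Sum.forall, Sum.elim_inl, Sum.elim_inr, Sigma.forall]
  have hc : ∀ i, G.flowRhs i ⬝ᵥ v i x = v i x ⬝ᵥ G.flowRhs i := fun i => dotProduct_comm _ _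
  change (((∀ i, 0 ≤ _) ∧ _) ∧ _ ≤ (0 : ℝ) ∧ _) ↔
    _ ∧ (∀ i, 0 ≤ U x - G.flowRhs i ⬝ᵥ v i x + _) ∧ _ ∧ ∀ _, 0 ≤ -(U x)
  simp only [hc, neg_nonneg, forall_const]
  constructor
  · rintro ⟨⟨h1, h2⟩, h3, h4⟩
    exact ⟨h4, h1, h2, h3⟩
  · rintro ⟨h4, h1, h2, h3⟩
    exact ⟨⟨h1, h2⟩, h3, h4⟩

theorem isSolutionSet_efcceLP {k : ℕ} (h : IsSolutionSet G.corrPolytope k) :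
    IsSolutionSet G.efcceLP
      (k + Fintype.card (G.Info ⊕ (Σ I : G.Info, G.Seq (G.player I)) ⊕ Unit)) := by
  let X : (G.EFCCEVar → ℝ) →ₗ[ℝ] (G.RelTuple → ℝ) := LinearMap.funLeft ℝ ℝ Sum.inl
  let U : (G.EFCCEVar → ℝ) →ₗ[ℝ] ℝ := LinearMap.proj (Sum.inr (Sum.inl ()))
  let w : G.Info → (G.EFCCEVar → ℝ) →ₗ[ℝ] ℝ := fun I =>
    LinearMap.proj (Sum.inr (Sum.inr (Sum.inl I)))
  let v : ∀ I, (G.EFCCEVar → ℝ) →ₗ[ℝ] (Option (G.InfoOf (G.player I)) → ℝ) := fun I =>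
    LinearMap.funLeft ℝ ℝ fun r => Sum.inr (Sum.inr (Sum.inr ⟨I, r⟩))
  refine h.inter_preimage X
    (Sum.elim (fun I => U - w I - (dotProductBilin ℝ ℝ (G.flowRhs (G.player I))).comp (v I) +
      (dotProductBilin ℝ ℝ (G.trigB I)).comp X) (Sum.elim (fun r =>
      (LinearMap.proj r.2).comp ((G.flowMat (G.player r.1))ᵀ.mulVecLin.comp (v r.1)) +
        (if r.2 = G.parentSeq r.1 then w r.1 else 0) -
        (LinearMap.proj r.2).comp ((G.trigA r.1)ᵀ.mulVecLin.comp X)) fun _ => -U)) 0 fun x => ?_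
  simp only [Sum.forall, Sum.elim_inl, Sum.elim_inr, Sigma.forall]
  have hc : ∀ I, G.flowRhs (G.player I) ⬝ᵥ v I x = v I x ⬝ᵥ G.flowRhs (G.player I) :=
    fun I => dotProduct_comm _ _
  have hw : ∀ I s, (if s = G.parentSeq I then w I else 0) x =
      if s = G.parentSeq I then w I x else 0 := fun I s => by split_ifs <;> rfl
  simp only [LinearMap.sub_apply, LinearMap.add_apply, hw]
  change (((∀ i, 0 ≤ _) ∧ _) ∧ _ ≤ (0 : ℝ) ∧ _) ↔
    _ ∧ (∀ I, 0 ≤ U x - w I x - G.flowRhs (G.player I) ⬝ᵥ v I x + _) ∧ _ ∧ ∀ _, 0 ≤ -(U x)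
  simp only [hc, neg_nonneg, forall_const]
  constructor
  · rintro ⟨⟨h1, h2⟩, h3, h4⟩
    exact ⟨h4, h1, h2, h3⟩
  · rintro ⟨h4, h1, h2, h3⟩
    exact ⟨⟨h1, h2⟩, h3, h4⟩

/-! ### Independent strategies -/

/-- Players who mix independently induce a correlation plan of product form. -/
theorem exists_product_corrPlan (y : ∀ i, G.Seq i → ℝ) (hy : ∀ i, y i ∈ G.seqForm i) :
    ∃ ξ ∈ G.corrPolytope, ∀ t : G.RelTuple, ξ t = ∏ i, y i (t.1 i) := by
  choose ν hν hνy using hy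
  have hsum : ∀ g : ∀ i, G.Plan i → ℝ, ∑ p : ∀ i, G.Plan i, ∏ i, g i (p i) = ∏ i, ∑ q, g i q := by
    intro g
    rw [Finset.prod_univ_sum, Fintype.piFinset_univ]
  refine ⟨G.corrPlan fun p => ∏ i, ν i (p i), ⟨_, ⟨fun p => ?_, ?_⟩, rfl⟩, fun t => ?_⟩
  · exact Finset.prod_nonneg fun i _ => (hν i).1 _
  · rw [hsum]
    exact Finset.prod_eq_one fun i _ => (hν i).2
  · have h1 : ∀ i, y i (t.1 i) = ∑ q, if G.Plays q (t.1 i) then ν i q else 0 := by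
      intro i
      rw [← hνy, inducedSeq, Finset.sum_filter]
    simp only [h1]
    rw [← hsum, corrPlan, Finset.sum_filter]
    refine Finset.sum_congr rfl fun p _ => ?_
    rw [Finset.prod_ite_zero]
    simp

theorem extend_leafTuple_of_product {y : ∀ i, G.Seq i → ℝ} {ξ : G.RelTuple → ℝ}
    (hξ : ∀ t : G.RelTuple, ξ t = ∏ i, y i (t.1 i)) {i : Fin n} {s : G.Seq i} {z : G.leaves}
    (hs : ∀ m ∈ s.1, G.Through m.1 z.1) : G.extend ξ (G.leafTuple i s z) =
      y i s * ∏ j ∈ Finset.univ.erase i, y j (G.leafSeq j z) := by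
  rw [extend, dif_pos (leafTuple_relevant hs), hξ, ← Finset.mul_prod_erase _ _ (Finset.mem_univ i)]
  congr 1
  · simp [leafTuple]
  · refine Finset.prod_congr rfl fun j hj => ?_
    simp [leafTuple, Function.update_of_ne (Finset.ne_of_mem_erase hj)]

theorem extend_leafSeq_of_product {y : ∀ i, G.Seq i → ℝ} {ξ : G.RelTuple → ℝ}
    (hξ : ∀ t : G.RelTuple, ξ t = ∏ i, y i (t.1 i)) (i : Fin n) (z : G.leaves) :
    G.extend ξ (fun j => G.leafSeq j z) =
      y i (G.leafSeq i z) * ∏ j ∈ Finset.univ.erase i, y j (G.leafSeq j z) := by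
  rw [← leafTuple_self i,
    extend_leafTuple_of_product hξ (s := G.leafSeq i z) fun m hm => through_of_mem_seqAt hm]

theorem benefit_product_eq_zero {y : ∀ i, G.Seq i → ℝ} (hy : ∀ i, y i ∈ G.seqForm i)
    {ξ : G.RelTuple → ℝ} (hξ : ∀ t : G.RelTuple, ξ t = ∏ i, y i (t.1 i)) (i : Fin n) :
    benefit G.matA G.vecB i (y i) ξ = 0 := by
  rw [benefit_apply, dotProduct_matA_mulVec, vecB_dotProduct, ← Finset.sum_sub_distrib]
  refine Finset.sum_eq_zero fun z _ => ?_
  rw [extend_leafTuple_of_product hξ (s := G.emptySeq i) (fun m hm => by cases hm),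
    extend_leafSeq_of_product hξ i, (isFlow_of_mem_seqForm (hy i)).2.1]
  ring

theorem sum_smul_benefit {V ι P : Type} [Fintype V] [Fintype P] {W : ι → Type}
    [∀ k, Fintype (W k)] (A : ∀ k, Matrix V (W k) ℝ) (b : ι → V → ℝ) (k : ι) (w : P → ℝ)
    (e : P → W k → ℝ) (ξ : V → ℝ) : ∑ p, w p * benefit A b k (e p) ξ =
      ξ ⬝ᵥ (A k *ᵥ ∑ p, w p • e p) - (∑ p, w p) * (b k ⬝ᵥ ξ) := by
  rw [Matrix.mulVec_sum, dotProduct_sum, Finset.sum_mul, ← Finset.sum_sub_distrib]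
  refine Finset.sum_congr rfl fun p _ => ?_
  rw [benefit_apply, Matrix.mulVec_smul, dotProduct_smul, smul_eq_mul]
  ring

/-- An NFCCE exists: against given weights on the deviations, all players mix independently
according to their weights. -/
theorem nfccePlans_nonempty : G.nfccePlans.Nonempty := by
  rw [nfccePlans_eq]
  obtain ⟨ξ, hξ, h⟩ := exists_forall_nonpos_of_forall_weights convex_corrPolytope
    isCompact_corrPolytope
    (fun x : Σ i, G.Plan i => benefit G.matA G.vecB x.1 (planVec x.2)) (by
    intro w hw
    have : ∀ i, ∃ y ∈ G.seqForm i,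
        ∑ p : G.Plan i, w ⟨i, p⟩ • planVec p = (∑ p : G.Plan i, w ⟨i, p⟩) • y := by
      intro i
      by_cases h0 : ∑ p : G.Plan i, w ⟨i, p⟩ = 0
      · have hz : ∀ p, w ⟨i, p⟩ = 0 := fun p =>
          (Finset.sum_eq_zero_iff_of_nonneg fun p _ => hw ⟨i, p⟩).1 h0 p (Finset.mem_univ p)
        exact ⟨_, planVec_mem i (Classical.arbitrary _), by simp [hz]⟩
      · refine ⟨G.inducedSeq i fun p => w ⟨i, p⟩ / ∑ p : G.Plan i, w ⟨i, p⟩,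
          ⟨_, ⟨fun p => div_nonneg (hw _) (Finset.sum_nonneg fun p _ => hw _), ?_⟩, rfl⟩, ?_⟩
        · rw [← Finset.sum_div, div_self h0]
        · rw [inducedSeq_eq, Finset.smul_sum]
          refine Finset.sum_congr rfl fun p _ => ?_
          rw [smul_smul, mul_div_cancel₀ _ h0]
    choose y hy hyw using this
    obtain ⟨ξ, hξ, hp⟩ := exists_product_corrPlan y hy
    refine ⟨ξ, hξ, ?_⟩
    rw [Fintype.sum_sigma]
    refine (Finset.sum_eq_zero fun i _ => ?_).le
    have := benefit_product_eq_zero hy hp i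
    rw [benefit_apply] at this
    rw [sum_smul_benefit G.matA G.vecB i (fun p => w ⟨i, p⟩) planVec ξ, hyw, Matrix.mulVec_smul,
      dotProduct_smul, smul_eq_mul, ← mul_sub, this, mul_zero])
  exact ⟨ξ, hξ, fun i p => h ⟨i, p⟩⟩

/-! ### Strategies that are stationary under trigger deviations -/

/-- `I` is one of the information sets at which the sequence `s` moves -/
def Above {i : Fin n} (I : G.InfoOf i) (s : G.Seq i) : Prop := ∃ a, (I.1, a) ∈ G.seqMoves s

theorem not_above_empty {i : Fin n} (I : G.InfoOf i) : ¬ Above I (G.emptySeq i) := by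
  rintro ⟨a, ha⟩
  simp [seqMoves_empty] at ha

theorem above_mv {i : Fin n} {I J : G.InfoOf i} {a : G.acts J.1} :
    Above I (mv J a) ↔ I = J ∨ Above I (par J) := by
  unfold Above
  rw [seqMoves_mv']
  constructor
  · rintro ⟨b, hb⟩
    rcases List.mem_cons.1 hb with h | h
    · left
      exact Subtype.ext (congrArg Prod.fst h)
    · exact Or.inr ⟨b, h⟩
  · rintro (rfl | ⟨b, hb⟩)
    · exact ⟨a, List.mem_cons_self⟩
    · exact ⟨b, List.mem_cons_of_mem _ hb⟩

theorem depth_lt_of_above {i : Fin n} {I J : G.InfoOf i} (h : Above I (par J)) :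
    depth I.1 < depth J.1 := by
  obtain ⟨a, ha⟩ := h
  rw [seqMoves_par] at ha
  exact depth_lt_of_mem J.2 ha

theorem not_above_par {i : Fin n} (J : G.InfoOf i) : ¬ Above J (par J) := fun h =>
  lt_irrefl _ (depth_lt_of_above h)

theorem length_seqMoves_par {i : Fin n} (I : G.InfoOf i) :
    (G.seqMoves (par I)).length = depth I.1 := by
  obtain ⟨I, rfl⟩ := I
  rw [seqMoves_par]
  rfl

theorem length_seqMoves_mv {i : Fin n} (I : G.InfoOf i) (a : G.acts I.1) :
    (G.seqMoves (mv I a)).length = depth I.1 + 1 := by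
  rw [seqMoves_mv', List.length_cons, length_seqMoves_par]

theorem through_iff_above {i : Fin n} (I : G.InfoOf i) (z : G.leaves) :
    G.Through I.1 z.1 ↔ Above I (G.leafSeq i z) := by
  obtain ⟨I, rfl⟩ := I
  rw [through_iff, Above, seqMoves_leafSeq]

/-- Given a deviation `r_I` of weight `λ_I` for every information set `I` of Player `i`, some
strategy of the player does not change on average if a deviation is applied at random. Its
behaviour at an information set is computed from its behaviour at the preceding ones. -/
theorem exists_stationary {i : Fin n} (l : G.InfoOf i → ℝ) (r : G.InfoOf i → G.Seq i → ℝ)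
    (hl : ∀ I, 0 ≤ l I) (hr : ∀ I s, 0 ≤ r I s)
    (hflow : ∀ I J, ∑ a, r I (mv J a) = r I (par J)) (hpar : ∀ I, r I (par I) = l I)
    (hz : ∀ I, l I = 0 → ∀ s, r I s = 0) :
    ∃ y ∈ G.seqForm i, ∀ s,
      (∑ I, if Above I s then y (par I) * r I s else 0) =
        (∑ I, if Above I s then l I else 0) * y s := by
  let d : ∀ J : G.InfoOf i, G.acts J.1 := fun J => ⟨_, (G.acts_nonempty J.1).choose_spec⟩
  let Φ : (Option (Σ I : G.InfoOf i, G.acts I.1) → ℝ) → Option (Σ I : G.InfoOf i, G.acts I.1) → ℝ :=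
    fun y o => match o with
    | none => 1
    | some ⟨J, a⟩ =>
      if (∑ I, if Above I (mv J a) then l I else 0) = 0 then
        if a = d J then y ((seqEquiv i).symm (par J)) else 0
      else (∑ I, if Above I (mv J a) then y ((seqEquiv i).symm (par I)) * r I (mv J a) else 0) /
        ∑ I, if Above I (mv J a) then l I else 0
  obtain ⟨y', hy'⟩ := exists_fixedPoint_of_rank
    (fun o => (G.seqMoves (seqEquiv i o)).length) Φ (by
      rintro y y' (_ | ⟨J, a⟩) h
      · rfl
      · have hlt : ∀ I : G.InfoOf i, Above I (mv J a) → y ((seqEquiv i).symm (par I)) =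
            y' ((seqEquiv i).symm (par I)) := by
          intro I hI
          refine h _ ?_
          change (G.seqMoves (seqEquiv i ((seqEquiv i).symm (par I)))).length <
            (G.seqMoves (mv J a)).length
          rw [Equiv.apply_symm_apply, length_seqMoves_par, length_seqMoves_mv]
          rcases above_mv.1 hI with rfl | hI
          · exact Nat.lt_succ_self _
          · exact (depth_lt_of_above hI).trans (Nat.lt_succ_self _)
        simp only [Φ]
        rw [hlt J (above_mv.2 (Or.inl rfl))]
        congr 2
        refine Finset.sum_congr rfl fun I _ => ?_
        split_ifs with hI
        · rw [hlt I hI]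
        · rfl)
  let y : G.Seq i → ℝ := fun s => y' ((seqEquiv i).symm s)
  have hy0 : y (G.emptySeq i) = 1 := by
    have : (seqEquiv i).symm (G.emptySeq i) = none := (Equiv.symm_apply_eq _).2 rfl
    simp only [y, this]
    rw [hy']
  have hymv : ∀ J a, y (mv J a) = if (∑ I, if Above I (mv J a) then l I else 0) = 0 then
        if a = d J then y (par J) else 0
      else (∑ I, if Above I (mv J a) then y (par I) * r I (mv J a) else 0) /
        ∑ I, if Above I (mv J a) then l I else 0 := by
    intro J a
    have : (seqEquiv i).symm (mv J a) = some ⟨J, a⟩ := (Equiv.symm_apply_eq _).2 rfl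
    change y' _ = _
    rw [this, hy']
  have hstat : ∀ s, (∑ I, if Above I s then y (par I) * r I s else 0) =
      (∑ I, if Above I s then l I else 0) * y s := by
    intro s
    rcases seq_cases s with rfl | ⟨J, a, rfl⟩
    · simp [not_above_empty]
    · by_cases h0 : (∑ I, if Above I (mv J a) then l I else 0) = 0
      · rw [h0, zero_mul]
        refine Finset.sum_eq_zero fun I _ => ?_
        split_ifs with hI
        · have := (Finset.sum_eq_zero_iff_of_nonneg fun I _ => by
            split_ifs
            · exact hl I
            · exact le_rfl).1 h0 I (Finset.mem_univ I)
          rw [if_pos hI] at this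
          rw [hz I this, mul_zero]
        · rfl
      · rw [hymv, if_neg h0, mul_div_cancel₀ _ h0]
  refine ⟨y, (mem_seqForm_iff y).2 ⟨?_, hy0, fun J => ?_⟩, hstat⟩
  · have hnn : ∀ k, ∀ s : G.Seq i, (G.seqMoves s).length = k → 0 ≤ y s := by
      intro k
      induction k using Nat.strong_induction_on with
      | _ k ih =>
        intro s hs
        rcases seq_cases s with rfl | ⟨J, a, rfl⟩
        · rw [hy0]
          exact zero_le_one
        · rw [length_seqMoves_mv] at hs
          have hI : ∀ I, Above I (mv J a) → 0 ≤ y (par I) := by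
            intro I hI
            refine ih _ ?_ (par I) rfl
            rw [length_seqMoves_par]
            rcases above_mv.1 hI with rfl | hI
            · omega
            · have := depth_lt_of_above hI
              omega
          rw [hymv]
          split_ifs
          · exact hI J (above_mv.2 (Or.inl rfl))
          · exact le_rfl
          · refine div_nonneg (Finset.sum_nonneg fun I _ => ?_) (Finset.sum_nonneg fun I _ => ?_)
            · split_ifs with h
              · exact mul_nonneg (hI I h) (hr _ _)
              · exact le_rfl
            · split_ifs
              · exact hl I
              · exact le_rfl
    exact fun s => hnn _ s rfl
  · -- the mass at `J` splits into the part of `J` itself and that of the preceding sets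
    have hsplit : ∀ f : G.InfoOf i → ℝ, (∑ I, if I = J ∨ Above I (par J) then f I else 0) =
        f J + ∑ I, if Above I (par J) then f I else 0 := by
      intro f
      have h1 : ∀ I, (if I = J ∨ Above I (par J) then f I else 0) =
          (if I = J then f I else 0) + if Above I (par J) then f I else 0 := by
        intro I
        by_cases hI : I = J
        · subst hI
          simp [not_above_par]
        · simp [hI]
      rw [Finset.sum_congr rfl fun I _ => h1 I, Finset.sum_add_distrib]
      simp
    simp only [hymv, above_mv]
    by_cases h0 : (∑ I, if I = J ∨ Above I (par J) then l I else 0) = 0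
    · simp [h0]
    · simp only [if_neg h0]
      rw [← Finset.sum_div, Finset.sum_comm, div_eq_iff h0]
      have h1 : ∀ I, (∑ a, if I = J ∨ Above I (par J) then y (par I) * r I (mv J a) else 0) =
          if I = J ∨ Above I (par J) then y (par I) * r I (par J) else 0 := by
        intro I
        split_ifs
        · rw [← Finset.mul_sum, hflow]
        · simp
      rw [Finset.sum_congr rfl fun I _ => h1 I, hsplit, hsplit, hstat, hpar]
      ring

theorem sum_info (T : ∀ i, G.InfoOf i → ℝ) :
    ∑ I : G.Info, T (G.player I) ⟨I, rfl⟩ = ∑ i, ∑ I : G.InfoOf i, T i I := by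
  rw [← Fintype.sum_sigma', ← (Equiv.sigmaFiberEquiv G.player).sum_comp]
  refine Finset.sum_congr rfl fun x _ => ?_
  obtain ⟨i, I, rfl⟩ := x
  rfl

/-- An EFCCE exists: against given weights on the trigger deviations, all players independently
play strategies that are stationary under their deviations. -/
theorem efccePlans_nonempty : G.efccePlans.Nonempty := by
  rw [efccePlans_eq]
  obtain ⟨ξ, hξ, h⟩ := exists_forall_nonpos_of_forall_weights convex_corrPolytope
    isCompact_corrPolytope
    (fun x : Σ I : G.Info, TrigPlan I => benefit G.trigA G.trigB x.1 (trigVec x.1 x.2)) (by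
    intro w hw
    let l : ∀ i, G.InfoOf i → ℝ := fun _ I => ∑ p : TrigPlan I.1, w ⟨I.1, p⟩
    let r : ∀ i, G.InfoOf i → G.Seq i → ℝ := fun i I => match i, I with
      | _, ⟨I, rfl⟩ => ∑ p : TrigPlan I, w ⟨I, p⟩ • trigVec I p
    have hr : ∀ (I : G.Info) s, r _ ⟨I, rfl⟩ s = ∑ p : TrigPlan I, w ⟨I, p⟩ * planVec p.1 s := by
      intro I s
      simp [r, Finset.sum_apply, trigVec]
    have hstat : ∀ i, ∃ y ∈ G.seqForm i, ∀ s,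
        (∑ I : G.InfoOf i, if Above I s then y (par I) * r i I s else 0) =
          (∑ I, if Above I s then l i I else 0) * y s := by
      intro i
      refine exists_stationary (l i) (r i) (fun I => Finset.sum_nonneg fun p _ => hw _) ?_ ?_ ?_ ?_
      · rintro ⟨I, rfl⟩ s
        exact (Finset.sum_nonneg fun p _ =>
          mul_nonneg (hw _) (planVec_nonneg _ _)).trans_eq (hr I s).symm
      · rintro ⟨I, rfl⟩ J
        simp only [hr]
        rw [Finset.sum_comm]
        refine Finset.sum_congr rfl fun p _ => ?_
        rw [← Finset.mul_sum, (isFlow_planVec p.1).2]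
      · rintro ⟨I, rfl⟩
        refine (hr I _).trans (Finset.sum_congr rfl fun p _ => ?_)
        rw [planVec, par_mk, if_pos p.2, mul_one]
      · rintro ⟨I, rfl⟩ h0 s
        refine (hr I s).trans (Finset.sum_eq_zero fun p _ => ?_)
        rw [(Finset.sum_eq_zero_iff_of_nonneg fun p _ => hw _).1 h0 p (Finset.mem_univ p), zero_mul]
    choose y hy hys using hstat
    obtain ⟨ξ, hξ, hp⟩ := exists_product_corrPlan y hy
    refine ⟨ξ, hξ, ?_⟩
    -- the total benefit, as a sum over players and leaves
    let T : ∀ i, G.InfoOf i → ℝ := fun i I => ∑ z : G.leaves,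
      G.chanceReach z * G.payoff i z * (∏ j ∈ Finset.univ.erase i, y j (G.leafSeq j z)) *
        ((if Above I (G.leafSeq i z) then y i (par I) * r i I (G.leafSeq i z) else 0) -
          (if Above I (G.leafSeq i z) then l i I else 0) * y i (G.leafSeq i z))
    have hT : ∀ I : G.Info, ∑ p : TrigPlan I,
        w ⟨I, p⟩ * benefit G.trigA G.trigB I (trigVec I p) ξ = T _ ⟨I, rfl⟩ := by
      intro I
      rw [sum_smul_benefit G.trigA G.trigB I (fun p => w ⟨I, p⟩) (trigVec I) ξ,
        dotProduct_trigA_mulVec, trigB_dotProduct, Finset.mul_sum, ← Finset.sum_sub_distrib]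
      refine Finset.sum_congr rfl fun z _ => ?_
      have hiff := through_iff_above (⟨I, rfl⟩ : G.InfoOf (G.player I)) z
      by_cases hz : G.Through I z.1
      · rw [if_pos hz, if_pos hz, if_pos (hiff.1 hz), if_pos (hiff.1 hz),
          extend_leafTuple_of_product hp (through_parentSeq hz),
          extend_leafSeq_of_product hp (G.player I), par_mk]
        change _ * (r _ ⟨I, rfl⟩ _) - l _ ⟨I, rfl⟩ * _ = _
        ring
      · have hz' := fun h => hz (hiff.2 h)
        rw [if_neg hz, if_neg hz, if_neg hz', if_neg hz']
        ring
    rw [Fintype.sum_sigma, Finset.sum_congr rfl fun I _ => hT I, sum_info]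
    refine (Finset.sum_eq_zero fun i _ => ?_).le
    simp only [T]
    rw [Finset.sum_comm]
    refine Finset.sum_eq_zero fun z _ => ?_
    rw [← Finset.mul_sum, Finset.sum_sub_distrib, hys, ← Finset.sum_mul, sub_self, mul_zero])
  exact ⟨ξ, hξ, fun I p => h ⟨I, p⟩⟩

/-! ### Relevance within a subtree -/

/-- the information set `I` has a node in the subtree of `x` -/
def Meets (x : List G.Act) (I : G.Info) : Prop :=
  ∃ u ∈ G.nodes, x <:+ u ∧ G.infoset u = some I

/-- a path in the subtree of `x` passes through both information sets -/
def ConnectedIn (x : List G.Act) (I J : G.Info) : Prop :=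
  ∃ u ∈ G.nodes, ∃ v ∈ G.nodes, x <:+ u ∧ x <:+ v ∧ G.infoset u = some I ∧
    G.infoset v = some J ∧ (u <:+ v ∨ v <:+ u)

/-- Two sequences are relevant within the subtree of `x` if each of them is the last sequence at
`x` or ends in the subtree, where in the latter case for both, their information sets are connected
within the subtree. -/
def RelevantIn {x : List G.Act} (hx : x ∈ G.nodes) {i j : Fin n} (s : G.Seq i) (t : G.Seq j) :
    Prop :=
  (s = G.seqAt i x hx ∧ t = G.seqAt j x hx) ∨
  (s = G.seqAt i x hx ∧ ∃ m ∈ t.1, Meets x m.1) ∨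
  (t = G.seqAt j x hx ∧ ∃ m ∈ s.1, Meets x m.1) ∨
  ∃ m ∈ s.1, ∃ m' ∈ t.1, ConnectedIn x m.1 m'.1

theorem connected_comm {I J : G.Info} : G.Connected I J ↔ G.Connected J I := by
  constructor <;>
  · rintro ⟨u, hu, v, hv, h1, h2, h3⟩
    exact ⟨v, hv, u, hu, h2, h1, h3.symm⟩

theorem connectedIn_comm {x : List G.Act} {I J : G.Info} (h : ConnectedIn x I J) :
    ConnectedIn x J I := by
  obtain ⟨u, hu, v, hv, h1, h2, h3, h4, h5⟩ := h
  exact ⟨v, hv, u, hu, h2, h1, h4, h3, h5.symm⟩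

theorem ConnectedIn.meets {x : List G.Act} {I J : G.Info} (h : ConnectedIn x I J) :
    Meets x I ∧ Meets x J := by
  obtain ⟨u, hu, v, hv, h1, h2, h3, h4, -⟩ := h
  exact ⟨⟨u, hu, h1, h3⟩, ⟨v, hv, h2, h4⟩⟩

theorem relevantIn_comm {x : List G.Act} {hx : x ∈ G.nodes} {i j : Fin n} {s : G.Seq i}
    {t : G.Seq j} (h : RelevantIn hx s t) : RelevantIn hx t s := by
  rcases h with ⟨h1, h2⟩ | ⟨h1, h2⟩ | ⟨h1, h2⟩ | ⟨m, hm, m', hm', h⟩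
  · exact Or.inl ⟨h2, h1⟩
  · exact Or.inr (Or.inr (Or.inl ⟨h1, h2⟩))
  · exact Or.inr (Or.inl ⟨h1, h2⟩)
  · exact Or.inr (Or.inr (Or.inr ⟨m', hm', m, hm, connectedIn_comm h⟩))

theorem RelevantIn.right {x : List G.Act} {hx : x ∈ G.nodes} {i j : Fin n} {s : G.Seq i}
    {t : G.Seq j} (h : RelevantIn hx s t) : t = G.seqAt j x hx ∨ ∃ m ∈ t.1, Meets x m.1 := by
  rcases h with ⟨_, h2⟩ | ⟨_, h2⟩ | ⟨h1, _⟩ | ⟨m, hm, m', hm', h⟩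
  · exact Or.inl h2
  · exact Or.inr h2
  · exact Or.inl h1
  · exact Or.inr ⟨m', hm', h.meets.2⟩

theorem seqAt_of_suffix {x u : List G.Act} (hx : x ∈ G.nodes) (hu : u ∈ G.nodes) (h : x <:+ u)
    (i : Fin n) : G.seqAt i u hu = G.seqAt i x hx ∨ ∃ m ∈ (G.seqAt i u hu).1, Meets x m.1 := by
  induction u with
  | nil =>
    obtain rfl := List.suffix_nil.1 h
    exact Or.inl rfl
  | cons a u ih =>
    rcases List.suffix_cons_iff.1 h with rfl | h
    · exact Or.inl rfl
    · have hu' := G.parent_mem a u hu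
      by_cases hc : ∃ J, G.infoset u = some J ∧ G.player J = i
      · obtain ⟨J, hJ, hi⟩ := hc
        right
        refine ⟨(J, a), ?_, u, hu', h, hJ⟩
        change (G.moves i (a :: u)).head? = some (J, a)
        rw [moves_cons_own a hJ hi]
        rfl
      · push Not at hc
        rw [seqAt_cons_other hu hc]
        exact ih hu' h

theorem par_of_meets {x : List G.Act} (hx : x ∈ G.nodes) {i : Fin n} {K : G.InfoOf i}
    (h : Meets x K.1) : par K = G.seqAt i x hx ∨ ∃ m ∈ (par K).1, Meets x m.1 := by
  obtain ⟨u, hu, hxu, hK⟩ := h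
  rw [← seqAt_eq_par hu K hK]
  exact seqAt_of_suffix hx hu hxu i

/-- A sequence is the list of own moves at a node, so it moves only once at an information set. -/
theorem seqMoves_unique {i : Fin n} {s : G.Seq i} {I : G.Info} {a b : G.Act}
    (ha : (I, a) ∈ G.seqMoves s) (hb : (I, b) ∈ G.seqMoves s) : a = b := by
  rcases seq_cases s with rfl | ⟨J, c, rfl⟩
  · simp [seqMoves_empty] at ha
  · have hn : c.1 :: G.rep J.1 ∈ G.nodes :=
      (G.mem_acts_iff _ (G.rep_mem J.1) J.1 (G.infoset_rep J.1) c.1).1 c.2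
    have h : G.seqMoves (mv J c) = G.moves i (c.1 :: G.rep J.1) := by
      rw [moves_cons_own c.1 (G.infoset_rep J.1) J.2, seqMoves_mv]
    rw [h] at ha hb
    exact moves_unique hn ha hb

theorem moves_subset_seqMoves {i : Fin n} {u : List G.Act} (hu : u ∈ G.nodes) {I : G.InfoOf i}
    (hI : G.infoset u = some I.1) (a : G.acts I.1) {m : G.Info × G.Act} (hm : m ∈ G.moves i u) :
    m ∈ G.seqMoves (mv I a) := by
  rw [seqMoves_mv, ← moves_eq_rep hu hI I.2]
  exact List.mem_cons_of_mem _ hm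

/-- The information sets on the path to `x` do not meet the subtree of `x` -/
theorem not_meets_of_mem_moves {x : List G.Act} {i : Fin n} {J : G.Info}
    {b : G.Act} (h : (J, b) ∈ G.moves i x) : ¬ Meets x J := by
  rintro ⟨v, hv, hxv, hJ⟩
  obtain ⟨-, w, hw, hwJ⟩ := mem_moves_iff.1 h
  have hwx : w <:+ x := (List.suffix_cons b w).trans hw
  have := eq_of_suffix_of_infoset hv (hwx.trans hxv) hwJ hJ
  subst this
  have h1 := hw.length_le
  have h2 := hxv.length_le
  simp at h1
  omega

/-- A vector indexed by the pairs of sequences of two players is a flow if it is nonnegative and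
satisfies the flow equations of both players wherever the sequences are relevant. -/
structure IsPairFlow {i j : Fin n} (X : G.Seq i → G.Seq j → ℝ) : Prop where
  nonneg : ∀ s t, 0 ≤ X s t
  left : ∀ (I : G.InfoOf i) (t : G.Seq j), (∀ m ∈ t.1, G.Connected I.1 m.1) →
    ∑ a, X (mv I a) t = X (par I) t
  right : ∀ (J : G.InfoOf j) (s : G.Seq i), (∀ m ∈ s.1, G.Connected J.1 m.1) →
    ∑ b, X s (mv J b) = X s (par J)

theorem IsPairFlow.swap {i j : Fin n} {X : G.Seq i → G.Seq j → ℝ} (h : IsPairFlow X) :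
    IsPairFlow fun t s => X s t := ⟨fun t s => h.nonneg s t, h.right, h.left⟩

/-- the value of a pure profile for weights on the pairs of sequences of two players -/
def pairValue {i j : Fin n} (g : G.Seq i → G.Seq j → ℝ) (F : ∀ I : G.Info, G.acts I) : ℝ :=
  ∑ s, ∑ t, g s t * ((if Follows F s then 1 else 0) * if Follows F t then 1 else 0)

theorem pairValue_swap {i j : Fin n} (g : G.Seq i → G.Seq j → ℝ) (F : ∀ I : G.Info, G.acts I) :
    pairValue (fun t s => g s t) F = pairValue g F := by
  unfold pairValue
  rw [Finset.sum_comm]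
  refine Finset.sum_congr rfl fun s _ => Finset.sum_congr rfl fun t _ => ?_
  ring

/-- For weights on the pairs of sequences that are relevant within the subtree of `x`, some pure
profile that reaches `x` as far as the two players are concerned does as well as every flow, in
proportion to the flow at `x`. -/
def PureOptimal (i j : Fin n) {x : List G.Act} (hx : x ∈ G.nodes) : Prop :=
  ∀ g : G.Seq i → G.Seq j → ℝ, (∀ s t, ¬ RelevantIn hx s t → g s t = 0) →
    ∃ F : ∀ I : G.Info, G.acts I, Follows F (G.seqAt i x hx) ∧ Follows F (G.seqAt j x hx) ∧
      ∀ X : G.Seq i → G.Seq j → ℝ, IsPairFlow X →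
        ∑ s, ∑ t, g s t * X s t ≤ X (G.seqAt i x hx) (G.seqAt j x hx) * pairValue g F

theorem PureOptimal.swap {i j : Fin n} {x : List G.Act} {hx : x ∈ G.nodes}
    (h : PureOptimal i j hx) : PureOptimal j i hx := by
  intro g hg
  obtain ⟨F, h1, h2, h3⟩ := h (fun s t => g t s) fun s t hst =>
    hg t s fun h' => hst (relevantIn_comm h')
  refine ⟨F, h2, h1, fun X hX => ?_⟩
  have := h3 _ hX.swap
  rw [Finset.sum_comm, pairValue_swap] at this
  exact this

theorem pureOptimal_of_leaf (i j : Fin n) {x : List G.Act} (hx : x ∈ G.nodes)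
    (hl : x ∈ G.leaves) : PureOptimal i j hx := by
  intro g hg
  obtain ⟨F, hF⟩ := exists_profile_follows hx
  refine ⟨F, hF i, hF j, fun X hX => ?_⟩
  have hm : ∀ I, ¬ Meets x I := by
    rintro I ⟨u, hu, hxu, hI⟩
    by_cases hne : x = u
    · subst hne
      have := infoset_eq_none_of_leaf ⟨x, hl⟩
      rw [hI] at this
      cases this
    · obtain ⟨a, ha⟩ := exists_cons_suffix hxu hne
      exact (Finset.mem_filter.1 hl).2 a (mem_nodes_of_suffix ha hu)
  have h0 : ∀ Y : G.Seq i → G.Seq j → ℝ, ∑ s, ∑ t, g s t * Y s t =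
      g (G.seqAt i x hx) (G.seqAt j x hx) * Y (G.seqAt i x hx) (G.seqAt j x hx) := by
    intro Y
    have hz : ∀ s t, ¬ (s = G.seqAt i x hx ∧ t = G.seqAt j x hx) → g s t = 0 := by
      refine fun s t hst => hg s t ?_
      rintro (h | ⟨_, m, _, h⟩ | ⟨_, m, _, h⟩ | ⟨m, _, m', _, h⟩)
      · exact hst h
      · exact hm _ h
      · exact hm _ h
      · exact hm _ h.meets.1
    rw [Finset.sum_eq_single (G.seqAt i x hx), Finset.sum_eq_single (G.seqAt j x hx)]
    · intro t _ ht
      rw [hz _ _ fun h => ht h.2, zero_mul]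
    · simp
    · intro s _ hs
      exact Finset.sum_eq_zero fun t _ => by rw [hz _ _ fun h => hs h.1, zero_mul]
    · simp
  unfold pairValue
  rw [h0, h0, if_pos (hF i), if_pos (hF j), mul_one, mul_one, mul_comm]

/-! ### The induction over the game tree -/

/-- the part of the weights `g` that belongs to the move `a` at `R`, where the weight of the parent
sequence of `R` is added to the weight of the move -/
def branch {i j : Fin n} (R : G.InfoOf i) (a : G.acts R.1) (g : G.Seq i → G.Seq j → ℝ) :
    G.Seq i → G.Seq j → ℝ := fun s t =>
  (if (R.1, a.1) ∈ G.seqMoves s then g s t else 0) + if s = mv R a then g (par R) t else 0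

theorem sum_branch {i j : Fin n} (R : G.InfoOf i) (g Y : G.Seq i → G.Seq j → ℝ)
    (hg : ∀ s t, g s t ≠ 0 → s = par R ∨ ∃ a : G.acts R.1, (R.1, a.1) ∈ G.seqMoves s)
    (hY : ∀ t, g (par R) t ≠ 0 → ∑ a, Y (mv R a) t = Y (par R) t) :
    ∑ s, ∑ t, g s t * Y s t = ∑ a, ∑ s, ∑ t, branch R a g s t * Y s t := by
  have h1 : ∀ s t, g s t * Y s t = (if s = par R then g s t * Y s t else 0) +
      ∑ a : G.acts R.1, if (R.1, a.1) ∈ G.seqMoves s then g s t * Y s t else 0 := by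
    intro s t
    by_cases hs : s = par R
    · have hn : ∀ a : G.acts R.1, (R.1, a.1) ∉ G.seqMoves s :=
        fun a ha => not_above_par R ⟨a.1, hs ▸ ha⟩
      rw [if_pos hs, Finset.sum_eq_zero fun a _ => if_neg (hn a), add_zero]
    · rw [if_neg hs, zero_add]
      by_cases ha : ∃ a : G.acts R.1, (R.1, a.1) ∈ G.seqMoves s
      · obtain ⟨a, ha⟩ := ha
        rw [Finset.sum_eq_single a, if_pos ha]
        · exact fun b _ hb => if_neg fun h => hb (Subtype.ext (seqMoves_unique h ha))
        · simp
      · have h0 : g s t = 0 := by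
          by_contra h
          exact (hg s t h).elim hs ha
        simp [h0]
  have h2 : ∀ a s t, branch R a g s t * Y s t =
      (if (R.1, a.1) ∈ G.seqMoves s then g s t * Y s t else 0) +
        if s = mv R a then g (par R) t * Y (mv R a) t else 0 := by
    intro a s t
    rw [branch, add_mul, ite_mul, ite_mul, zero_mul]
    congr 1
    split_ifs with h
    · rw [h]
    · rfl
  have h3 : ∀ t, ∑ a, g (par R) t * Y (mv R a) t = g (par R) t * Y (par R) t := by
    intro t
    by_cases h0 : g (par R) t = 0
    · simp [h0]
    · rw [← Finset.mul_sum, hY t h0]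
  calc ∑ s, ∑ t, g s t * Y s t
      = ∑ t, (g (par R) t * Y (par R) t + ∑ s, ∑ a : G.acts R.1,
          if (R.1, a.1) ∈ G.seqMoves s then g s t * Y s t else 0) := by
        rw [Finset.sum_comm]
        refine Finset.sum_congr rfl fun t _ => ?_
        rw [Finset.sum_congr rfl fun s _ => h1 s t, Finset.sum_add_distrib]
        simp
    _ = ∑ t, ∑ a, ∑ s, branch R a g s t * Y s t := by
        refine Finset.sum_congr rfl fun t _ => ?_
        simp only [h2, Finset.sum_add_distrib]
        rw [Finset.sum_comm, ← h3 t, add_comm]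
        simp
    _ = ∑ a, ∑ s, ∑ t, branch R a g s t * Y s t := by
        rw [Finset.sum_comm]
        exact Finset.sum_congr rfl fun a _ => Finset.sum_comm

theorem suffix_of_branch {x u : List G.Act} {i : Fin n} {R I : G.InfoOf i}
    (hR : G.infoset x = some R.1) {a : G.acts R.1} {c : G.acts I.1} (hu : u ∈ G.nodes)
    (hxu : x <:+ u) (hI : G.infoset u = some I.1) (ha : (R.1, a.1) ∈ G.seqMoves (mv I c)) :
    mv I c = mv R a ∨ a.1 :: x <:+ u := by
  by_cases hne : x = u
  · subst hne
    obtain rfl : R = I := Subtype.ext (by simpa [hR] using hI)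
    left
    have : (R.1, c.1) ∈ G.seqMoves (mv R c) := List.mem_cons_self
    rw [Subtype.ext (seqMoves_unique this ha)]
  · obtain ⟨b, hb⟩ := exists_cons_suffix hxu hne
    have h1 : (R.1, b) ∈ G.seqMoves (mv I c) :=
      moves_subset_seqMoves hu hI c (mem_moves_iff.2 ⟨R.2, x, hb, hR⟩)
    rw [seqMoves_unique ha h1]
    exact Or.inr hb

theorem eq_par_or_branch {x : List G.Act} {hx : x ∈ G.nodes} {i j : Fin n} {R : G.InfoOf i}
    (hR : G.infoset x = some R.1) {s : G.Seq i} {t : G.Seq j} (h : RelevantIn hx s t) :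
    s = par R ∨ ∃ a : G.acts R.1, (R.1, a.1) ∈ G.seqMoves s := by
  rcases (relevantIn_comm h).right with h | ⟨m, hm, u, hu, hxu, hI⟩
  · left
    rw [h, seqAt_eq_par hx R hR]
  · right
    rcases seq_cases s with rfl | ⟨I, c, rfl⟩
    · cases hm
    · cases hm
      by_cases hne : x = u
      · subst hne
        obtain rfl : R = I := Subtype.ext (by simpa [hR] using hI)
        exact ⟨c, List.mem_cons_self⟩
      · obtain ⟨b, hb⟩ := exists_cons_suffix hxu hne
        exact ⟨⟨b, (G.mem_acts_iff x hx R.1 hR b).2 (mem_nodes_of_suffix hb hu)⟩,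
          moves_subset_seqMoves hu hI c (mem_moves_iff.2 ⟨R.2, x, hb, hR⟩)⟩

theorem suffix_of_comparable {x u v : List G.Act} {a : G.Act} (hu : a :: x <:+ u) (hxv : x <:+ v)
    (hne : x ≠ v) (h : u <:+ v ∨ v <:+ u) : a :: x <:+ v := by
  rcases h with h | h
  · exact hu.trans h
  · obtain ⟨b, hb⟩ := exists_cons_suffix hxv hne
    have h1 := List.suffix_of_suffix_length_le hu (hb.trans h) (by simp)
    have h2 := h1.eq_of_length (by simp)
    rw [h2]
    exact hb

/-- A pair of sequences beyond a move at the root of a subtree that is relevant in the subtree is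
relevant in the subtree of the move. -/
theorem relevantIn_of_branch {x : List G.Act} {hx : x ∈ G.nodes} {i j : Fin n} (hij : i ≠ j)
    {R : G.InfoOf i} (hR : G.infoset x = some R.1) {a : G.acts R.1} (ha : a.1 :: x ∈ G.nodes)
    {s : G.Seq i} {t : G.Seq j} (h : RelevantIn hx s t) (hs : (R.1, a.1) ∈ G.seqMoves s)
    (hne : s ≠ mv R a) : RelevantIn ha s t := by
  have hoth : ∀ J, G.infoset x = some J → G.player J ≠ j := by
    intro J hJ
    obtain rfl : R.1 = J := by simpa [hR] using hJ
    rw [R.2]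
    exact hij
  have hpar : s ≠ G.seqAt i x hx := by
    rintro rfl
    rw [seqAt_eq_par hx R hR] at hs
    exact not_above_par R ⟨a.1, hs⟩
  have hmeet : ∀ m ∈ s.1, ∀ u ∈ G.nodes, x <:+ u → G.infoset u = some m.1 → a.1 :: x <:+ u := by
    intro m hm u hu hxu hI
    rcases seq_cases s with rfl | ⟨I, c, rfl⟩
    · cases hm
    · cases hm
      exact (suffix_of_branch hR hu hxu hI hs).resolve_left hne
  rcases h with ⟨h1, _⟩ | ⟨h1, _⟩ | ⟨h1, m, hm, u, hu, hxu, hI⟩ |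
    ⟨m, hm, m', hm', u, hu, v, hv, hxu, hxv, hI, hJ, hc⟩
  · exact absurd h1 hpar
  · exact absurd h1 hpar
  · refine Or.inr (Or.inr (Or.inl ⟨?_, m, hm, u, hu, hmeet m hm u hu hxu hI, hI⟩))
    rw [h1, seqAt_cons_other ha hoth]
  · refine Or.inr (Or.inr (Or.inr ⟨m, hm, m', hm', u, hu, v, hv, hmeet m hm u hu hxu hI, ?_, hI, hJ,
      hc⟩))
    refine suffix_of_comparable (hmeet m hm u hu hxu hI) hxv ?_ hc
    rintro rfl
    exact hoth _ hJ (t.2 m' hm').1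

/-- The induction step for one move `a` at `R`: the choices of the other player that the move makes
unreachable within the subtree are eliminated, and the rest is left to the subtree of the move. -/
theorem exists_branch_profile {x : List G.Act} {hx : x ∈ G.nodes} {i j : Fin n} (hij : i ≠ j)
    {R : G.InfoOf i} (hR : G.infoset x = some R.1) (a : G.acts R.1) (ha : a.1 :: x ∈ G.nodes)
    (ih : PureOptimal i j ha) (g : G.Seq i → G.Seq j → ℝ)
    (hg : ∀ s t, ¬ RelevantIn hx s t → g s t = 0) :
    ∃ F : ∀ I : G.Info, G.acts I, Follows F (mv R a) ∧ Follows F (G.seqAt j x hx) ∧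
      ∀ X : G.Seq i → G.Seq j → ℝ, IsPairFlow X →
        ∑ s, ∑ t, branch R a g s t * X s t ≤
          X (mv R a) (G.seqAt j x hx) * pairValue (branch R a g) F := by
  have hoth : ∀ J, G.infoset x = some J → G.player J ≠ j := by
    intro J hJ
    obtain rfl : R.1 = J := by simpa [hR] using hJ
    rw [R.2]
    exact hij
  have hj : G.seqAt j (a.1 :: x) ha = G.seqAt j x hx := seqAt_cons_other ha hoth
  have hi : G.seqAt i (a.1 :: x) ha = mv R a := seqAt_cons_own ha R hR a.2
  let D : Set (G.InfoOf j) := {J | Meets x J.1 ∧ ¬ Meets (a.1 :: x) J.1}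
  obtain ⟨h, f, hD, hzero, hle, heq⟩ := exists_elimination (branch R a g (mv R a)) D
  -- the weights after the elimination
  let g' : G.Seq i → G.Seq j → ℝ := fun s t => if s = mv R a then h t else branch R a g s t
  have hreg : ∀ s t, g s t ≠ 0 → RelevantIn hx s t := fun s t hst => by
    by_contra hn
    exact hst (hg s t hn)
  have hh : ∀ t, h t ≠ 0 → t = G.seqAt j x hx ∨ ∃ m ∈ t.1, Meets (a.1 :: x) m.1 := by
    intro t ht
    have ht' : t = G.seqAt j x hx ∨ ∃ m ∈ t.1, Meets x m.1 := by
      by_contra hn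
      refine ht (hzero t ?_ ?_)
      · have h1 : ∀ s, g s t = 0 := fun s => hg s t fun h' => hn h'.right
        simp [branch, h1]
      · rintro K ⟨hK, -⟩ rfl
        exact hn (par_of_meets hx hK)
    rcases ht' with ht' | ⟨m, hm, hmx⟩
    · exact Or.inl ht'
    · right
      refine ⟨m, hm, ?_⟩
      rcases seq_cases t with rfl | ⟨J, b, rfl⟩
      · cases hm
      · cases hm
        by_contra hn
        exact ht (hD J ⟨hmx, hn⟩ b)
  have hg' : ∀ s t, g' s t ≠ 0 → RelevantIn ha s t := by
    intro s t hst
    by_cases hs : s = mv R a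
    · simp only [g', if_pos hs] at hst
      rcases hh t hst with ht | ht
      · exact Or.inl ⟨hs.trans hi.symm, ht.trans hj.symm⟩
      · exact Or.inr (Or.inl ⟨hs.trans hi.symm, ht⟩)
    · simp only [g', if_neg hs, branch, add_zero] at hst
      split_ifs at hst with hb
      · exact relevantIn_of_branch hij hR ha (hreg s t hst) hb hs
      · exact absurd rfl hst
  obtain ⟨F, hF1, hF2, hF⟩ := ih g' fun s t hst => by
    by_contra hn
    exact hst (hg' s t hn)
  rw [hi] at hF1 hF
  rw [hj] at hF2 hF
  -- the choices in `D` are replaced by optimal ones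
  let F' : ∀ I : G.Info, G.acts I := fun I =>
    if hI : ∃ hj : G.player I = j, (⟨I, hj⟩ : G.InfoOf j) ∈ D then f ⟨I, hI.choose⟩ else F I
  have hF'D : ∀ K : G.InfoOf j, K ∈ D → F' K.1 = f K := fun K hK => dif_pos ⟨K.2, hK⟩
  have hF'n : ∀ I, (∀ hj : G.player I = j, (⟨I, hj⟩ : G.InfoOf j) ∉ D) → F' I = F I :=
    fun I hI => dif_neg fun ⟨h1, h2⟩ => hI h1 h2
  have hfi : ∀ s : G.Seq i, Follows F' s ↔ Follows F s := by
    intro s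
    refine forall₂_congr fun m hm => ?_
    rw [hF'n m.1 fun h' => absurd ((tail_mem_seqMoves hm).1.symm.trans h') hij]
  have hfj : ∀ t : G.Seq j, (t = G.seqAt j x hx ∨ ∃ m ∈ t.1, Meets (a.1 :: x) m.1) →
      (Follows F' t ↔ Follows F t) := by
    intro t ht
    refine forall₂_congr fun m hm => ?_
    rw [hF'n m.1]
    rintro hmj ⟨hmx, hmn⟩
    rcases ht with rfl | ⟨m', hm', v, hv, hxv, hJ⟩
    · rw [seqMoves_seqAt] at hm
      exact not_meets_of_mem_moves (show (m.1, m.2) ∈ _ from hm) hmx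
    · rcases seq_cases t with rfl | ⟨J, b, rfl⟩
      · cases hm'
      · cases hm'
        rw [seqMoves_mv, ← moves_eq_rep hv hJ J.2] at hm
        rcases List.mem_cons.1 hm with rfl | hm
        · exact hmn ⟨v, hv, hxv, hJ⟩
        · obtain ⟨-, w, hw, hwI⟩ := mem_moves_iff.1 (show (m.1, m.2) ∈ _ from hm)
          have hwv : w <:+ v := (List.suffix_cons _ w).trans hw
          rcases List.suffix_or_suffix_of_suffix hwv hxv with h1 | h1
          · rcases List.suffix_cons_iff.1 h1 with rfl | h2
            · exact hmn ⟨_, ha, List.suffix_refl _, hwI⟩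
            · have hne : w ≠ x := by
                rintro rfl
                exact hoth _ hwI hmj
              obtain ⟨b', hb'⟩ := exists_cons_suffix h2 hne
              exact not_meets_of_mem_moves (mem_moves_iff.2 ⟨hmj, w, hb', hwI⟩) hmx
          · exact hmn ⟨w, mem_nodes_of_suffix hwv hv, h1, hwI⟩
  have hval : pairValue (branch R a g) F' = pairValue g' F := by
    have hrow : ∀ s, ∑ t, branch R a g s t *
        ((if Follows F' s then 1 else 0) * if Follows F' t then 1 else 0) =
        ∑ t, g' s t * ((if Follows F' s then 1 else 0) * if Follows F' t then 1 else 0) := by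
      intro s
      by_cases hs : s = mv R a
      · subst hs
        simp only [g', if_true]
        refine heq (fun t => (if Follows F' (mv R a) then 1 else 0) *
          if Follows F' t then 1 else 0) ?_ ?_
        · intro K _
          rw [← Finset.mul_sum]
          congr 1
          have := sum_plays_mv (planOf F' j) K
          simpa only [plays_planOf] using this
        · intro K hK b hb
          have : ¬ Follows F' (mv K b) := by
            rw [follows_mv, hF'D K hK]
            exact fun h' => hb h'.1.symm
          simp [this]
      · simp only [g', if_neg hs]
    unfold pairValue
    refine Finset.sum_congr rfl fun s _ => (hrow s).trans (Finset.sum_congr rfl fun t _ => ?_)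
    by_cases h0 : g' s t = 0
    · rw [h0, zero_mul, zero_mul]
    · have h1 := (hg' s t h0).right
      rw [hj] at h1
      simp only [hfi, hfj t h1]
  refine ⟨F', (hfi _).2 hF1, (hfj _ (Or.inl rfl)).2 hF2, fun X hX => ?_⟩
  rw [hval]
  refine le_trans (Finset.sum_le_sum fun s _ => ?_) (hF X hX)
  by_cases hs : s = mv R a
  · subst hs
    simp only [g', if_true]
    refine hle (X (mv R a)) (hX.nonneg _) ?_
    rintro K ⟨⟨v, hv, hxv, hK⟩, -⟩
    refine hX.right K (mv R a) fun m hm => ?_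
    cases hm
    exact ⟨v, hv, x, hx, hK, hR, Or.inr hxv⟩
  · simp only [g', if_neg hs]
    exact le_rfl

theorem pureOptimal_of_children {x : List G.Act} {hx : x ∈ G.nodes} {i j : Fin n} (hij : i ≠ j)
    (R : G.InfoOf i) (hR : G.infoset x = some R.1)
    (ih : ∀ (a : G.acts R.1) (ha : a.1 :: x ∈ G.nodes), PureOptimal i j ha) :
    PureOptimal i j hx := by
  intro g hg
  have hn : ∀ a : G.acts R.1, a.1 :: x ∈ G.nodes :=
    fun a => (G.mem_acts_iff x hx R.1 hR a.1).1 a.2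
  choose F hF1 hF2 hF using fun a => exists_branch_profile hij hR a (hn a) (ih a (hn a)) g hg
  have hsupp : ∀ s t, g s t ≠ 0 → s = par R ∨ ∃ a : G.acts R.1, (R.1, a.1) ∈ G.seqMoves s := by
    intro s t hst
    refine eq_par_or_branch (hx := hx) hR (t := t) ?_
    by_contra h
    exact hst (hg s t h)
  have hcon : ∀ t, (t = G.seqAt j x hx ∨ ∃ m ∈ t.1, Meets x m.1) →
      ∀ m ∈ t.1, G.Connected R.1 m.1 := by
    intro t ht m hm
    rcases ht with rfl | ⟨m', hm', v, hv, hxv, hJ⟩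
    · obtain ⟨u, hu, hI⟩ := through_of_mem_seqAt hm
      exact ⟨x, hx, u, mem_nodes_of_suffix hu hx, hR, hI, Or.inr hu⟩
    · obtain rfl := Option.mem_unique hm hm'
      exact ⟨x, hx, v, hv, hR, hJ, Or.inl hxv⟩
  have : Nonempty (G.acts R.1) := (G.acts_nonempty R.1).to_subtype
  -- the best move at `R`
  obtain ⟨a, -, hmax⟩ := Finset.exists_max_image Finset.univ
    (fun a => pairValue (branch R a g) (F a)) Finset.univ_nonempty
  have hfol := (follows_mv (F a) R a).1 (hF1 a)
  refine ⟨F a, ?_, hF2 a, fun X hX => ?_⟩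
  · rw [seqAt_eq_par hx R hR]
    exact hfol.2
  have hval : pairValue g (F a) = pairValue (branch R a g) (F a) := by
    unfold pairValue
    rw [sum_branch R g _ hsupp, Finset.sum_eq_single a]
    · intro b _ hb
      refine Finset.sum_eq_zero fun s _ => Finset.sum_eq_zero fun t _ => ?_
      by_cases hs : (R.1, b.1) ∈ G.seqMoves s
      · have : ¬ Follows (F a) s := fun h => hb (Subtype.ext
          ((h _ hs).symm.trans (congrArg Subtype.val hfol.1)))
        rw [if_neg this, zero_mul, mul_zero]
      · have hs' : s ≠ mv R b := by
          rintro rfl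
          exact hs List.mem_cons_self
        simp [branch, hs, hs']
    · simp
    · intro t _
      rw [← Finset.sum_mul]
      congr 1
      have := sum_plays_mv (planOf (F a) i) R
      simpa only [plays_planOf] using this
  rw [sum_branch R g X hsupp fun t ht => hX.left R t (hcon t ?_), hval, seqAt_eq_par hx R hR,
    ← hX.left R _ (hcon _ (Or.inl rfl)), Finset.sum_mul]
  · refine Finset.sum_le_sum fun b _ => (hF b X hX).trans ?_
    exact mul_le_mul_of_nonneg_left (hmax b (Finset.mem_univ b)) (hX.nonneg _ _)
  · refine RelevantIn.right (hx := hx) (s := par R) ?_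
    by_contra h
    exact ht (hg _ _ h)

/-- In a game of two players without chance moves, pure profiles are optimal in every subtree. -/
theorem pureOptimal (hc : G.NoChance) {i j : Fin n} (hij : i ≠ j)
    (h2 : ∀ I, G.player I = i ∨ G.player I = j) {x : List G.Act} (hx : x ∈ G.nodes) :
    PureOptimal i j hx := by
  obtain ⟨N, hN⟩ : ∃ N, ∀ x ∈ G.nodes, x.length < N :=
    ⟨G.nodes.sup List.length + 1, fun x hx => Nat.lt_succ_of_le (Finset.le_sup hx)⟩
  have key : ∀ k, ∀ x, ∀ hx : x ∈ G.nodes, N ≤ x.length + k → PureOptimal i j hx := by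
    intro k
    induction k with
    | zero =>
      intro x hx h
      exact absurd (hN x hx) (by omega)
    | succ k ih =>
      intro x hx h
      cases hI : G.infoset x with
      | none => exact pureOptimal_of_leaf i j hx (hc x hx hI)
      | some R =>
        have hlen : ∀ a : G.Act, N ≤ (a :: x).length + k := fun a => by
          rw [List.length_cons]
          omega
        rcases h2 R with hR | hR
        · exact pureOptimal_of_children hij ⟨R, hR⟩ hI fun a ha => ih _ ha (hlen _)
        · exact (pureOptimal_of_children hij.symm ⟨R, hR⟩ hI fun a ha =>
            (ih _ ha (hlen _)).swap).swap
  exact key N x hx (by omega)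

/-! ### The flow polytope -/

theorem relevant_comm {i j : Fin n} {s : G.Seq i} {t : G.Seq j} (h : G.Relevant s t) :
    G.Relevant t s := fun m hm m' hm' => connected_comm.1 (h m' hm' m hm)

theorem relevant_mv {i j : Fin n} {I : G.InfoOf i} {t : G.Seq j}
    (h : ∀ m ∈ t.1, G.Connected I.1 m.1) (a : G.acts I.1) : G.Relevant (mv I a) t := by
  intro m hm m' hm'
  cases hm
  exact h m' hm'

/-- Relevance passes to the parent sequence, because the preceding information set lies on the same
paths. -/
theorem relevant_par {i j : Fin n} {I : G.InfoOf i} {t : G.Seq j}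
    (h : ∀ m ∈ t.1, G.Connected I.1 m.1) : G.Relevant (par I) t := by
  intro m hm m' hm'
  obtain ⟨u, hu, v, hv, hI, hJ, hc⟩ := h m' hm'
  rw [← seqAt_eq_par hu I hI] at hm
  obtain ⟨w, hw, hwI⟩ := through_of_mem_seqAt hm
  refine ⟨w, mem_nodes_of_suffix hw hu, v, hv, hwI, hJ, ?_⟩
  rcases hc with hc | hc
  · exact Or.inl (hw.trans hc)
  · exact List.suffix_or_suffix_of_suffix hw hc

/-- the flow equations of `flowPolytope`, for the information sets of a given player -/
theorem flow_of_mem_flowPolytope {ξ : G.RelTuple → ℝ} (h : ξ ∈ G.flowPolytope) {i : Fin n}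
    (I : G.InfoOf i) (t : G.RelTuple) (ht : t.1 i = par I)
    (hr : ∀ a : G.acts I.1, ∀ k l, k ≠ l → G.Relevant (Function.update t.1 i (mv I a) k)
      (Function.update t.1 i (mv I a) l)) :
    ∑ a, G.extend ξ (Function.update t.1 i (mv I a)) = ξ t := by
  obtain ⟨I, rfl⟩ := I
  exact h.2.2 I t ht hr

theorem corrPolytope_subset_flowPolytope : G.corrPolytope ⊆ G.flowPolytope := by
  rintro _ ⟨μ, hμ, rfl⟩
  refine ⟨fun t => Finset.sum_nonneg fun p _ => hμ.1 p, ?_, ?_⟩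
  · rw [← hμ.2, corrPlan, Finset.filter_true_of_mem]
    exact fun p _ i => plays_empty (p i)
  · intro I t ht hr
    have h1 : ∀ (s : G.Seq (G.player I)) (p : ∀ i, G.Plan i),
        (∀ j, G.Plays (p j) (Function.update t.1 (G.player I) s j)) ↔
          G.Plays (p (G.player I)) s ∧ ∀ j, j ≠ G.player I → G.Plays (p j) (t.1 j) := by
      intro s p
      rw [Function.forall_update_iff (p := fun j s => G.Plays (p j) s)]
    have h2 : G.corrPlan μ t = ∑ p, if G.Plays (p (G.player I)) (G.parentSeq I) ∧
        ∀ j, j ≠ G.player I → G.Plays (p j) (t.1 j) then μ p else 0 := by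
      rw [corrPlan, Finset.sum_filter]
      refine Finset.sum_congr rfl fun p _ => if_congr ?_ rfl rfl
      rw [← h1, ← ht, Function.update_eq_self]
    have h3 : ∀ a, G.extend (G.corrPlan μ) (Function.update t.1 (G.player I) (G.moveSeq I a)) =
        ∑ p, if G.Plays (p (G.player I)) (G.moveSeq I a) ∧
          ∀ j, j ≠ G.player I → G.Plays (p j) (t.1 j) then μ p else 0 := by
      intro a
      rw [extend_corrPlan μ (hr a), Finset.sum_filter]
      simp only [h1]
    rw [Finset.sum_congr rfl fun a _ => h3 a, h2, Finset.sum_comm]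
    refine Finset.sum_congr rfl fun p _ => ?_
    by_cases hp : ∀ j, j ≠ G.player I → G.Plays (p j) (t.1 j)
    · have := sum_plays_mv (p (G.player I)) ⟨I, rfl⟩
      simp only [and_iff_left hp]
      have h4 : ∀ s : G.Seq (G.player I), (if G.Plays (p (G.player I)) s then μ p else 0) =
          μ p * if G.Plays (p (G.player I)) s then 1 else 0 := fun s => by simp
      simp only [h4, ← Finset.mul_sum]
      rw [← par_mk, ← this]
      rfl
    · simp [hp]

theorem sum_extend (h : G.RelTuple → ℝ) : ∑ τ, G.extend h τ = ∑ t, h t := by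
  simp only [← sum_ite_eq_extend]
  rw [Finset.sum_comm]
  refine Finset.sum_congr rfl fun t _ => ?_
  simp

theorem extend_mul (g h : G.RelTuple → ℝ) (τ : ∀ i, G.Seq i) :
    G.extend g τ * G.extend h τ = G.extend (g * h) τ := by
  unfold extend
  split_ifs
  · rfl
  · rw [mul_zero]

end ExtensiveGame

namespace ExtensiveGame

variable {G : ExtensiveGame 2}

/-- a pair of sequences, one for each of two players, as a tuple -/
def pairTuple (s : G.Seq 0) (t : G.Seq 1) : ∀ i, G.Seq i := fun i => match i with
  | 0 => s
  | 1 => t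

theorem forall_pairTuple {s : G.Seq 0} {t : G.Seq 1} :
    (∀ i j, i ≠ j → G.Relevant (pairTuple s t i) (pairTuple s t j)) ↔ G.Relevant s t := by
  constructor
  · exact fun h => h 0 1 (by decide)
  · intro h i j hij
    fin_cases i <;> fin_cases j
    · exact absurd rfl hij
    · exact h
    · exact relevant_comm h
    · exact absurd rfl hij

theorem update_pairTuple_zero (s s' : G.Seq 0) (t : G.Seq 1) :
    Function.update (pairTuple s t) 0 s' = pairTuple s' t := by
  funext i
  fin_cases i
  · rfl
  · rfl

theorem update_pairTuple_one (s : G.Seq 0) (t t' : G.Seq 1) :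
    Function.update (pairTuple s t) 1 t' = pairTuple s t' := by
  funext i
  fin_cases i
  · rfl
  · rfl

theorem sum_pairTuple (f : (∀ i, G.Seq i) → ℝ) : ∑ τ, f τ = ∑ s, ∑ t, f (pairTuple s t) := by
  let e : G.Seq 0 × G.Seq 1 ≃ ∀ i, G.Seq i :=
    { toFun := fun x => pairTuple x.1 x.2
      invFun := fun τ => (τ 0, τ 1)
      left_inv := fun x => rfl
      right_inv := fun τ => by
        funext i
        fin_cases i <;> rfl }
  rw [← e.sum_comp, Fintype.sum_prod_type]
  rfl

theorem isPairFlow_of_mem_flowPolytope {ξ : G.RelTuple → ℝ} (h : ξ ∈ G.flowPolytope) :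
    IsPairFlow fun (s : G.Seq 0) (t : G.Seq 1) => G.extend ξ (pairTuple s t) := by
  refine ⟨fun s t => ?_, fun I t ht => ?_, fun J s hs => ?_⟩
  · unfold extend
    split_ifs
    · exact h.1 _
    · exact le_rfl
  · have hr := forall_pairTuple.2 (relevant_par ht)
    have := flow_of_mem_flowPolytope h I ⟨pairTuple (par I) t, hr⟩ rfl fun a => by
      simp only [update_pairTuple_zero]
      exact forall_pairTuple.2 (relevant_mv ht a)
    simp only [update_pairTuple_zero] at this
    rw [this, extend, dif_pos hr]
  · have hr := forall_pairTuple.2 (relevant_comm (relevant_par hs))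
    have := flow_of_mem_flowPolytope h J ⟨pairTuple s (par J), hr⟩ rfl fun a => by
      simp only [update_pairTuple_one]
      exact forall_pairTuple.2 (relevant_comm (relevant_mv hs a))
    simp only [update_pairTuple_one] at this
    rw [this, extend, dif_pos hr]

/-- Relevance within the whole tree is relevance. -/
theorem relevantIn_root {s : G.Seq 0} {t : G.Seq 1} (h : G.Relevant s t) :
    RelevantIn G.root_mem s t := by
  have hm : ∀ I, Meets [] I := fun I =>
    ⟨G.rep I, G.rep_mem I, List.nil_suffix, G.infoset_rep I⟩
  rcases seq_cases s with rfl | ⟨I, a, rfl⟩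
  · rcases seq_cases t with rfl | ⟨J, b, rfl⟩
    · exact Or.inl ⟨rfl, rfl⟩
    · exact Or.inr (Or.inl ⟨rfl, _, rfl, hm _⟩)
  · rcases seq_cases t with rfl | ⟨J, b, rfl⟩
    · exact Or.inr (Or.inr (Or.inl ⟨rfl, _, rfl, hm _⟩))
    · obtain ⟨u, hu, v, hv, h1, h2, h3⟩ := h _ rfl _ rfl
      exact Or.inr (Or.inr (Or.inr ⟨_, rfl, _, rfl, u, hu, v, hv, List.nil_suffix,
        List.nil_suffix, h1, h2, h3⟩))

/-- In two-player games without chance moves, the flow equations describe the correlation plans. -/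
theorem corrPolytope_eq_flowPolytope (hc : G.NoChance) : G.corrPolytope = G.flowPolytope := by
  refine corrPolytope_subset_flowPolytope.antisymm fun ξ hξ => ?_
  rw [corrPolytope_eq_convexHull]
  refine mem_of_forall_dotProduct_le (convex_convexHull ℝ _)
    ((Set.finite_range _).isClosed_convexHull ℝ) fun g => ?_
  have h2 : ∀ I, G.player I = 0 ∨ G.player I = 1 := by
    intro I
    generalize G.player I = k
    fin_cases k
    · exact Or.inl rfl
    · exact Or.inr rfl
  have hsum : ∀ ζ : G.RelTuple → ℝ, g ⬝ᵥ ζ = ∑ s : G.Seq 0, ∑ t : G.Seq 1,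
      G.extend g (pairTuple s t) * G.extend ζ (pairTuple s t) := by
    intro ζ
    simp only [extend_mul]
    rw [← sum_pairTuple, sum_extend]
    rfl
  obtain ⟨F, -, -, hF⟩ := pureOptimal hc (i := 0) (j := 1) (by decide) h2 G.root_mem
    (fun s t => G.extend g (pairTuple s t)) fun s t hst =>
      dif_neg fun h => hst (relevantIn_root (forall_pairTuple.1 h))
  refine ⟨profVec (planOf F), subset_convexHull ℝ _ ⟨_, rfl⟩, ?_⟩
  have h1 := hF _ (isPairFlow_of_mem_flowPolytope hξ)
  have h0 : G.extend ξ (pairTuple (G.seqAt 0 [] G.root_mem) (G.seqAt 1 [] G.root_mem)) = 1 := by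
    rw [← hξ.2.1, ← extend_of_relevant ξ]
    congr 1
    funext i
    fin_cases i <;> rfl
  rw [h0, one_mul, ← hsum] at h1
  refine h1.trans_eq ?_
  rw [hsum]
  refine Finset.sum_congr rfl fun s _ => Finset.sum_congr rfl fun t _ => ?_
  by_cases h : ∀ i j, i ≠ j → G.Relevant (pairTuple s t i) (pairTuple s t j)
  · congr 1
    rw [extend, dif_pos h, profVec]
    simp only [plays_planOf, Fin.forall_fin_two]
    change _ = if Follows F s ∧ Follows F t then (1 : ℝ) else 0
    by_cases hs : Follows F s <;> by_cases ht : Follows F t <;> simp [hs, ht]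
  · have hz : ∀ ζ, G.extend ζ (pairTuple s t) = 0 := fun ζ => dif_neg h
    simp only [hz, zero_mul]

end ExtensiveGame

namespace ExtensiveGame

variable {n : ℕ} {G : ExtensiveGame n}

/-! ### Sizes -/

theorem card_info_le : Fintype.card G.Info ≤ G.size := by
  have h : Function.Injective fun I : G.Info => (⟨G.rep I, G.rep_mem I⟩ : G.nodes) := by
    intro I J h
    have h1 : G.rep I = G.rep J := congrArg Subtype.val h
    have h2 := G.infoset_rep I
    rw [h1, G.infoset_rep J] at h2
    exact (Option.some.inj h2).symm
  simpa [size] using Fintype.card_le_of_injective _ h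

/-- The nonempty sequences are counted by the children of representatives of the information sets,
the empty one by the root. -/
theorem card_seq_le (i : Fin n) : Fintype.card (G.Seq i) ≤ G.size := by
  let f : Option (Σ I : G.InfoOf i, G.acts I.1) → G.nodes := fun o => match o with
    | none => ⟨[], G.root_mem⟩
    | some ⟨I, a⟩ => ⟨a.1 :: G.rep I.1,
      (G.mem_acts_iff _ (G.rep_mem I.1) I.1 (G.infoset_rep I.1) a.1).1 a.2⟩
  have hf : Function.Injective f := by
    rintro (_ | ⟨I, a⟩) (_ | ⟨J, b⟩) h
    · rfl
    · cases congrArg Subtype.val h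
    · cases congrArg Subtype.val h
    · have h1 : a.1 :: G.rep I.1 = b.1 :: G.rep J.1 := congrArg Subtype.val h
      obtain ⟨hab, hr⟩ := List.cons.inj h1
      have h2 := G.infoset_rep I.1
      rw [hr, G.infoset_rep J.1] at h2
      obtain rfl : I = J := Subtype.ext (Option.some.inj h2).symm
      rw [Subtype.ext hab]
  rw [← Fintype.card_congr (seqEquiv i)]
  simpa [size] using Fintype.card_le_of_injective f hf

theorem card_relTuple_le : Fintype.card G.RelTuple ≤ G.size ^ n := by
  calc Fintype.card G.RelTuple ≤ Fintype.card (∀ i, G.Seq i) := Fintype.card_subtype_le _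
    _ = ∏ i, Fintype.card (G.Seq i) := Fintype.card_pi
    _ ≤ ∏ _i : Fin n, G.size := Finset.prod_le_prod' fun i _ => card_seq_le i
    _ = G.size ^ n := by simp

theorem card_infoOf_le (i : Fin n) : Fintype.card (G.InfoOf i) ≤ G.size :=
  (Fintype.card_subtype_le _).trans card_info_le

theorem card_nfcceVar_le :
    Fintype.card G.NFCCEVar ≤ G.size ^ n + (1 + n * (G.size + 1)) := by
  rw [Fintype.card_sum, Fintype.card_sum, Fintype.card_sigma, Fintype.card_unit]
  refine Nat.add_le_add card_relTuple_le (Nat.add_le_add le_rfl ?_)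
  calc ∑ i : Fin n, Fintype.card (Option (G.InfoOf i)) ≤ ∑ _i : Fin n, (G.size + 1) :=
        Finset.sum_le_sum fun i _ => by
          rw [Fintype.card_option]
          exact Nat.succ_le_succ (card_infoOf_le i)
    _ = n * (G.size + 1) := by simp

theorem card_efcceVar_le :
    Fintype.card G.EFCCEVar ≤ G.size ^ n + (1 + (G.size + G.size * (G.size + 1))) := by
  rw [Fintype.card_sum, Fintype.card_sum, Fintype.card_sum, Fintype.card_sigma, Fintype.card_unit]
  refine Nat.add_le_add card_relTuple_le (Nat.add_le_add le_rfl (Nat.add_le_add card_info_le ?_))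
  calc ∑ I : G.Info, Fintype.card (Option (G.InfoOf (G.player I)))
      ≤ ∑ _I : G.Info, (G.size + 1) :=
        Finset.sum_le_sum fun I _ => by
          rw [Fintype.card_option]
          exact Nat.succ_le_succ (card_infoOf_le _)
    _ = Fintype.card G.Info * (G.size + 1) := by simp
    _ ≤ G.size * (G.size + 1) := Nat.mul_le_mul_right _ card_info_le

theorem card_nfcceConstraints_le :
    Fintype.card (Fin n ⊕ (Σ i, G.Seq i) ⊕ Unit) ≤ n + (n * G.size + 1) := by
  rw [Fintype.card_sum, Fintype.card_sum, Fintype.card_sigma, Fintype.card_unit, Fintype.card_fin]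
  refine Nat.add_le_add le_rfl (Nat.add_le_add ?_ le_rfl)
  calc ∑ i : Fin n, Fintype.card (G.Seq i) ≤ ∑ _i : Fin n, G.size :=
        Finset.sum_le_sum fun i _ => card_seq_le i
    _ = n * G.size := by simp

theorem card_efcceConstraints_le :
    Fintype.card (G.Info ⊕ (Σ I : G.Info, G.Seq (G.player I)) ⊕ Unit) ≤
      G.size + (G.size * G.size + 1) := by
  rw [Fintype.card_sum, Fintype.card_sum, Fintype.card_sigma, Fintype.card_unit]
  refine Nat.add_le_add card_info_le (Nat.add_le_add ?_ le_rfl)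
  calc ∑ I : G.Info, Fintype.card (G.Seq (G.player I)) ≤ ∑ _I : G.Info, G.size :=
        Finset.sum_le_sum fun I _ => card_seq_le _
    _ = Fintype.card G.Info * G.size := by simp
    _ ≤ G.size * G.size := Nat.mul_le_mul_right _ card_info_le

/-- the value at a tuple of sequences, as a linear functional -/
def extendLinear (τ : ∀ i, G.Seq i) : (G.RelTuple → ℝ) →ₗ[ℝ] ℝ where
  toFun ξ := G.extend ξ τ
  map_add' ξ ξ' := by
    unfold extend
    split_ifs <;> simp
  map_smul' c ξ := by
    unfold extend
    split_ifs <;> simp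

theorem isSolutionSet_flowPolytope : IsSolutionSet G.flowPolytope
    (Fintype.card (G.RelTuple ⊕ Bool ⊕ (G.Info × G.RelTuple) × Bool)) := by
  let E : (G.RelTuple → ℝ) →ₗ[ℝ] ℝ := LinearMap.proj G.emptyTuple
  let C : G.Info × G.RelTuple → Prop := fun x => x.2.1 (G.player x.1) = G.parentSeq x.1 ∧
    ∀ a : G.acts x.1, ∀ i j, i ≠ j →
      G.Relevant (Function.update x.2.1 (G.player x.1) (G.moveSeq x.1 a) i)
        (Function.update x.2.1 (G.player x.1) (G.moveSeq x.1 a) j)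
  let B : G.Info × G.RelTuple → (G.RelTuple → ℝ) →ₗ[ℝ] ℝ := fun x => if C x then
    ∑ a : G.acts x.1, extendLinear (Function.update x.2.1 (G.player x.1) (G.moveSeq x.1 a)) -
      LinearMap.proj x.2 else 0
  have hB : ∀ x ξ, B x ξ = if C x then ∑ a : G.acts x.1,
      G.extend ξ (Function.update x.2.1 (G.player x.1) (G.moveSeq x.1 a)) - ξ x.2 else 0 := by
    intro x ξ
    simp only [B]
    split_ifs
    · simp [extendLinear]
    · rfl
  refine isSolutionSet_of
    (Sum.elim (fun t => LinearMap.proj t) (Sum.elim (fun b => if b then E else -E)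
      fun x => if x.2 then B x.1 else -B x.1))
    (Sum.elim 0 (Sum.elim (fun b => if b then 1 else -1) 0)) fun ξ => ?_
  simp only [Sum.forall, Sum.elim_inl, Sum.elim_inr, Bool.forall_bool, Prod.forall]
  simp only [if_true, Bool.false_eq_true, if_false, LinearMap.neg_apply, hB, Pi.zero_apply]
  constructor
  · rintro ⟨h1, h2, h3⟩
    refine ⟨h1, ⟨neg_le_neg h2.le, h2.ge⟩, fun I t => ?_⟩
    by_cases hC : C (I, t)
    · rw [if_pos hC, h3 I t hC.1 hC.2]
      simp
    · simp [hC]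
  · rintro ⟨h1, ⟨h2, h3⟩, h4⟩
    refine ⟨h1, le_antisymm (neg_le_neg_iff.1 h2) h3, fun I t ht hr => ?_⟩
    have hC : C (I, t) := ⟨ht, hr⟩
    have := h4 I t
    rw [if_pos hC] at this
    linarith [this.1, this.2]

theorem card_flowConstraints_le :
    Fintype.card (G.RelTuple ⊕ Bool ⊕ (G.Info × G.RelTuple) × Bool) ≤
      G.size ^ n + (2 + G.size * G.size ^ n * 2) := by
  rw [Fintype.card_sum, Fintype.card_sum, Fintype.card_prod, Fintype.card_prod, Fintype.card_bool]
  gcongr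
  · exact card_relTuple_le
  · exact card_info_le
  · exact card_relTuple_le

/-! ### The saddle-point problems -/

theorem corrPolytope_nonempty : G.corrPolytope.Nonempty := by
  rw [corrPolytope_eq_convexHull]
  exact (Set.range_nonempty _).convexHull

theorem nfcceDomain_eq : G.nfcceDomain = {p | p.1 ∈ stdSimplex ℝ (Fin n) ∧
    ∀ i, p.2 i ∈ p.1 i • convexHull ℝ (Set.range (planVec : G.Plan i → _))} := by
  simp only [← seqForm_eq_convexHull]
  rfl

theorem efcceDomain_eq : G.efcceDomain = {p | p.1 ∈ stdSimplex ℝ G.Info ∧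
    ∀ I, p.2 I ∈ p.1 I • convexHull ℝ (Set.range (trigVec I))} := by
  simp only [← seqForm_sep_eq]
  rfl

theorem exists_bilinear_nfcceObj :
    ∃ B : (G.RelTuple → ℝ) →ₗ[ℝ] ((Fin n → ℝ) × (∀ i, G.Seq i → ℝ)) →ₗ[ℝ] ℝ,
      ∀ ξ p, G.nfcceObj ξ p = B ξ p := ⟨weightedForm G.matA G.vecB, fun _ _ => rfl⟩

theorem exists_bilinear_efcceObj :
    ∃ B : (G.RelTuple → ℝ) →ₗ[ℝ]
        ((G.Info → ℝ) × (∀ I : G.Info, G.Seq (G.player I) → ℝ)) →ₗ[ℝ] ℝ,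
      ∀ ξ p, G.efcceObj ξ p = B ξ p := ⟨weightedForm G.trigA G.trigB, fun _ _ => rfl⟩

theorem isPolytope_nfcceDomain : IsPolytope G.nfcceDomain := by
  rw [nfcceDomain_eq, weighted_eq_convexHull]
  exact isPolytope_convexHull_range _

theorem isPolytope_efcceDomain : IsPolytope G.efcceDomain := by
  rw [efcceDomain_eq, weighted_eq_convexHull]
  exact isPolytope_convexHull_range _

section NFCCE

variable [Nonempty (Fin n)]

theorem isGreatest_nfcceObj (ξ : G.RelTuple → ℝ) : IsGreatest (G.nfcceObj ξ '' G.nfcceDomain)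
    (maxBenefit G.matA G.vecB (fun _ => planVec) ξ) := by
  rw [nfcceDomain_eq]
  exact isGreatest_weightedForm G.matA G.vecB (fun _ => planVec) ξ

theorem nfcceInner_eq : G.nfcceInner = maxBenefit G.matA G.vecB fun _ => planVec :=
  funext fun ξ => (isGreatest_nfcceObj ξ).csSup_eq

theorem nfccePlans_eq_inner : G.nfccePlans = {ξ ∈ G.corrPolytope | G.nfcceInner ξ ≤ 0} := by
  simp only [nfccePlans_eq, nfcceInner_eq, maxBenefit_le_iff]

theorem continuous_nfcceInner : Continuous G.nfcceInner :=
  nfcceInner_eq (G := G) ▸ continuous_maxBenefit _ _ _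

theorem isGreatest_deviation (μ : (∀ i, G.Plan i) → ℝ) :
    IsGreatest {d | ∃ i, ∃ ν ∈ G.PlanDist i, d = G.deviationUtility μ i ν - G.utility μ i}
      (G.nfcceInner (G.corrPlan μ)) := by
  rw [deviation_set_eq, nfcceInner_eq]
  exact isGreatest_benefit _ _ _ _

theorem isNFCCE_iff_inner {μ : (∀ i, G.Plan i) → ℝ} (hμ : μ ∈ G.CorrDist) :
    G.IsNFCCE μ ↔ G.nfcceInner (G.corrPlan μ) ≤ 0 := by
  rw [isNFCCE_iff hμ, nfcceInner_eq, maxBenefit_le_iff]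

theorem isLeast_nfcceDual (ξ : G.RelTuple → ℝ) :
    IsLeast {u | ∃ v, G.NFCCEDual ξ u v} (G.nfcceInner ξ) := by
  simp only [exists_nfcceDual_iff, nfcceInner_eq]
  exact isLeast_maxBenefit _ _ (fun _ => planVec) ξ

end NFCCE

section EFCCE

variable [Nonempty G.Info]

theorem isGreatest_efcceObj (ξ : G.RelTuple → ℝ) : IsGreatest (G.efcceObj ξ '' G.efcceDomain)
    (maxBenefit G.trigA G.trigB trigVec ξ) := by
  rw [efcceDomain_eq]
  exact isGreatest_weightedForm G.trigA G.trigB trigVec ξ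

theorem efcceInner_eq : G.efcceInner = maxBenefit G.trigA G.trigB trigVec :=
  funext fun ξ => (isGreatest_efcceObj ξ).csSup_eq

theorem efccePlans_eq_inner : G.efccePlans = {ξ ∈ G.corrPolytope | G.efcceInner ξ ≤ 0} := by
  simp only [efccePlans_eq, efcceInner_eq, maxBenefit_le_iff]

theorem continuous_efcceInner : Continuous G.efcceInner :=
  efcceInner_eq (G := G) ▸ continuous_maxBenefit _ _ _

theorem isGreatest_trigger (μ : (∀ i, G.Plan i) → ℝ) :
    IsGreatest {d | ∃ I, ∃ ν ∈ G.triggerDist I,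
      d = G.triggerUtility μ I ν - G.utility μ (G.player I)} (G.efcceInner (G.corrPlan μ)) := by
  rw [trigger_set_eq, efcceInner_eq]
  exact isGreatest_benefit _ _ _ _

theorem isEFCCE_iff_inner {μ : (∀ i, G.Plan i) → ℝ} (hμ : μ ∈ G.CorrDist) :
    G.IsEFCCE μ ↔ G.efcceInner (G.corrPlan μ) ≤ 0 := by
  rw [isEFCCE_iff hμ, efcceInner_eq, maxBenefit_le_iff]

theorem isLeast_efcceDual (ξ : G.RelTuple → ℝ) :
    IsLeast {u | ∃ w v, G.EFCCEDual ξ u w v} (G.efcceInner ξ) := by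
  simp only [exists_efcceDual_iff, efcceInner_eq]
  exact isLeast_maxBenefit _ _ trigVec ξ

end EFCCE

theorem exists_isSolutionSet_corrPolytope : ∃ m, IsSolutionSet G.corrPolytope m := by
  rw [corrPolytope_eq_convexHull]
  exact exists_isSolutionSet_convexHull_range _

theorem exists_mem_argmaxOn_nfccePlans (c : G.RelTuple → ℝ) :
    (argmaxOn (fun ξ => c ⬝ᵥ ξ) G.nfccePlans).Nonempty := by
  refine exists_mem_argmaxOn ?_ nfccePlans_nonempty (continuous_const.dotProduct continuous_id)
  rw [nfccePlans_eq]
  exact isCompact_setOf_benefit_le G.matA G.vecB fun _ => planVec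

theorem exists_mem_argmaxOn_efccePlans (c : G.RelTuple → ℝ) :
    (argmaxOn (fun ξ => c ⬝ᵥ ξ) G.efccePlans).Nonempty := by
  refine exists_mem_argmaxOn ?_ efccePlans_nonempty (continuous_const.dotProduct continuous_id)
  rw [efccePlans_eq]
  exact isCompact_setOf_benefit_le G.trigA G.trigB trigVec

theorem nonempty_argminOn_of_plans {m : (G.RelTuple → ℝ) → ℝ} (hm : Continuous m)
    (h : {ξ ∈ G.corrPolytope | m ξ ≤ 0}.Nonempty) :
    (argminOn m G.corrPolytope).Nonempty ∧
      argminOn m G.corrPolytope ⊆ {ξ ∈ G.corrPolytope | m ξ ≤ 0} :=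
  ⟨exists_mem_argminOn isCompact_corrPolytope corrPolytope_nonempty hm,
    argminOn_subset subset_rfl h⟩

theorem exists_polynomial_size (n : ℕ) : ∃ P : Polynomial ℕ, ∀ G : ExtensiveGame n,
    Fintype.card G.NFCCEVar ≤ P.eval G.size ∧ Fintype.card G.EFCCEVar ≤ P.eval G.size ∧
    ∀ k, IsSolutionSet G.corrPolytope k →
      (∃ m ≤ k + P.eval G.size, IsSolutionSet G.nfcceLP m) ∧
      (∃ m ≤ k + P.eval G.size, IsSolutionSet G.efcceLP m) := by
  refine ⟨.X ^ n + (1 + .C n * (.X + 1)) + (1 + (.X + .X * (.X + 1))) +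
    (.C n + (.C n * .X + 1)), fun G => ?_⟩
  simp only [Polynomial.eval_add, Polynomial.eval_mul, Polynomial.eval_pow, Polynomial.eval_X,
    Polynomial.eval_C, Polynomial.eval_one]
  have h1 := card_nfcceVar_le (G := G)
  have h2 := card_efcceVar_le (G := G)
  have h3 := card_nfcceConstraints_le (G := G)
  have h4 := card_efcceConstraints_le (G := G)
  refine ⟨by omega, by omega, fun k hk => ⟨⟨_, ?_, isSolutionSet_nfcceLP hk⟩,
    ⟨_, ?_, isSolutionSet_efcceLP hk⟩⟩⟩
  · omega
  · rw [mul_add G.size, mul_one]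
    omega

theorem exists_polynomial_noChance : ∃ P : Polynomial ℕ, ∀ G : ExtensiveGame 2, G.NoChance →
    G.corrPolytope = G.flowPolytope ∧
    (∃ k ≤ P.eval G.size, IsSolutionSet G.corrPolytope k) ∧
    (∃ m ≤ P.eval G.size, IsSolutionSet G.nfcceLP m) ∧
    (∃ m ≤ P.eval G.size, IsSolutionSet G.efcceLP m) := by
  obtain ⟨P, hP⟩ := exists_polynomial_size 2
  refine ⟨.X ^ 2 + (2 + .X * .X ^ 2 * 2) + P, fun G hc => ?_⟩
  have hflow := corrPolytope_eq_flowPolytope hc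
  have hsol : IsSolutionSet G.corrPolytope _ := hflow ▸ isSolutionSet_flowPolytope
  have hk := card_flowConstraints_le (G := G)
  obtain ⟨⟨m, hm, hm'⟩, ⟨m', hm2, hm2'⟩⟩ := (hP G).2.2 _ hsol
  have he : (.X ^ 2 + (2 + .X * .X ^ 2 * 2) + P : Polynomial ℕ).eval G.size =
      G.size ^ 2 + (2 + G.size * G.size ^ 2 * 2) + P.eval G.size := by
    simp
  rw [he]
  exact ⟨hflow, ⟨_, hk.trans (Nat.le_add_right _ _), hsol⟩, ⟨m, hm.trans (by omega), hm'⟩,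
    ⟨m', hm2.trans (by omega), hm2'⟩⟩

end ExtensiveGame
end

theorem mainTheorem4 :
    -- NFCCE
    (∀ n : ℕ, 0 < n → ∀ G : ExtensiveGame n,
      -- a bilinear saddle-point problem over two polytopes
      IsPolytope G.corrPolytope ∧ IsPolytope G.nfcceDomain ∧
      (∃ B : (G.RelTuple → ℝ) →ₗ[ℝ] ((Fin n → ℝ) × (∀ i, G.Seq i → ℝ)) →ₗ[ℝ] ℝ,
        ∀ ξ p, G.nfcceObj ξ p = B ξ p) ∧
      (∀ ξ, IsGreatest (G.nfcceObj ξ '' G.nfcceDomain) (G.nfcceInner ξ)) ∧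
      -- its inner value is the maximum deviation benefit, and characterizes NFCCE
      (∀ μ ∈ G.CorrDist,
        IsGreatest {d | ∃ i, ∃ ν ∈ G.PlanDist i, d = G.deviationUtility μ i ν - G.utility μ i}
          (G.nfcceInner (G.corrPlan μ))) ∧
      (∀ μ ∈ G.CorrDist, G.IsNFCCE μ ↔ G.nfcceInner (G.corrPlan μ) ≤ 0) ∧
      (∀ μ ∈ G.CorrDist, G.IsNFCCE μ ↔ G.corrPlan μ ∈ G.nfccePlans) ∧
      -- social welfare is linear in the correlation plan
      (∀ μ ∈ G.CorrDist, G.welfare μ = (∑ i, G.vecB i) ⬝ᵥ G.corrPlan μ) ∧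
      -- solutions of the saddle-point problem
      (argminOn G.nfcceInner G.corrPolytope).Nonempty ∧
      argminOn G.nfcceInner G.corrPolytope ⊆ G.nfccePlans ∧
      (∀ (c : G.RelTuple → ℝ) (τ : ℝ), (∃ ξ ∈ G.nfccePlans, τ ≤ c ⬝ᵥ ξ) →
        (argminOn G.nfcceInner (G.corrPolytope ∩ {ξ | τ ≤ c ⬝ᵥ ξ})).Nonempty ∧
        argminOn G.nfcceInner (G.corrPolytope ∩ {ξ | τ ≤ c ⬝ᵥ ξ}) ⊆ G.nfccePlans) ∧
      (∀ c : G.RelTuple → ℝ, (argmaxOn (fun ξ => c ⬝ᵥ ξ) G.nfccePlans).Nonempty ∧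
        ∀ ξ₀ ∈ argmaxOn (fun ξ => c ⬝ᵥ ξ) G.nfccePlans,
          (argminOn G.nfcceInner (G.corrPolytope ∩ {ξ | c ⬝ᵥ ξ₀ ≤ c ⬝ᵥ ξ})).Nonempty ∧
          argminOn G.nfcceInner (G.corrPolytope ∩ {ξ | c ⬝ᵥ ξ₀ ≤ c ⬝ᵥ ξ}) ⊆
            argmaxOn (fun ξ => c ⬝ᵥ ξ) G.nfccePlans) ∧
      -- strong duality for the inner maximization
      (∀ ξ, IsLeast {u | ∃ v, G.NFCCEDual ξ u v} (G.nfcceInner ξ)) ∧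
      -- the linear program
      (∃ m, IsSolutionSet G.nfcceLP m) ∧
      (fun x t => x (Sum.inl t)) '' G.nfcceLP = G.nfccePlans ∧
      (∀ c : G.RelTuple → ℝ,
        (argmaxOn (fun x => c ⬝ᵥ fun t => x (Sum.inl t)) G.nfcceLP).Nonempty ∧
        (fun x t => x (Sum.inl t)) '' argmaxOn (fun x => c ⬝ᵥ fun t => x (Sum.inl t)) G.nfcceLP =
          argmaxOn (fun ξ => c ⬝ᵥ ξ) G.nfccePlans)) ∧
    -- EFCCE
    (∀ n : ℕ, 0 < n → ∀ G : ExtensiveGame n,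
      (∀ μ ∈ G.CorrDist, G.IsEFCCE μ ↔ G.corrPlan μ ∈ G.efccePlans) ∧
      (Nonempty G.Info →
        -- a bilinear saddle-point problem over two polytopes
        IsPolytope G.efcceDomain ∧
        (∃ B : (G.RelTuple → ℝ) →ₗ[ℝ]
            ((G.Info → ℝ) × (∀ I : G.Info, G.Seq (G.player I) → ℝ)) →ₗ[ℝ] ℝ,
          ∀ ξ p, G.efcceObj ξ p = B ξ p) ∧
        (∀ ξ, IsGreatest (G.efcceObj ξ '' G.efcceDomain) (G.efcceInner ξ)) ∧
        -- its inner value is the maximum deviation benefit, and characterizes EFCCE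
        (∀ μ ∈ G.CorrDist,
          IsGreatest {d | ∃ I, ∃ ν ∈ G.triggerDist I,
            d = G.triggerUtility μ I ν - G.utility μ (G.player I)} (G.efcceInner (G.corrPlan μ))) ∧
        (∀ μ ∈ G.CorrDist, G.IsEFCCE μ ↔ G.efcceInner (G.corrPlan μ) ≤ 0) ∧
        -- solutions of the saddle-point problem
        (argminOn G.efcceInner G.corrPolytope).Nonempty ∧
        argminOn G.efcceInner G.corrPolytope ⊆ G.efccePlans ∧
        (∀ (c : G.RelTuple → ℝ) (τ : ℝ), (∃ ξ ∈ G.efccePlans, τ ≤ c ⬝ᵥ ξ) →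
          (argminOn G.efcceInner (G.corrPolytope ∩ {ξ | τ ≤ c ⬝ᵥ ξ})).Nonempty ∧
          argminOn G.efcceInner (G.corrPolytope ∩ {ξ | τ ≤ c ⬝ᵥ ξ}) ⊆ G.efccePlans) ∧
        (∀ c : G.RelTuple → ℝ, ∀ ξ₀ ∈ argmaxOn (fun ξ => c ⬝ᵥ ξ) G.efccePlans,
          (argminOn G.efcceInner (G.corrPolytope ∩ {ξ | c ⬝ᵥ ξ₀ ≤ c ⬝ᵥ ξ})).Nonempty ∧
          argminOn G.efcceInner (G.corrPolytope ∩ {ξ | c ⬝ᵥ ξ₀ ≤ c ⬝ᵥ ξ}) ⊆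
            argmaxOn (fun ξ => c ⬝ᵥ ξ) G.efccePlans) ∧
        -- strong duality for the inner maximization
        (∀ ξ, IsLeast {u | ∃ w v, G.EFCCEDual ξ u w v} (G.efcceInner ξ))) ∧
      -- the linear program
      (∃ m, IsSolutionSet G.efcceLP m) ∧
      (fun x t => x (Sum.inl t)) '' G.efcceLP = G.efccePlans ∧
      (∀ c : G.RelTuple → ℝ,
        (argmaxOn (fun ξ => c ⬝ᵥ ξ) G.efccePlans).Nonempty ∧
        (argmaxOn (fun x => c ⬝ᵥ fun t => x (Sum.inl t)) G.efcceLP).Nonempty ∧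
        (fun x t => x (Sum.inl t)) '' argmaxOn (fun x => c ⬝ᵥ fun t => x (Sum.inl t)) G.efcceLP =
          argmaxOn (fun ξ => c ⬝ᵥ ξ) G.efccePlans)) ∧
    -- polynomially many variables, and polynomially many constraints besides those of `Ξ`
    (∀ n : ℕ, 0 < n → ∃ P : Polynomial ℕ, ∀ G : ExtensiveGame n,
      Fintype.card G.NFCCEVar ≤ P.eval G.size ∧ Fintype.card G.EFCCEVar ≤ P.eval G.size ∧
      ∀ k, IsSolutionSet G.corrPolytope k →
        (∃ m ≤ k + P.eval G.size, IsSolutionSet G.nfcceLP m) ∧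
        (∃ m ≤ k + P.eval G.size, IsSolutionSet G.efcceLP m)) ∧
    -- polynomially many constraints in two-player games without chance moves
    (∃ P : Polynomial ℕ, ∀ G : ExtensiveGame 2, G.NoChance →
      G.corrPolytope = G.flowPolytope ∧
      (∃ k ≤ P.eval G.size, IsSolutionSet G.corrPolytope k) ∧
      (∃ m ≤ P.eval G.size, IsSolutionSet G.nfcceLP m) ∧
      (∃ m ≤ P.eval G.size, IsSolutionSet G.efcceLP m)) := by
  refine ⟨?_, ?_, fun n _ => ExtensiveGame.exists_polynomial_size n,
    ExtensiveGame.exists_polynomial_noChance⟩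
  · intro n hn G
    have : Nonempty (Fin n) := ⟨⟨0, hn⟩⟩
    have hinner := ExtensiveGame.nfcceInner_eq (G := G)
    have hplans := ExtensiveGame.nfccePlans_eq_inner (G := G)
    have hcont := ExtensiveGame.continuous_nfcceInner (G := G)
    have hne := ExtensiveGame.nfccePlans_nonempty (G := G)
    have hmin := ExtensiveGame.nonempty_argminOn_of_plans hcont (hplans ▸ hne)
    obtain ⟨k, hk⟩ := ExtensiveGame.exists_isSolutionSet_corrPolytope (G := G)
    refine ⟨?_, ExtensiveGame.isPolytope_nfcceDomain, ExtensiveGame.exists_bilinear_nfcceObj,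
      fun ξ => hinner ▸ ExtensiveGame.isGreatest_nfcceObj ξ,
      fun μ _ => ExtensiveGame.isGreatest_deviation μ,
      fun μ hμ => ExtensiveGame.isNFCCE_iff_inner hμ,
      fun μ hμ => ExtensiveGame.isNFCCE_iff_mem hμ, fun μ _ => ExtensiveGame.welfare_eq μ, hmin.1,
      hplans ▸ hmin.2, fun c τ h => ?_, fun c => ⟨ExtensiveGame.exists_mem_argmaxOn_nfccePlans c,
      fun ξ₀ h => ?_⟩, ExtensiveGame.isLeast_nfcceDual, ⟨_, ExtensiveGame.isSolutionSet_nfcceLP hk⟩,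
      ExtensiveGame.image_nfcceLP, fun c => ?_⟩
    · rw [ExtensiveGame.corrPolytope_eq_convexHull]
      exact isPolytope_convexHull_range _
    · rw [hplans] at h ⊢
      exact argminOn_inter_halfSpace ExtensiveGame.isCompact_corrPolytope hcont c τ h
    · rw [hplans] at h ⊢
      exact argminOn_inter_argmaxOn ExtensiveGame.isCompact_corrPolytope hcont c ξ₀ h
    · have himage := image_argmaxOn_comp (fun (x : G.NFCCEVar → ℝ) t => x (Sum.inl t))
        (fun ξ => c ⬝ᵥ ξ) G.nfcceLP
      rw [ExtensiveGame.image_nfcceLP] at himage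
      refine ⟨Set.Nonempty.of_image (f := fun (x : G.NFCCEVar → ℝ) t => x (Sum.inl t)) ?_, himage⟩
      rw [himage]
      exact ExtensiveGame.exists_mem_argmaxOn_nfccePlans c
  · intro n _ G
    obtain ⟨k, hk⟩ := ExtensiveGame.exists_isSolutionSet_corrPolytope (G := G)
    refine ⟨fun μ hμ => ExtensiveGame.isEFCCE_iff_mem hμ, fun _ => ?_,
      ⟨_, ExtensiveGame.isSolutionSet_efcceLP hk⟩, ExtensiveGame.image_efcceLP, fun c =>
      ⟨ExtensiveGame.exists_mem_argmaxOn_efccePlans c, ?_⟩⟩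
    · have hinner := ExtensiveGame.efcceInner_eq (G := G)
      have hplans := ExtensiveGame.efccePlans_eq_inner (G := G)
      have hcont := ExtensiveGame.continuous_efcceInner (G := G)
      have hne := ExtensiveGame.efccePlans_nonempty (G := G)
      have hmin := ExtensiveGame.nonempty_argminOn_of_plans hcont (hplans ▸ hne)
      refine ⟨ExtensiveGame.isPolytope_efcceDomain,
        ExtensiveGame.exists_bilinear_efcceObj,
        fun ξ => hinner ▸ ExtensiveGame.isGreatest_efcceObj ξ,
        fun μ _ => ExtensiveGame.isGreatest_trigger μ,
        fun μ hμ => ExtensiveGame.isEFCCE_iff_inner hμ,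
        hmin.1, hplans ▸ hmin.2, fun c τ h => ?_, fun c ξ₀ h => ?_,
        ExtensiveGame.isLeast_efcceDual⟩
      · rw [hplans] at h ⊢
        exact argminOn_inter_halfSpace ExtensiveGame.isCompact_corrPolytope hcont c τ h
      · rw [hplans] at h ⊢
        exact argminOn_inter_argmaxOn ExtensiveGame.isCompact_corrPolytope hcont c ξ₀ h
    · have himage := image_argmaxOn_comp (fun (x : G.EFCCEVar → ℝ) t => x (Sum.inl t))
        (fun ξ => c ⬝ᵥ ξ) G.efcceLP
      rw [ExtensiveGame.image_efcceLP] at himage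
      refine ⟨Set.Nonempty.of_image (f := fun (x : G.EFCCEVar → ℝ) t => x (Sum.inl t)) ?_, himage⟩
      rw [himage]
      exact ExtensiveGame.exists_mem_argmaxOn_efccePlans c
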